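/- Let $\alpha\in(0,\pi/2)$ and $F^{(\alpha)}=\{x\in\mathbb R^2: x_2>-|x_1|\tan\alpha\}$, a sector of vertex angle $\pi+2\alpha$; let $W_1^{(\alpha)}=F^{(\alpha)}\times(-1,0)\subset\mathbb R^3$ be the layer of unit depth under the free surface $F=F^{(\alpha)}\times\{0\}$. Let $W_c\subset\mathbb R^3$ be a bounded set (possibly empty) such that $W=W_1^{(\alpha)}\cup W_c$ is open and connected, and such that every point $(x,y)\in W_c$ with $y\ge-1$ satisfies $x\notin F^{(\alpha)}$. Thus, above the level $y=-1$, the set $W_c$ lies in the cape, between the vertical half-planes through the coastline (the open parts of these half-planes through which $W_c$ and the layer communicate are included in $W_c$); below the level $y=-1$ it is arbitrary; and the bottom $F^{(\alpha)}\times\{-1\}$ of the layer is rigid, that is, disjoint from $W$. Tunnels through the cape are allowed. Let $\nu>0$ and let $\phi\in H^1(W)$ be real-valued. Consider the weak form of the water-wave problem ($\nabla^2\phi=0$ in $W$, $\phi_y=\nu\phi$ on $F$, $\partial\phi/\partial n=0$ on $\partial W\setminus\overline F$), $$\int_W\nabla\phi\cdot\nabla\psi\,dx\,dy=\nu\int_F\phi\,\psi\,dx,\qquad(*)$$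 where the values on $F$ are taken in the sense of traces. 1. If $(*)$ holds for all $\psi\in H^1(W)$, then $\phi=0$ almost everywhere in $W$. 2. If, except possibly at finitely many points, the boundary of $W$ is locally the graph of a Lipschitz function with $W$ on one side of it, and if $(*)$ holds for all restrictions $\psi$ to $\overline W$ of smooth compactly supported functions on $\mathbb R^3$, then $\phi=0$ almost everywhere in $W$. In other words, there are no trapped modes: no $\nu>0$ is an eigenvalue of the problem. -/

import Mathlib

open Set Filter Topology MeasureTheory
open scoped ContDiff

namespace WaterWaves

/-- Points `(x, y)` of three-dimensional space: `x = (x₁, x₂)` is the horizontal part and `y` the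
vertical coordinate. Only topology, boundedness, Lebesgue measure, partial derivatives and local
Lipschitz graphs are used below, and none of them depends on the choice of a norm. -/
abbrev Pt : Type := (ℝ × ℝ) × ℝ

/-- The coordinate vectors of the axes `x₁`, `x₂`, `y`. -/
def axis : Fin 3 → Pt := ![((1, 0), 0), ((0, 1), 0), ((0, 0), 1)]

/-- The infinite sector `x₂ > -|x₁| tan α`, whose vertex angle is `π + 2α`. -/
def sector (α : ℝ) : Set (ℝ × ℝ) := {x | -|x.1| * Real.tan α < x.2}

/-- The layer of depth one under the free surface `{(x, 0) : x ∈ sector α}`. -/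
def layer (α : ℝ) : Set Pt := {p | p.1 ∈ sector α ∧ p.2 ∈ Ioo (-1 : ℝ) 0}

/-- The water domain `W`: the union of the layer and the region `Wc` adjoining the cliff. -/
def waterDomain (α : ℝ) (Wc : Set Pt) : Set Pt := layer α ∪ Wc

/-- Admissible regions `Wc`. The region contains the parts of the coastal vertical half-planes
through which it communicates with the layer, so that the union with the layer is open.
A point of `Wc` lying at or above the level `y = -1` has its horizontal part outside the sector;
below this level there is no restriction. In particular the points `(x, -1)`, `x` in the sector,
do not belong to the water domain: they form the rigid bottom of the layer of constant depth. -/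
structure IsCliffRegion (α : ℝ) (Wc : Set Pt) : Prop where
  isOpen : IsOpen (waterDomain α Wc)
  isConnected : IsConnected (waterDomain α Wc)
  bounded : Bornology.IsBounded Wc
  confined : ∀ p ∈ Wc, -1 ≤ p.2 → p.1 ∉ sector α

/-- Near `p` the set `W` is the part of space lying below the graph of a Lipschitz function, in
suitable linear coordinates. -/
def IsLipschitzGraphNear (W : Set Pt) (p : Pt) : Prop :=
  ∃ U ∈ 𝓝 p, ∃ (T : Pt ≃L[ℝ] Pt) (K : NNReal) (f : ℝ × ℝ → ℝ),
    LipschitzWith K f ∧ ∀ q ∈ U, (q ∈ W ↔ (T q).2 < f (T q).1)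

/-- The boundary of `W` is locally a Lipschitz graph, with `W` on one side of it, except possibly
at finitely many points. -/
def HasLipschitzBoundary (W : Set Pt) : Prop :=
  ∃ E : Set Pt, E.Finite ∧ ∀ p ∈ frontier W \ E, IsLipschitzGraphNear W p

/-- `u ∈ H¹(W)`, and `g` is its weak gradient: `u` and the `g i` are square integrable over `W`,
and `g i` is the weak partial derivative of `u` along the `i`-th axis. -/
structure HasWeakGradient (W : Set Pt) (u : Pt → ℝ) (g : Fin 3 → Pt → ℝ) : Prop where
  memLp : MemLp u 2 (volume.restrict W)
  memLp_grad : ∀ i, MemLp (g i) 2 (volume.restrict W)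
  weak : ∀ i, ∀ η : Pt → ℝ, ContDiff ℝ ∞ η → HasCompactSupport η → tsupport η ⊆ W →
    ∫ p in W, u p * fderiv ℝ η p (axis i) = - ∫ p in W, g i p * η p

/-- The Sobolev space `H¹(W)` of real-valued functions. -/
def MemH1 (W : Set Pt) (u : Pt → ℝ) : Prop := ∃ g, HasWeakGradient W u g

/-- `t ∈ L²` is the trace of `u` on the free surface: the mean over `-ε < y < 0` of the squared
`L²(sector α)` distance between `u (·, y)` and `t` tends to zero as `ε → 0+`. -/
structure HasTrace (α : ℝ) (u : Pt → ℝ) (t : ℝ × ℝ → ℝ) : Prop where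
  memLp : MemLp t 2 (volume.restrict (sector α))
  tendsto : Tendsto
    (fun ε : ℝ => ε⁻¹ * ∫ p in sector α ×ˢ Ioo (-ε) 0, (u p - t p.1) ^ 2) (𝓝[>] 0) (𝓝 0)

/-- Weak solutions in `H¹` of the water-wave problem, with test functions from all of `H¹`:
`∫_W ∇φ · ∇ψ = ν ∫_F φ ψ` for every `ψ ∈ H¹(W)`. -/
def IsWeakSolution (α : ℝ) (Wc : Set Pt) (ν : ℝ) (φ : Pt → ℝ) : Prop :=
  ∃ (g : Fin 3 → Pt → ℝ) (t : ℝ × ℝ → ℝ),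
    HasWeakGradient (waterDomain α Wc) φ g ∧ HasTrace α φ t ∧
    ∀ (ψ : Pt → ℝ) (h : Fin 3 → Pt → ℝ) (s : ℝ × ℝ → ℝ),
      HasWeakGradient (waterDomain α Wc) ψ h → HasTrace α ψ s →
      ∫ p in waterDomain α Wc, ∑ i, g i p * h i p = ν * ∫ x in sector α, t x * s x

/-- Weak solutions in `H¹` of the water-wave problem, with smooth test functions:
`∫_W ∇φ · ∇ψ = ν ∫_F φ ψ` for every restriction `ψ` to the closure of `W` of a smooth compactly
supported function on space. -/
def IsSmoothlyTestedWeakSolution (α : ℝ) (Wc : Set Pt) (ν : ℝ) (φ : Pt → ℝ) : Prop :=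
  ∃ (g : Fin 3 → Pt → ℝ) (t : ℝ × ℝ → ℝ),
    HasWeakGradient (waterDomain α Wc) φ g ∧ HasTrace α φ t ∧
    ∀ ψ : Pt → ℝ, ContDiff ℝ ∞ ψ → HasCompactSupport ψ →
      ∫ p in waterDomain α Wc, ∑ i, g i p * fderiv ℝ ψ p (axis i) =
        ν * ∫ x in sector α, t x * ψ (x, 0)

end WaterWaves

open WaterWaves

/-! Let `k > 0` solve the dispersion relation `ν = k tanh k`, and project the solution onto the
vertical profile that can propagate: `u(x) = ∫ cosh(k(y+1)) φ(x,y) dy` for `x` in the sector.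
Testing with `χ(x) cosh(k(y+1))`, extended from the layer by zero, shows that `u` is a square
integrable weak solution of `Δu + k²u = 0` in the sector (`integral_layer_weak_helmholtz`). Since
the vertex angle exceeds `π`, a Rellich-type theorem forces `u = 0`
(`ae_eq_zero_of_weak_helmholtz`). Integrating `sinh(k(y+1)) φ_y` along a vertical line then leaves
only the surface value `sinh k · φ(x,0)`, and the Cauchy–Schwarz inequality gives `ν ∫ φ² ≤ ½ ∫
φ_y²` (`integral_sq_trace_le`). With `ψ = φ` the energy is at most half of itself, so `φ` is
constant on the connected set `W`, and the constant vanishes because its integral against the cosh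
profile does.

The Rellich theorem rests on Green's form of `u` (mollified, hence smooth and bounded) and a plane
wave `exp(-ikr cos(θ-φ))` of complex direction `θ`, integrated over a ray of angle `φ`. Over a
finite segment this is entire in `θ`. For real `θ`, two rays of the sector give values differing by
an arc integral, which tends to zero along suitable radii because `u` and its gradient are square
integrable. For `θ` off the real axis the wave decays along the rays with `sin(Re θ - φ) Im θ > 0`,
and the integrals converge. Hence the limit from above along one ray and the limit from below along
another continue each other analytically (`exists_analytic_glue`). The angle being greater than `π`,
every direction has a decaying ray on either side, so that all the limits form one entire function.
It has period `2π` and is bounded, hence constant by Liouville's theorem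
(`exists_rayLimit_eq_const`). Comparing the directions `φ + τ` and `φ - τ` cancels the normal
derivative and shows that the Laplace transform of `u` along each ray vanishes on a vertical line;
Fourier inversion gives `u = 0`.

The second claim is reduced to the first. The residual of the equation is a bounded linear
functional on `H¹(W)`, the surface term being rewritten as an integral over the layer. A functional
that vanishes on smooth compactly supported functions vanishes on `H¹(W)`
(`HasLipschitzBoundary.pairing_eq_zero`): one truncates, cuts off infinity and the exceptional
points, which have zero capacity, localises, and mollifies with kernels shifted along an inward
cone. -/

section Gluing

/-! ### Analytic continuation across a segment by Cauchy integrals. -/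

open Complex

namespace WaterWaves

/-- The integral of `h` over the boundary of the rectangle `[a, b] × [c, d]`. -/
noncomputable def rectIntegral (a b c d : ℝ) (h : ℂ → ℂ) : ℂ :=
  (∫ x in a..b, h (x + c * I)) - (∫ x in a..b, h (x + d * I))
    + I * (∫ y in c..d, h (b + y * I)) - I * (∫ y in c..d, h (a + y * I))

theorem rectIntegral_congr {a b c d : ℝ} (hab : a ≤ b) (hcd : c ≤ d) {h h' : ℂ → ℂ}
    (H : ∀ z : ℂ, z.re ∈ Icc a b → z.im ∈ Icc c d →
      (z.re = a ∨ z.re = b ∨ z.im = c ∨ z.im = d) → h z = h' z) :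
    rectIntegral a b c d h = rectIntegral a b c d h' := by
  unfold rectIntegral
  congr 1
  · congr 1
    · congr 1
      · refine intervalIntegral.integral_congr fun x hx => H _ ?_ ?_ ?_ <;>
          rw [uIcc_of_le hab] at hx <;> simp_all
      · refine intervalIntegral.integral_congr fun x hx => H _ ?_ ?_ ?_ <;>
          rw [uIcc_of_le hab] at hx <;> simp_all
    · congr 1
      refine intervalIntegral.integral_congr fun x hx => H _ ?_ ?_ ?_ <;>
          rw [uIcc_of_le hcd] at hx <;> simp_all
  · congr 1
    refine intervalIntegral.integral_congr fun x hx => H _ ?_ ?_ ?_ <;>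
          rw [uIcc_of_le hcd] at hx <;> simp_all

theorem rectIntegral_eq_zero {a b c d : ℝ} (hab : a ≤ b) (hcd : c ≤ d) {h : ℂ → ℂ}
    (H : DifferentiableOn ℂ h (Icc a b ×ℂ Icc c d)) : rectIntegral a b c d h = 0 := by
  have := Complex.integral_boundary_rect_eq_zero_of_differentiableOn h (a + c * I) (b + d * I)
    (by simpa [uIcc_of_le hab, uIcc_of_le hcd] using H)
  simpa [rectIntegral] using this

/-- Cauchy's theorem for the difference quotient of an entire function. -/
theorem rectIntegral_quotient_eq_zero {a b c d : ℝ} (hab : a ≤ b) (hcd : c ≤ d) {f : ℂ → ℂ}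
    (hf : Differentiable ℂ f) {w v : ℂ}
    (hw : (w ∈ Ioo a b ×ℂ Ioo c d ∧ v = f w) ∨ w ∉ Icc a b ×ℂ Icc c d) :
    rectIntegral a b c d (fun z => (f z - v) / (z - w)) = 0 := by
  rcases hw with ⟨hw, rfl⟩ | hw
  -- `dslope f w` is entire, the singularity at `w` being removable, and on the sides, which avoid
  -- `w`, it is the quotient.
  · rw [rectIntegral_congr hab hcd (h' := dslope f w)]
    · refine rectIntegral_eq_zero hab hcd (DifferentiableOn.mono (t := univ) ?_ (subset_univ _))
      rw [Complex.differentiableOn_dslope univ_mem]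
      exact hf.differentiableOn
    · intro z _ _ hz
      have hzw : z ≠ w := by
        rintro rfl
        rw [Complex.mem_reProdIm] at hw
        obtain ⟨⟨h1, h2⟩, h3, h4⟩ := hw
        rcases hz with h | h | h | h <;> linarith
      rw [dslope_of_ne _ hzw, slope_def_field]
  · refine rectIntegral_eq_zero hab hcd fun z hz => ?_
    have hzw : z - w ≠ 0 := sub_ne_zero.2 (by rintro rfl; exact hw hz)
    exact (((hf z).sub_const v).div ((differentiableAt_id).sub_const w) hzw).differentiableWithinAt

theorem intervalIntegrable_div_sub {Φ : ℝ → ℂ} {γ : ℝ → ℂ} {l r C δ : ℝ} {w : ℂ}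
    (hγ : Continuous γ) (hΦ : AEStronglyMeasurable Φ (volume.restrict (uIoc l r)))
    (hC : ∀ t ∈ uIoc l r, ‖Φ t‖ ≤ C) (hδ : 0 < δ) (hw : ∀ t ∈ uIoc l r, δ ≤ ‖γ t - w‖) :
    IntervalIntegrable (fun t => Φ t / (γ t - w)) volume l r := by
  rw [intervalIntegrable_iff]
  refine IntegrableOn.of_bound (by simp [uIoc]) ?_ (C / δ) ?_
  · exact (hΦ.aemeasurable.div
      (hγ.sub continuous_const).measurable.aemeasurable).aestronglyMeasurable
  · refine (ae_restrict_iff' measurableSet_uIoc).2 (.of_forall fun t ht => ?_)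
    rw [norm_div]
    exact div_le_div₀ ((norm_nonneg _).trans (hC t ht)) (hC t ht) hδ (hw t ht)

theorem tendsto_integral_div_sub {Φ : ℕ → ℝ → ℂ} {Ψ γ : ℝ → ℂ} {l r C δ : ℝ} {w : ℂ}
    (hγ : Continuous γ) (hΦ : ∀ n, Measurable (Φ n))
    (hC : ∀ n, ∀ t ∈ uIoc l r, ‖Φ n t‖ ≤ C)
    (hlim : ∀ᵐ t, t ∈ uIoc l r → Tendsto (fun n => Φ n t) atTop (𝓝 (Ψ t)))
    (hδ : 0 < δ) (hw : ∀ t ∈ uIoc l r, δ ≤ ‖γ t - w‖) :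
    Tendsto (fun n => ∫ t in l..r, Φ n t / (γ t - w)) atTop
      (𝓝 (∫ t in l..r, Ψ t / (γ t - w))) := by
  refine intervalIntegral.tendsto_integral_filter_of_dominated_convergence (fun _ => C / δ)
    (.of_forall fun n => ?_) (.of_forall fun n => .of_forall fun t ht => ?_)
    intervalIntegrable_const ?_
  · exact ((hΦ n).div (hγ.sub continuous_const).measurable).aestronglyMeasurable
  · rw [norm_div]
    exact div_le_div₀ ((norm_nonneg _).trans (hC n t ht)) (hC n t ht) hδ (hw t ht)
  · filter_upwards [hlim] with t ht h using (ht h).div_const _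

theorem differentiableAt_integral_div_sub {Ψ γ : ℝ → ℂ} {l r C δ : ℝ} {w : ℂ}
    (hγ : Continuous γ) (hΨ : AEStronglyMeasurable Ψ (volume.restrict (uIoc l r)))
    (hC : ∀ᵐ t, t ∈ uIoc l r → ‖Ψ t‖ ≤ C)
    (hδ : 0 < δ) (hw : ∀ t ∈ uIoc l r, δ ≤ ‖γ t - w‖) :
    DifferentiableAt ℂ (fun w => ∫ t in l..r, Ψ t / (γ t - w)) w := by
  have hne : ∀ t ∈ uIoc l r, ∀ x ∈ Metric.ball w (δ / 2), δ / 2 ≤ ‖γ t - x‖ := by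
    intro t ht x hx
    have h1 := hw t ht
    have h2 : ‖x - w‖ < δ / 2 := by simpa [dist_eq_norm] using hx
    have h3 : ‖γ t - w‖ ≤ ‖γ t - x‖ + ‖x - w‖ := by
      simpa using norm_add_le (γ t - x) (x - w)
    linarith
  have hmeas : ∀ x, AEStronglyMeasurable (fun t => Ψ t / (γ t - x))
      (volume.restrict (uIoc l r)) := fun x =>
    (hΨ.aemeasurable.div
      (hγ.sub continuous_const).measurable.aemeasurable).aestronglyMeasurable
  have key := intervalIntegral.hasDerivAt_integral_of_dominated_loc_of_deriv_le
    (μ := volume) (a := l) (b := r)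
    (F := fun x t => Ψ t / (γ t - x)) (F' := fun x t => Ψ t / (γ t - x) ^ 2) (x₀ := w)
    (s := Metric.ball w (δ / 2)) (bound := fun _ => C / (δ / 2) ^ 2)
    (Metric.ball_mem_nhds _ (by positivity)) (.of_forall hmeas) ?_ ?_ ?_
    intervalIntegrable_const ?_
  · exact key.2.differentiableAt
  · rw [intervalIntegrable_iff]
    refine IntegrableOn.of_bound (by simp [uIoc]) (hmeas w) (C / δ) ?_
    refine (ae_restrict_iff' measurableSet_uIoc).2 ?_
    filter_upwards [hC] with t hC ht
    rw [norm_div]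
    exact div_le_div₀ ((norm_nonneg _).trans (hC ht)) (hC ht) hδ (hw t ht)
  · exact (hΨ.aemeasurable.div
      ((hγ.sub continuous_const).pow 2).measurable.aemeasurable).aestronglyMeasurable
  · filter_upwards [hC] with t hC ht x hx
    rw [norm_div, norm_pow]
    exact div_le_div₀ ((norm_nonneg _).trans (hC ht)) (hC ht) (by positivity)
      (pow_le_pow_left₀ (by positivity) (hne t ht x hx) 2)
  · refine .of_forall fun t ht x hx => ?_
    have h0 : γ t - x ≠ 0 := by
      intro h
      have := hne t ht x hx
      rw [h, norm_zero] at this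
      linarith
    have := ((hasDerivAt_id x).const_sub (γ t)).inv h0
    simpa [div_eq_mul_inv] using this.const_mul (Ψ t)

theorem continuous_side_horizontal (d : ℝ) : Continuous fun t : ℝ => (t : ℂ) + d * I := by
  fun_prop

theorem continuous_side_vertical (a : ℝ) : Continuous fun t : ℝ => (a : ℂ) + t * I := by
  fun_prop

/-- The winding integral of a rectangle does not vanish at interior points. -/
theorem rectIntegral_inv_ne_zero {a b c d : ℝ} {w : ℂ} (hw : w ∈ Ioo a b ×ℂ Ioo c d) :
    rectIntegral a b c d (fun z => 1 / (z - w)) ≠ 0 := by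
  rw [Complex.mem_reProdIm] at hw
  obtain ⟨⟨h1, h2⟩, h3, h4⟩ := hw
  have him : ∀ {l r : ℝ} {f : ℝ → ℂ}, ContinuousOn f (uIcc l r) →
      (∫ t in l..r, f t).im = ∫ t in l..r, (f t).im := by
    intro l r f hf
    exact (Complex.imCLM.intervalIntegral_comp_comm hf.intervalIntegrable).symm
  have hre : ∀ {l r : ℝ} {f : ℝ → ℂ}, ContinuousOn f (uIcc l r) →
      (∫ t in l..r, f t).re = ∫ t in l..r, (f t).re := by
    intro l r f hf
    exact (Complex.reCLM.intervalIntegral_comp_comm hf.intervalIntegrable).symm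
  have hH : ∀ e : ℝ, e ≠ w.im → Continuous fun t : ℝ => 1 / ((t : ℂ) + e * I - w) := by
    intro e he
    refine continuous_const.div (by fun_prop) fun t h => he ?_
    have := congrArg Complex.im h
    simp at this
    linarith
  have hV : ∀ e : ℝ, e ≠ w.re → Continuous fun t : ℝ => 1 / ((e : ℂ) + t * I - w) := by
    intro e he
    refine continuous_const.div (by fun_prop) fun t h => he ?_
    have := congrArg Complex.re h
    simp at this
    linarith
  have hns : ∀ z : ℂ, z ≠ 0 → 0 < normSq z := fun z hz => normSq_pos.2 hz
  have pos : ∀ {l r : ℝ} {f : ℝ → ℝ}, l < r → Continuous f → (∀ t, 0 < f t) →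
      0 < ∫ t in l..r, f t := by
    intro l r f hlr hf hpos
    exact intervalIntegral.intervalIntegral_pos_of_pos (hf.intervalIntegrable _ _) hpos hlr
  -- The value `2πi` is not needed: in the imaginary part each of the four sides contributes a
  -- strictly positive amount.
  intro h0
  have h := congrArg Complex.im h0
  simp only [rectIntegral, Complex.sub_im, Complex.add_im, Complex.mul_im, Complex.I_re,
    Complex.I_im, zero_mul, one_mul, zero_add, Complex.zero_im] at h
  rw [him (hH c h3.ne).continuousOn, him (hH d h4.ne').continuousOn,
    hre (hV b h2.ne').continuousOn, hre (hV a h1.ne).continuousOn] at h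
  have e1 : 0 < ∫ t in a..b, (1 / ((t : ℂ) + c * I - w)).im := by
    refine pos (h1.trans h2) (Complex.continuous_im.comp (hH c h3.ne)) fun t => ?_
    have hz : (t : ℂ) + c * I - w ≠ 0 := fun h => h3.ne (by
      have := congrArg Complex.im h; simp at this; linarith)
    rw [one_div, Complex.inv_im]
    exact div_pos (by simp; linarith) (hns _ hz)
  have e2 : 0 < ∫ t in a..b, -(1 / ((t : ℂ) + d * I - w)).im := by
    refine pos (h1.trans h2) (Complex.continuous_im.comp (hH d h4.ne')).neg fun t => ?_
    have hz : (t : ℂ) + d * I - w ≠ 0 := fun h => h4.ne' (by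
      have := congrArg Complex.im h; simp at this; linarith)
    rw [one_div, Complex.inv_im, neg_div, neg_neg]
    exact div_pos (by simp; linarith) (hns _ hz)
  have e3 : 0 < ∫ t in c..d, (1 / ((b : ℂ) + t * I - w)).re := by
    refine pos (h3.trans h4) (Complex.continuous_re.comp (hV b h2.ne')) fun t => ?_
    have hz : (b : ℂ) + t * I - w ≠ 0 := fun h => h2.ne' (by
      have := congrArg Complex.re h; simp at this; linarith)
    rw [one_div, Complex.inv_re]
    exact div_pos (by simp; linarith) (hns _ hz)
  have e4 : 0 < ∫ t in c..d, -(1 / ((a : ℂ) + t * I - w)).re := by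
    refine pos (h3.trans h4) (Complex.continuous_re.comp (hV a h1.ne)).neg fun t => ?_
    have hz : (a : ℂ) + t * I - w ≠ 0 := fun h => h1.ne (by
      have := congrArg Complex.re h; simp at this; linarith)
    rw [one_div, Complex.inv_re, ← neg_div]
    exact div_pos (by simp; linarith) (hns _ hz)
  rw [intervalIntegral.integral_neg] at e2 e4
  linarith

/-- The function equal to `f` above the real axis and to `g` elsewhere. -/
noncomputable def glue (f g : ℂ → ℂ) (z : ℂ) : ℂ := if 0 < z.im then f z else g z

theorem measurable_glue {f g : ℂ → ℂ} (hf : Measurable f) (hg : Measurable g) :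
    Measurable (glue f g) :=
  Measurable.ite (measurableSet_lt measurable_const Complex.measurable_im) hf hg

/-- Cauchy's formula on a rectangle cut by the real axis, for a pair of entire functions. -/
theorem rectIntegral_glue_quotient {a b Y : ℝ} (hab : a < b) (hY : 0 < Y) {f g : ℂ → ℂ}
    (hf : Differentiable ℂ f) (hg : Differentiable ℂ g) {w v : ℂ}
    (hw : w ∈ Ioo a b ×ℂ Ioo (-Y) Y)
    (hv : (0 < w.im ∧ v = f w) ∨ (w.im < 0 ∧ v = g w)) :
    rectIntegral a b (-Y) Y (fun z => (glue f g z - v) / (z - w))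
      = ∫ x in a..b, (g x - f x) / (x - w) := by
  rw [Complex.mem_reProdIm] at hw
  obtain ⟨hw1, hw3, hw4⟩ := hw
  -- The same constant `v` serves both halves: it is the right value in the half containing `w`, and
  -- the other closed half does not contain `w`, so that any constant is allowed there.
  have hup : rectIntegral a b 0 Y (fun z => (f z - v) / (z - w)) = 0 := by
    refine rectIntegral_quotient_eq_zero hab.le hY.le hf ?_
    rcases hv with ⟨h, rfl⟩ | ⟨h, -⟩
    · exact Or.inl ⟨⟨hw1, h, hw4⟩, rfl⟩
    · exact Or.inr fun H => absurd H.2.1 (not_le.2 h)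
  have hlo : rectIntegral a b (-Y) 0 (fun z => (g z - v) / (z - w)) = 0 := by
    refine rectIntegral_quotient_eq_zero hab.le (by linarith) hg ?_
    rcases hv with ⟨h, -⟩ | ⟨h, rfl⟩
    · exact Or.inr fun H => absurd H.2.2 (not_le.2 h)
    · exact Or.inl ⟨⟨hw1, hw3, h⟩, rfl⟩
  have hwim : w.im ≠ 0 := by rcases hv with ⟨h, -⟩ | ⟨h, -⟩; exacts [h.ne', h.ne]
  have hV : ∀ e : ℝ, e ≠ w.re → ∀ F : ℂ → ℂ, Differentiable ℂ F →
      Continuous fun t : ℝ => (F ((e : ℂ) + t * I) - v) / ((e : ℂ) + t * I - w) := by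
    intro e he F hF
    have hFc := hF.continuous
    refine Continuous.div (by fun_prop) (by fun_prop) fun t h => he ?_
    have := congrArg Complex.re h
    simp at this
    linarith
  have split : ∀ e : ℝ, e ≠ w.re →
      (∫ t in (-Y)..Y, (glue f g ((e : ℂ) + t * I) - v) / ((e : ℂ) + t * I - w))
      = (∫ t in (-Y)..0, (g ((e : ℂ) + t * I) - v) / ((e : ℂ) + t * I - w))
        + ∫ t in (0 : ℝ)..Y, (f ((e : ℂ) + t * I) - v) / ((e : ℂ) + t * I - w) := by
    intro e he
    have c1 : ∀ t ∈ uIoc (-Y) 0, (g ((e : ℂ) + t * I) - v) / ((e : ℂ) + t * I - w)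
        = (glue f g ((e : ℂ) + t * I) - v) / ((e : ℂ) + t * I - w) := by
      intro t ht
      rw [uIoc_of_le (by linarith)] at ht
      simp [glue, not_lt.2 ht.2]
    have c2 : ∀ t ∈ uIoc 0 Y, (f ((e : ℂ) + t * I) - v) / ((e : ℂ) + t * I - w)
        = (glue f g ((e : ℂ) + t * I) - v) / ((e : ℂ) + t * I - w) := by
      intro t ht
      rw [uIoc_of_le hY.le] at ht
      simp [glue, ht.1]
    rw [intervalIntegral.integral_congr_ae (.of_forall c1),
      intervalIntegral.integral_congr_ae (.of_forall c2)]
    refine (intervalIntegral.integral_add_adjacent_intervals ?_ ?_).symm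
    · exact ((hV e he g hg).intervalIntegrable _ _).congr c1
    · exact ((hV e he f hf).intervalIntegrable _ _).congr c2
  have hb := split b hw1.2.ne'
  have ha := split a hw1.1.ne
  have hR : ∀ F : ℂ → ℂ, Differentiable ℂ F →
      Continuous fun t : ℝ => (F (t : ℂ) - v) / ((t : ℂ) - w) := by
    intro F hF
    have hFc := hF.continuous
    refine Continuous.div (by fun_prop) (by fun_prop) fun t h => hwim ?_
    have := congrArg Complex.im h
    simp at this
    exact this
  have htop : (∫ t in a..b, (glue f g ((t : ℂ) + Y * I) - v) / ((t : ℂ) + Y * I - w))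
      = ∫ t in a..b, (f ((t : ℂ) + Y * I) - v) / ((t : ℂ) + Y * I - w) := by
    congr 1; ext t; simp [glue, hY]
  have hbot : (∫ t in a..b, (glue f g ((t : ℂ) + (-Y : ℝ) * I) - v) / ((t : ℂ) + (-Y : ℝ) * I - w))
      = ∫ t in a..b, (g ((t : ℂ) + (-Y : ℝ) * I) - v) / ((t : ℂ) + (-Y : ℝ) * I - w) := by
    congr 1; ext t; simp [glue, not_lt.2 hY.le]
  have hdiff : (∫ x in a..b, (g x - f x) / ((x : ℂ) - w))
      = (∫ x in a..b, (g x - v) / ((x : ℂ) - w)) - ∫ x in a..b, (f x - v) / ((x : ℂ) - w) := by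
    rw [← intervalIntegral.integral_sub ((hR g hg).intervalIntegrable _ _)
      ((hR f hf).intervalIntegrable _ _)]
    congr 1; ext t; ring
  have z0 : ∀ t : ℝ, (t : ℂ) + ((0 : ℝ) : ℂ) * I = t := by intro t; simp
  simp only [rectIntegral, z0] at hup hlo ⊢
  rw [ha, hb, htop, hbot, hdiff]
  -- In the sum of the two halves the sides on the real axis do not cancel but leave the integral of
  -- `g - f`.
  linear_combination hup + hlo

/-- Two sequences of entire functions that approach each other on a real segment, and are locally
bounded and convergent above, respectively below it, have limits continuing each other
analytically. -/
theorem exists_analytic_glue {a b Y C : ℝ} (hab : a < b) (hY : 0 < Y) {f g : ℕ → ℂ → ℂ}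
    {F G : ℂ → ℂ} {ε : ℕ → ℝ} (hf : ∀ n, Differentiable ℂ (f n))
    (hg : ∀ n, Differentiable ℂ (g n))
    (hfC : ∀ n z, z.re ∈ Icc a b → 0 < z.im → z.im ≤ Y → ‖f n z‖ * z.im ≤ C)
    (hgC : ∀ n z, z.re ∈ Icc a b → z.im < 0 → -Y ≤ z.im → ‖g n z‖ * -z.im ≤ C)
    (hε : Tendsto ε atTop (𝓝 0)) (hfg : ∀ n, ∀ x ∈ Icc a b, ‖g n (x : ℝ) - f n (x : ℝ)‖ ≤ ε n)
    (hF : ∀ z : ℂ, z.re ∈ Icc a b → 0 < z.im → z.im ≤ Y →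
      Tendsto (fun n => f n z) atTop (𝓝 (F z)))
    (hG : ∀ z : ℂ, z.re ∈ Icc a b → z.im < 0 → -Y ≤ z.im →
      Tendsto (fun n => g n z) atTop (𝓝 (G z))) :
    ∃ h : ℂ → ℂ, DifferentiableOn ℂ h (Ioo a b ×ℂ Ioo (-Y) Y) ∧
      ∀ z ∈ Ioo a b ×ℂ Ioo (-Y) Y, (0 < z.im → h z = F z) ∧ (z.im < 0 → h z = G z) := by
  -- Near the real axis the sequences may grow like `1 / |Im z|`. The factor `m` vanishes where the
  -- vertical sides cross the axis, which makes the integrands bounded on the whole boundary,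
  -- uniformly in `n`.
  set m : ℂ → ℂ := fun z => (z - a) * (z - b) with hm
  have hmd : Differentiable ℂ m := by fun_prop
  set f' : ℕ → ℂ → ℂ := fun n z => m z * f n z with hf'
  set g' : ℕ → ℂ → ℂ := fun n z => m z * g n z with hg'
  have hfd : ∀ n, Differentiable ℂ (f' n) := fun n => hmd.mul (hf n)
  have hgd : ∀ n, Differentiable ℂ (g' n) := fun n => hmd.mul (hg n)
  set Φ : ℕ → ℂ → ℂ := fun n => glue (f' n) (g' n) with hΦ
  set Ψ : ℂ → ℂ := glue (fun z => m z * F z) (fun z => m z * G z) with hΨ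
  have hΦm : ∀ n, Measurable (Φ n) := fun n =>
    measurable_glue (hfd n).continuous.measurable (hgd n).continuous.measurable
  have hlim : ∀ z : ℂ, z.re ∈ Icc a b → z.im ∈ Icc (-Y) Y → z.im ≠ 0 →
      Tendsto (fun n => Φ n z) atTop (𝓝 (Ψ z)) := by
    intro z h1 h2 h3
    rcases lt_or_gt_of_ne h3 with h | h
    · simp only [hΦ, hΨ, glue, not_lt.2 h.le, if_false]
      exact (hG z h1 h h2.1).const_mul _
    · simp only [hΦ, hΨ, glue, h, if_true]
      exact (hF z h1 h h2.2).const_mul _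
  have hC0 : 0 ≤ C := (mul_nonneg (norm_nonneg _) hY.le).trans
    (by simpa using hfC 0 ((a : ℂ) + Y * I) (by simp [hab.le]) (by simpa using hY) (by simp))
  set L := b - a + Y with hL
  have hLpos : 0 < L := by simp only [hL]; linarith
  have hmn : ∀ n (z : ℂ) (M : ℝ), z.re ∈ Icc a b → z.im ∈ Icc (-Y) Y → 0 ≤ M → z.im ≠ 0 →
      ‖m z‖ ≤ M * |z.im| → ‖Φ n z‖ ≤ M * C := by
    intro n z M h1 h2 hM h3 h4
    rcases lt_or_gt_of_ne h3 with h | h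
    · simp only [hΦ, glue, not_lt.2 h.le, if_false, hg', norm_mul]
      rw [abs_of_neg h] at h4
      calc ‖m z‖ * ‖g n z‖ ≤ M * -z.im * ‖g n z‖ := by gcongr
        _ = M * (‖g n z‖ * -z.im) := by ring
        _ ≤ M * C := by gcongr; exact hgC n z h1 h h2.1
    · simp only [hΦ, glue, h, if_true, hf', norm_mul]
      rw [abs_of_pos h] at h4
      calc ‖m z‖ * ‖f n z‖ ≤ M * z.im * ‖f n z‖ := by gcongr
        _ = M * (‖f n z‖ * z.im) := by ring
        _ ≤ M * C := by gcongr; exact hfC n z h1 h h2.2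
  have hfac : ∀ z : ℂ, z.re ∈ Icc a b → z.im ∈ Icc (-Y) Y → ∀ e ∈ Icc a b, ‖z - (e : ℝ)‖ ≤ L := by
    intro z h1 h2 e he
    refine (Complex.norm_le_abs_re_add_abs_im _).trans ?_
    have : |z.re - e| ≤ b - a := abs_sub_le_of_le_of_le h1.1 h1.2 he.1 he.2
    have : |z.im| ≤ Y := abs_le.2 h2
    simp only [Complex.sub_re, Complex.ofReal_re, Complex.sub_im, Complex.ofReal_im, sub_zero]
    linarith
  set K := L * C + L * L / Y * C with hK
  have hK1 : L * C ≤ K := by have : 0 ≤ L * L / Y * C := by positivity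
                             linarith
  have hK2 : L * L / Y * C ≤ K := by have : 0 ≤ L * C := by positivity
                                     linarith
  have hK0 : 0 ≤ K := by positivity
  have haI : a ∈ Icc a b := left_mem_Icc.2 hab.le
  have hbI : b ∈ Icc a b := right_mem_Icc.2 hab.le
  have bV : ∀ n, ∀ e ∈ ({a, b} : Set ℝ), ∀ t ∈ uIoc (-Y) Y, ‖Φ n ((e : ℂ) + t * I)‖ ≤ K := by
    intro n e he t ht
    rw [uIoc_of_le (by linarith)] at ht
    have heI : e ∈ Icc a b := by rcases he with rfl | rfl <;> assumption
    have htI : ((e : ℂ) + t * I).im ∈ Icc (-Y) Y := by simp [ht.1.le, ht.2]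
    have hz : ((e : ℂ) + t * I).re ∈ Icc a b := by simpa using heI
    have hmz : ‖m ((e : ℂ) + t * I)‖ ≤ L * |((e : ℂ) + t * I).im| := by
      rcases he with rfl | rfl
      · have := hfac _ hz htI b hbI
        simp only [hm, norm_mul]
        rw [mul_comm]
        gcongr
        simp
      · have := hfac _ hz htI a haI
        simp only [hm, norm_mul]
        gcongr
        simp
    by_cases h0 : t = 0
    · subst h0
      have : m ((e : ℂ) + (0 : ℝ) * I) = 0 := by simpa using hmz
      have h2 : Φ n ((e : ℂ) + (0 : ℝ) * I) = 0 := by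
        simp only [hΦ, glue, hf', hg', this, zero_mul, ite_self]
      rw [h2, norm_zero]
      exact hK0
    · exact (hmn n _ L hz htI hLpos.le (by simpa using h0) hmz).trans hK1
  have bH : ∀ n, ∀ d ∈ ({-Y, Y} : Set ℝ), ∀ t ∈ uIoc a b, ‖Φ n ((t : ℂ) + d * I)‖ ≤ K := by
    intro n d hd t ht
    rw [uIoc_of_le hab.le] at ht
    have hz : ((t : ℂ) + d * I).re ∈ Icc a b := by simp [ht.1.le, ht.2]
    have hdY : |d| = Y := by rcases hd with rfl | rfl <;> simp [abs_of_pos hY]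
    have htI : ((t : ℂ) + d * I).im ∈ Icc (-Y) Y := by
      exact abs_le.1 (by simp [hdY])
    refine (hmn n _ (L * L / Y) hz htI (by positivity) ?_ ?_).trans hK2
    · have : d ≠ 0 := by rintro rfl; simp at hdY; linarith
      simpa using this
    · have e1 : |((t : ℂ) + d * I).im| = Y := by simp [hdY]
      rw [e1, div_mul_cancel₀ _ hY.ne']
      simp only [hm, norm_mul]
      exact mul_le_mul (hfac _ hz htI a haI) (hfac _ hz htI b hbI) (norm_nonneg _) hLpos.le
  -- limits along the sides
  have lV : ∀ e ∈ ({a, b} : Set ℝ), ∀ᵐ t : ℝ, t ∈ uIoc (-Y) Y →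
      Tendsto (fun n => Φ n ((e : ℂ) + t * I)) atTop (𝓝 (Ψ ((e : ℂ) + t * I))) := by
    intro e he
    filter_upwards [compl_mem_ae_iff.2 (measure_singleton (0 : ℝ))] with t ht0 ht
    rw [uIoc_of_le (by linarith)] at ht
    refine hlim _ ?_ (by simp [ht.1.le, ht.2]) (by simpa using ht0)
    have : e ∈ Icc a b := by rcases he with rfl | rfl <;> assumption
    simpa using this
  have lH : ∀ d ∈ ({-Y, Y} : Set ℝ), ∀ᵐ t : ℝ, t ∈ uIoc a b →
      Tendsto (fun n => Φ n ((t : ℂ) + d * I)) atTop (𝓝 (Ψ ((t : ℂ) + d * I))) := by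
    intro d hd
    refine .of_forall fun t ht => ?_
    rw [uIoc_of_le hab.le] at ht
    have hdY : |d| = Y := by rcases hd with rfl | rfl <;> simp [abs_of_pos hY]
    have hd0 : d ≠ 0 := by rintro rfl; simp at hdY; linarith
    refine hlim _ (by simp [ht.1.le, ht.2]) ?_ (by simpa using hd0)
    exact abs_le.1 (by simp [hdY])
  have side : ∀ (γ : ℝ → ℂ) (l r : ℝ), Continuous γ → (∀ n, ∀ t ∈ uIoc l r, ‖Φ n (γ t)‖ ≤ K) →
      (∀ᵐ t : ℝ, t ∈ uIoc l r → Tendsto (fun n => Φ n (γ t)) atTop (𝓝 (Ψ (γ t)))) →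
      ∀ (w : ℂ) (δ : ℝ), 0 < δ → (∀ t, δ ≤ ‖γ t - w‖) →
      Tendsto (fun n => ∫ t in l..r, Φ n (γ t) / (γ t - w)) atTop
          (𝓝 (∫ t in l..r, Ψ (γ t) / (γ t - w))) ∧
        DifferentiableAt ℂ (fun w => ∫ t in l..r, Ψ (γ t) / (γ t - w)) w := by
    intro γ l r hγ hb hl w δ hδ hw
    refine ⟨tendsto_integral_div_sub (Φ := fun n t => Φ n (γ t)) hγ
      (fun n => (hΦm n).comp hγ.measurable) hb hl hδ fun t _ => hw t,
      differentiableAt_integral_div_sub (C := K) hγ ?_ ?_ hδ fun t _ => hw t⟩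
    · refine aestronglyMeasurable_of_tendsto_ae atTop (f := fun n t => Φ n (γ t))
        (fun n => ((hΦm n).comp hγ.measurable).aestronglyMeasurable) ?_
      exact (ae_restrict_iff' measurableSet_uIoc).2 hl
    · filter_upwards [hl] with t ht h
      exact le_of_tendsto (ht h).norm (.of_forall fun n => hb n t h)
  have dV : ∀ (w : ℂ) (e : ℝ) (t : ℝ), |e - w.re| ≤ ‖(e : ℂ) + t * I - w‖ := by
    intro w e t
    simpa using Complex.abs_re_le_norm ((e : ℂ) + t * I - w)
  have dH : ∀ (w : ℂ) (d : ℝ) (t : ℝ), |d - w.im| ≤ ‖(t : ℂ) + d * I - w‖ := by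
    intro w d t
    simpa using Complex.abs_im_le_norm ((t : ℂ) + d * I - w)
  -- The continuation will be `H / (m N)`, the Cauchy integral of the limit divided by the winding
  -- integral; both are analytic inside the rectangle, including at real points.
  set N : ℂ → ℂ := fun w => rectIntegral a b (-Y) Y (fun z => 1 / (z - w)) with hN
  set H : ℂ → ℂ := fun w => rectIntegral a b (-Y) Y (fun z => Ψ z / (z - w)) with hH
  have rd : ∀ Θ : ℂ → ℂ, ∀ w : ℂ,
      DifferentiableAt ℂ (fun w => ∫ t in a..b, Θ ((t : ℂ) + (-Y : ℝ) * I) / ((t : ℂ) + (-Y : ℝ) * I - w)) w →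
      DifferentiableAt ℂ (fun w => ∫ t in a..b, Θ ((t : ℂ) + Y * I) / ((t : ℂ) + Y * I - w)) w →
      DifferentiableAt ℂ (fun w => ∫ t in (-Y)..Y, Θ ((b : ℂ) + t * I) / ((b : ℂ) + t * I - w)) w →
      DifferentiableAt ℂ (fun w => ∫ t in (-Y)..Y, Θ ((a : ℂ) + t * I) / ((a : ℂ) + t * I - w)) w →
      DifferentiableAt ℂ (fun w => rectIntegral a b (-Y) Y (fun z => Θ z / (z - w))) w := by
    intro Θ w h1 h2 h3 h4
    exact ((h1.sub h2).add (h3.const_mul I)).sub (h4.const_mul I)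
  have hpos : ∀ w ∈ Ioo a b ×ℂ Ioo (-Y) Y, 0 < |(-Y) - w.im| ∧ 0 < |Y - w.im| ∧
      0 < |b - w.re| ∧ 0 < |a - w.re| := by
    intro w hw
    rw [Complex.mem_reProdIm] at hw
    obtain ⟨⟨h1, h2⟩, h3, h4⟩ := hw
    refine ⟨?_, ?_, ?_, ?_⟩ <;> rw [abs_pos, sub_ne_zero]
    exacts [h3.ne, h4.ne', h2.ne', h1.ne]
  have hHd : ∀ w ∈ Ioo a b ×ℂ Ioo (-Y) Y, DifferentiableAt ℂ H w := by
    intro w hw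
    obtain ⟨p1, p2, p3, p4⟩ := hpos w hw
    refine rd Ψ w ?_ ?_ ?_ ?_
    · exact (side (fun t : ℝ => (t : ℂ) + (-Y : ℝ) * I) a b (continuous_side_horizontal _)
        (fun n => bH n _ (by simp)) (lH _ (by simp)) w _ p1 (dH w _)).2
    · exact (side (fun t : ℝ => (t : ℂ) + Y * I) a b (continuous_side_horizontal _)
        (fun n => bH n _ (by simp)) (lH _ (by simp)) w _ p2 (dH w _)).2
    · exact (side (fun t : ℝ => (b : ℂ) + t * I) (-Y) Y (continuous_side_vertical _)
        (fun n => bV n _ (by simp)) (lV _ (by simp)) w _ p3 (dV w _)).2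
    · exact (side (fun t : ℝ => (a : ℂ) + t * I) (-Y) Y (continuous_side_vertical _)
        (fun n => bV n _ (by simp)) (lV _ (by simp)) w _ p4 (dV w _)).2
  have hNd : ∀ w ∈ Ioo a b ×ℂ Ioo (-Y) Y, DifferentiableAt ℂ N w := by
    intro w hw
    obtain ⟨p1, p2, p3, p4⟩ := hpos w hw
    have one : ∀ (γ : ℝ → ℂ) (l r δ : ℝ), Continuous γ → 0 < δ → (∀ t, δ ≤ ‖γ t - w‖) →
        DifferentiableAt ℂ (fun w => ∫ t in l..r, (1 : ℂ) / (γ t - w)) w := by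
      intro γ l r δ hγ hδ hw
      exact differentiableAt_integral_div_sub (Ψ := fun _ => 1) (C := 1) hγ
        aestronglyMeasurable_const (by simp) hδ fun t _ => hw t
    refine rd (fun _ => 1) w ?_ ?_ ?_ ?_
    · exact one _ _ _ _ (continuous_side_horizontal _) p1 (dH w _)
    · exact one _ _ _ _ (continuous_side_horizontal _) p2 (dH w _)
    · exact one _ _ _ _ (continuous_side_vertical _) p3 (dV w _)
    · exact one _ _ _ _ (continuous_side_vertical _) p4 (dV w _)
  have hHlim : ∀ w ∈ Ioo a b ×ℂ Ioo (-Y) Y,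
      Tendsto (fun n => rectIntegral a b (-Y) Y (fun z => Φ n z / (z - w))) atTop (𝓝 (H w)) := by
    intro w hw
    obtain ⟨p1, p2, p3, p4⟩ := hpos w hw
    have t1 := (side (fun t : ℝ => (t : ℂ) + (-Y : ℝ) * I) a b (continuous_side_horizontal _)
        (fun n => bH n _ (by simp)) (lH _ (by simp)) w _ p1 (dH w _)).1
    have t2 := (side (fun t : ℝ => (t : ℂ) + Y * I) a b (continuous_side_horizontal _)
        (fun n => bH n _ (by simp)) (lH _ (by simp)) w _ p2 (dH w _)).1
    have t3 := (side (fun t : ℝ => (b : ℂ) + t * I) (-Y) Y (continuous_side_vertical _)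
        (fun n => bV n _ (by simp)) (lV _ (by simp)) w _ p3 (dV w _)).1
    have t4 := (side (fun t : ℝ => (a : ℂ) + t * I) (-Y) Y (continuous_side_vertical _)
        (fun n => bV n _ (by simp)) (lV _ (by simp)) w _ p4 (dV w _)).1
    exact ((t1.sub t2).add (t3.const_mul I)).sub (t4.const_mul I)
  have hlin : ∀ n (w v : ℂ), w ∈ Ioo a b ×ℂ Ioo (-Y) Y →
      rectIntegral a b (-Y) Y (fun z => (Φ n z - v) / (z - w))
        = rectIntegral a b (-Y) Y (fun z => Φ n z / (z - w)) - v * N w := by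
    intro n w v hw
    obtain ⟨p1, p2, p3, p4⟩ := hpos w hw
    have one : ∀ (γ : ℝ → ℂ) (l r δ : ℝ), Continuous γ → (∀ t ∈ uIoc l r, ‖Φ n (γ t)‖ ≤ K) →
        0 < δ → (∀ t, δ ≤ ‖γ t - w‖) →
        (∫ t in l..r, (Φ n (γ t) - v) / (γ t - w))
          = (∫ t in l..r, Φ n (γ t) / (γ t - w)) - v * ∫ t in l..r, 1 / (γ t - w) := by
      intro γ l r δ hγ hb hδ hw
      rw [← intervalIntegral.integral_const_mul, ← intervalIntegral.integral_sub]
      · congr 1; ext t; ring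
      · exact intervalIntegrable_div_sub hγ ((hΦm n).comp hγ.measurable).aestronglyMeasurable hb hδ
          fun t _ => hw t
      · exact (intervalIntegrable_div_sub (Φ := fun _ => 1) (C := 1) hγ aestronglyMeasurable_const
          (by simp) hδ fun t _ => hw t).const_mul v
    have t1 := one (fun t : ℝ => (t : ℂ) + (-Y : ℝ) * I) a b _ (continuous_side_horizontal _)
        (bH n _ (by simp)) p1 (dH w _)
    have t2 := one (fun t : ℝ => (t : ℂ) + Y * I) a b _ (continuous_side_horizontal _)
        (bH n _ (by simp)) p2 (dH w _)
    have t3 := one (fun t : ℝ => (b : ℂ) + t * I) (-Y) Y _ (continuous_side_vertical _)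
        (bV n _ (by simp)) p3 (dV w _)
    have t4 := one (fun t : ℝ => (a : ℂ) + t * I) (-Y) Y _ (continuous_side_vertical _)
        (bV n _ (by simp)) p4 (dV w _)
    simp only [hN, rectIntegral]
    rw [t1, t2, t3, t4]
    ring
  -- The jump across the real segment is at most a constant times `ε n`, and off the axis the Cauchy
  -- kernel is bounded by `1 / |Im w|`.
  have herr : ∀ w : ℂ, w.im ≠ 0 →
      Tendsto (fun n => ∫ x in a..b, (g' n x - f' n x) / ((x : ℂ) - w)) atTop (𝓝 0) := by
    intro w hw
    rw [tendsto_zero_iff_norm_tendsto_zero]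
    have hlim0 : Tendsto (fun n => L * L * ε n / |w.im| * |b - a|) atTop (𝓝 0) := by
      simpa using ((hε.const_mul (L * L)).div_const |w.im|).mul_const |b - a|
    refine squeeze_zero (fun _ => norm_nonneg _) (fun n => ?_) hlim0
    refine intervalIntegral.norm_integral_le_of_norm_le_const fun x hx => ?_
    rw [uIoc_of_le hab.le] at hx
    have hxI : x ∈ Icc a b := ⟨hx.1.le, hx.2⟩
    have h1 : g' n x - f' n x = m x * (g n x - f n x) := by simp only [hf', hg']; ring
    have h2 : ‖m (x : ℝ)‖ ≤ L * L := by
      simp only [hm, norm_mul]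
      exact mul_le_mul (hfac x (by simpa using hxI) (by simp [hY.le]) a haI)
        (hfac x (by simpa using hxI) (by simp [hY.le]) b hbI) (norm_nonneg _) hLpos.le
    have h3 : |w.im| ≤ ‖(x : ℂ) - w‖ := by simpa using Complex.abs_im_le_norm ((x : ℂ) - w)
    rw [h1, norm_div, norm_mul]
    have h4 := hfg n x hxI
    have : 0 ≤ ε n := (norm_nonneg _).trans h4
    exact div_le_div₀ (by positivity) (by gcongr) (abs_pos.2 hw) h3
  have key : ∀ w ∈ Ioo a b ×ℂ Ioo (-Y) Y, ∀ (v : ℕ → ℂ) (v0 : ℂ), Tendsto v atTop (𝓝 v0) →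
      (∀ n, (0 < w.im ∧ v n = f' n w) ∨ (w.im < 0 ∧ v n = g' n w)) → H w = v0 * N w := by
    intro w hw v v0 hv hvn
    have hw0 : w.im ≠ 0 := by rcases hvn 0 with ⟨h, -⟩ | ⟨h, -⟩; exacts [h.ne', h.ne]
    have h1 := (hHlim w hw).sub (hv.mul_const (N w))
    have h2 : (fun n => rectIntegral a b (-Y) Y (fun z => Φ n z / (z - w)) - v n * N w)
        = fun n => ∫ x in a..b, (g' n x - f' n x) / ((x : ℂ) - w) := by
      ext n
      rw [← hlin n w _ hw]
      exact rectIntegral_glue_quotient hab hY (hfd n) (hgd n) hw (hvn n)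
    rw [h2] at h1
    exact sub_eq_zero.1 (tendsto_nhds_unique h1 (herr w hw0))
  have hm0 : ∀ w ∈ Ioo a b ×ℂ Ioo (-Y) Y, m w ≠ 0 := by
    intro w hw
    obtain ⟨-, -, p3, p4⟩ := hpos w hw
    have : ∀ e : ℝ, 0 < |e - w.re| → w - e ≠ 0 := by
      intro e he h
      have := congrArg Complex.re h
      simp only [Complex.sub_re, Complex.ofReal_re, Complex.zero_re] at this
      rw [show e - w.re = 0 by linarith] at he
      simp at he
    exact mul_ne_zero (this a p4) (this b p3)
  refine ⟨fun w => H w / (m w * N w), fun w hw => ?_, fun w hw => ⟨fun h => ?_, fun h => ?_⟩⟩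
  · exact ((hHd w hw).div ((hmd w).mul (hNd w hw))
      (mul_ne_zero (hm0 w hw) (rectIntegral_inv_ne_zero hw))).differentiableWithinAt
  · have hwre : w.re ∈ Icc a b := ⟨hw.1.1.le, hw.1.2.le⟩
    simp only
    rw [key w hw (fun n => f' n w) (m w * F w) ((hF w hwre h hw.2.2.le).const_mul _)
      fun n => Or.inl ⟨h, rfl⟩]
    have := hm0 w hw
    have := rectIntegral_inv_ne_zero hw
    simp only [hN] at *
    field_simp
  · have hwre : w.re ∈ Icc a b := ⟨hw.1.1.le, hw.1.2.le⟩
    simp only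
    rw [key w hw (fun n => g' n w) (m w * G w) ((hG w hwre h hw.2.1.le).const_mul _)
      fun n => Or.inr ⟨h, rfl⟩]
    have := hm0 w hw
    have := rectIntegral_inv_ne_zero hw
    simp only [hN] at *
    field_simp

end WaterWaves

end Gluing

/-! ### Green's formula with plane waves of complex direction, in polar coordinates. -/

section Sector

open Complex

namespace WaterWaves

/-- A twice continuously differentiable function on the plane with its partial derivatives. -/
structure PlaneJet where
  V : ℝ × ℝ → ℝ
  Va : ℝ × ℝ → ℝ
  Vb : ℝ × ℝ → ℝ
  Vaa : ℝ × ℝ → ℝ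
  Vab : ℝ × ℝ → ℝ
  Vba : ℝ × ℝ → ℝ
  Vbb : ℝ × ℝ → ℝ
  hasFDerivAt : ∀ p, HasFDerivAt V
    (Va p • ContinuousLinearMap.fst ℝ ℝ ℝ + Vb p • ContinuousLinearMap.snd ℝ ℝ ℝ) p
  hasFDerivAt_a : ∀ p, HasFDerivAt Va
    (Vaa p • ContinuousLinearMap.fst ℝ ℝ ℝ + Vab p • ContinuousLinearMap.snd ℝ ℝ ℝ) p
  hasFDerivAt_b : ∀ p, HasFDerivAt Vb
    (Vba p • ContinuousLinearMap.fst ℝ ℝ ℝ + Vbb p • ContinuousLinearMap.snd ℝ ℝ ℝ) p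
  continuous_aa : Continuous Vaa
  continuous_bb : Continuous Vbb

namespace PlaneJet

variable (U : PlaneJet)

theorem differentiable_V : Differentiable ℝ U.V := fun p => (U.hasFDerivAt p).differentiableAt
theorem differentiable_Va : Differentiable ℝ U.Va := fun p => (U.hasFDerivAt_a p).differentiableAt
theorem differentiable_Vb : Differentiable ℝ U.Vb := fun p => (U.hasFDerivAt_b p).differentiableAt

/-- The values of the function in polar coordinates. -/
noncomputable def val (φ r : ℝ) : ℂ := (U.V (r * Real.cos φ, r * Real.sin φ) : ℝ)

/-- The radial derivative in polar coordinates. -/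
noncomputable def rad (φ r : ℝ) : ℂ :=
  (Real.cos φ * U.Va (r * Real.cos φ, r * Real.sin φ)
    + Real.sin φ * U.Vb (r * Real.cos φ, r * Real.sin φ) : ℝ)

/-- The derivative normal to the ray, in polar coordinates. -/
noncomputable def nrm (φ r : ℝ) : ℂ :=
  (-Real.sin φ * U.Va (r * Real.cos φ, r * Real.sin φ)
    + Real.cos φ * U.Vb (r * Real.cos φ, r * Real.sin φ) : ℝ)

theorem hasDerivAt_angle {f fa fb : ℝ × ℝ → ℝ} (hf : ∀ p, HasFDerivAt f
    (fa p • ContinuousLinearMap.fst ℝ ℝ ℝ + fb p • ContinuousLinearMap.snd ℝ ℝ ℝ) p) (φ r : ℝ) :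
    HasDerivAt (fun φ => f (r * Real.cos φ, r * Real.sin φ))
      (r * (-Real.sin φ * fa (r * Real.cos φ, r * Real.sin φ)
        + Real.cos φ * fb (r * Real.cos φ, r * Real.sin φ))) φ := by
  have h1 : HasDerivAt (fun φ => (r * Real.cos φ, r * Real.sin φ))
      (r * -Real.sin φ, r * Real.cos φ) φ :=
    ((Real.hasDerivAt_cos φ).const_mul r).prodMk ((Real.hasDerivAt_sin φ).const_mul r)
  have h2 := (hf (r * Real.cos φ, r * Real.sin φ)).comp_hasDerivAt φ h1
  refine h2.congr_deriv ?_
  simp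
  ring

theorem hasDerivAt_radius {f fa fb : ℝ × ℝ → ℝ} (hf : ∀ p, HasFDerivAt f
    (fa p • ContinuousLinearMap.fst ℝ ℝ ℝ + fb p • ContinuousLinearMap.snd ℝ ℝ ℝ) p) (φ r : ℝ) :
    HasDerivAt (fun r => f (r * Real.cos φ, r * Real.sin φ))
      (Real.cos φ * fa (r * Real.cos φ, r * Real.sin φ)
        + Real.sin φ * fb (r * Real.cos φ, r * Real.sin φ)) r := by
  have h1 : HasDerivAt (fun r => (r * Real.cos φ, r * Real.sin φ))
      (1 * Real.cos φ, 1 * Real.sin φ) r :=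
    ((hasDerivAt_id r).mul_const _).prodMk ((hasDerivAt_id r).mul_const _)
  have h2 := (hf (r * Real.cos φ, r * Real.sin φ)).comp_hasDerivAt r h1
  refine h2.congr_deriv ?_
  simp
  ring

/-- The plane wave with complex direction `θ`, in polar coordinates. -/
noncomputable def wave (k : ℝ) (θ : ℂ) (φ r : ℝ) : ℂ := exp (-(I * k * r * cos (θ - φ)))

/-- The density on a ray of Green's form of the function and a plane wave. -/
noncomputable def rayDensity (k : ℝ) (θ : ℂ) (φ r : ℝ) : ℂ :=
  (U.val φ r * -(I * k * sin (θ - φ)) - U.nrm φ r) * wave k θ φ r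

/-- The density on an arc of Green's form of the function and a plane wave. -/
noncomputable def arcDensity (k : ℝ) (θ : ℂ) (φ r : ℝ) : ℂ :=
  r * ((U.val φ r * -(I * k * cos (θ - φ)) - U.rad φ r) * wave k θ φ r)

theorem hasDerivAt_wave_angle (k : ℝ) (θ : ℂ) (φ r : ℝ) :
    HasDerivAt (fun φ => wave k θ φ r) (-(I * k * r * sin (θ - φ)) * wave k θ φ r) φ := by
  have h1 : HasDerivAt (fun φ : ℝ => θ - (φ : ℂ)) (-1) φ := by
    simpa using (hasDerivAt_id φ).ofReal_comp.const_sub θ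
  have h2 := ((Complex.hasDerivAt_cos (θ - φ)).comp φ h1).const_mul (-(I * k * r))
  have h3 := ((Complex.hasDerivAt_exp _).comp φ h2)
  refine (h3.congr_deriv ?_).congr_of_eventuallyEq (.of_forall fun x => ?_)
  · simp only [wave, Function.comp]; ring_nf
  · simp only [wave, Function.comp]; ring_nf

theorem hasDerivAt_wave_radius (k : ℝ) (θ : ℂ) (φ r : ℝ) :
    HasDerivAt (fun r => wave k θ φ r) (-(I * k * cos (θ - φ)) * wave k θ φ r) r := by
  have h1 : HasDerivAt (fun r : ℝ => (r : ℂ)) 1 r := by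
    simpa using (hasDerivAt_id r).ofReal_comp
  have h2 := h1.mul_const (-(I * k * cos (θ - φ)))
  have h3 := ((Complex.hasDerivAt_exp _).comp r h2)
  refine (h3.congr_deriv ?_).congr_of_eventuallyEq (.of_forall fun x => ?_)
  · simp only [wave]; ring_nf
  · simp only [wave, Function.comp]; ring_nf

/-- The Laplacian in polar coordinates, plus `k ^ 2` times the function. -/
noncomputable def helm (k φ r : ℝ) : ℝ :=
  U.Vaa (r * Real.cos φ, r * Real.sin φ) + U.Vbb (r * Real.cos φ, r * Real.sin φ)
    + k ^ 2 * U.V (r * Real.cos φ, r * Real.sin φ)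

/-- The polar divergence of the field `V ∇w - w ∇V`, `w` the plane wave: the wave solves the
Helmholtz equation, so only `-(ΔV + k²V) w` survives, multiplied by the Jacobian `r`. The mixed
second derivatives cancel individually, without using their symmetry. -/
theorem exists_hasDerivAt_densities (k : ℝ) (θ : ℂ) (φ r : ℝ) : ∃ x y : ℂ,
    HasDerivAt (fun φ => U.rayDensity k θ φ r) x φ ∧
    HasDerivAt (fun r => U.arcDensity k θ φ r) y r ∧
    y + x = -(r * U.helm k φ r * wave k θ φ r) := by
  have e1 : HasDerivAt (fun φ => U.val φ r) (r * U.nrm φ r) φ := by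
    refine (hasDerivAt_angle U.hasFDerivAt φ r).ofReal_comp.congr_deriv ?_
    simp [nrm]
  have e2 : HasDerivAt (fun r => U.val φ r) (U.rad φ r) r :=
    (hasDerivAt_radius U.hasFDerivAt φ r).ofReal_comp
  have a1 := hasDerivAt_angle U.hasFDerivAt_a φ r
  have a2 := hasDerivAt_radius U.hasFDerivAt_a φ r
  have b1 := hasDerivAt_angle U.hasFDerivAt_b φ r
  have b2 := hasDerivAt_radius U.hasFDerivAt_b φ r
  have e3 := (((Real.hasDerivAt_sin φ).neg.mul a1).add ((Real.hasDerivAt_cos φ).mul b1)).ofReal_comp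
  have e4 := ((a2.const_mul (Real.cos φ)).add (b2.const_mul (Real.sin φ))).ofReal_comp
  have h1 : HasDerivAt (fun φ : ℝ => θ - (φ : ℂ)) (-1) φ := by
    simpa using (hasDerivAt_id φ).ofReal_comp.const_sub θ
  have e5 := (((Complex.hasDerivAt_sin (θ - φ)).comp φ h1).const_mul (I * k)).neg
  have e6 := ((e1.mul e5).sub e3).mul (hasDerivAt_wave_angle k θ φ r)
  have h0 : HasDerivAt (fun r : ℝ => (r : ℂ)) 1 r := by
    simpa using (hasDerivAt_id r).ofReal_comp
  have e7 := h0.mul (((e2.mul_const (-(I * k * cos (θ - φ)))).sub e4).mul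
    (hasDerivAt_wave_radius k θ φ r))
  refine ⟨_, _, e6, e7, ?_⟩
  simp only [helm, rad, nrm, Function.comp, Pi.mul_apply, Pi.neg_apply, Pi.sub_apply, Pi.add_apply]
  push_cast
  have hs1 : cos (θ - φ) ^ 2 = 1 - sin (θ - φ) ^ 2 := by
    have := Complex.sin_sq_add_cos_sq (θ - φ); linear_combination this
  have hs2 : cos (φ : ℂ) ^ 2 = 1 - sin (φ : ℂ) ^ 2 := by
    have := Complex.sin_sq_add_cos_sq (φ : ℂ); linear_combination this
  have hI : I ^ 2 = -1 := Complex.I_sq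
  have hv : U.val φ r = (U.V (r * Real.cos φ, r * Real.sin φ) : ℝ) := rfl
  linear_combination
    (I ^ 2 * k ^ 2 * r * U.val φ r * wave k θ φ r) * hs1
      + (k ^ 2 * r * U.val φ r * wave k θ φ r) * hI
      - (r * (U.Vaa (r * Real.cos φ, r * Real.sin φ) + U.Vbb (r * Real.cos φ, r * Real.sin φ))
        * wave k θ φ r) * hs2
      - (k ^ 2 * r * wave k θ φ r) * hv

theorem differentiable_polar {f : ℝ × ℝ → ℝ} (hf : Differentiable ℝ f) :
    Differentiable ℝ fun x : ℝ × ℝ => f (x.1 * Real.cos x.2, x.1 * Real.sin x.2) :=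
  hf.comp (g := f) (by fun_prop)

theorem differentiable_densities (k : ℝ) (θ : ℂ) :
    (Differentiable ℝ fun x : ℝ × ℝ => U.rayDensity k θ x.2 x.1) ∧
    Differentiable ℝ fun x : ℝ × ℝ => U.arcDensity k θ x.2 x.1 := by
  have h0 := differentiable_polar U.differentiable_V
  have ha := differentiable_polar U.differentiable_Va
  have hb := differentiable_polar U.differentiable_Vb
  have ho : ∀ {f : ℝ × ℝ → ℝ}, Differentiable ℝ f → Differentiable ℝ fun x => (f x : ℂ) :=
    fun hf => Complex.ofRealCLM.differentiable.comp hf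
  have hv : Differentiable ℝ fun x : ℝ × ℝ => U.val x.2 x.1 := ho h0
  have hr : Differentiable ℝ fun x : ℝ × ℝ => U.rad x.2 x.1 := ho (by fun_prop)
  have hn : Differentiable ℝ fun x : ℝ × ℝ => U.nrm x.2 x.1 := ho (by fun_prop)
  have h1 : Differentiable ℝ fun x : ℝ × ℝ => (x.1 : ℂ) := ho differentiable_fst
  have h2 : Differentiable ℝ fun x : ℝ × ℝ => (x.2 : ℂ) := ho differentiable_snd
  have hcos : Differentiable ℝ fun x : ℝ × ℝ => cos (θ - x.2) :=
    (show Differentiable ℝ cos from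
      (show Differentiable ℂ cos from Complex.differentiable_cos).restrictScalars ℝ).comp
      (h2.const_sub θ)
  have hsin : Differentiable ℝ fun x : ℝ × ℝ => sin (θ - x.2) :=
    (show Differentiable ℝ sin from
      (show Differentiable ℂ sin from Complex.differentiable_sin).restrictScalars ℝ).comp
      (h2.const_sub θ)
  have hw : Differentiable ℝ fun x : ℝ × ℝ => wave k θ x.2 x.1 :=
    (show Differentiable ℝ exp from
      (show Differentiable ℂ exp from Complex.differentiable_exp).restrictScalars ℝ).comp
      ((h1.const_mul _).mul hcos).neg
  exact ⟨((hv.mul (hsin.const_mul _).neg).sub hn).mul hw,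
    h1.mul (((hv.mul (hcos.const_mul _).neg).sub hr).mul hw)⟩

theorem continuous_rayDensity (k : ℝ) (θ : ℂ) (φ : ℝ) :
    Continuous fun r => U.rayDensity k θ φ r :=
  (U.differentiable_densities k θ).1.continuous.comp (continuous_id.prodMk continuous_const)

/-- The integral over a segment of a ray of Green's form of the function and a plane wave. -/
noncomputable def rayIntegral (k ρ φ : ℝ) (θ : ℂ) : ℂ := ∫ r in (0 : ℝ)..ρ, U.rayDensity k θ φ r

/-- Green's formula in a circular sector where the function satisfies the Helmholtz equation. -/
theorem rayIntegral_sub_rayIntegral {k γ ρ φ₁ φ₂ : ℝ} (hρ : 0 ≤ ρ) (h₁ : |φ₁| < γ) (h₂ : |φ₂| < γ)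
    (hU : ∀ φ r, |φ| < γ → 0 < r → U.helm k φ r = 0) (θ : ℂ) :
    U.rayIntegral k ρ φ₂ θ - U.rayIntegral k ρ φ₁ θ = -∫ φ in φ₁..φ₂, U.arcDensity k θ φ ρ := by
  obtain ⟨dJ, dT⟩ := U.differentiable_densities k θ
  set J : ℝ × ℝ → ℂ := fun x => U.rayDensity k θ x.2 x.1
  set T : ℝ × ℝ → ℂ := fun x => U.arcDensity k θ x.2 x.1
  have hdiv : ∀ x : ℝ × ℝ, fderiv ℝ T x (1, 0) + fderiv ℝ J x (0, 1)
      = -(x.1 * U.helm k x.2 x.1 * wave k θ x.2 x.1) := by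
    intro x
    obtain ⟨a, b, ha, hb, hab⟩ := U.exists_hasDerivAt_densities k θ x.2 x.1
    have e1 : HasDerivAt (fun r : ℝ => T (r, x.2)) (fderiv ℝ T x (1, 0)) x.1 :=
      (show HasFDerivAt T (fderiv ℝ T x) (x.1, x.2) from (dT x).hasFDerivAt).comp_hasDerivAt
        (f := fun r : ℝ => (r, x.2)) x.1 ((hasDerivAt_id x.1).prodMk (hasDerivAt_const x.1 x.2))
    have e2 : HasDerivAt (fun φ : ℝ => J (x.1, φ)) (fderiv ℝ J x (0, 1)) x.2 :=
      (show HasFDerivAt J (fderiv ℝ J x) (x.1, x.2) from (dJ x).hasFDerivAt).comp_hasDerivAt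
        (f := fun φ : ℝ => (x.1, φ)) x.2 ((hasDerivAt_const x.2 x.1).prodMk (hasDerivAt_id x.2))
    rw [e1.unique hb, e2.unique ha, hab]
  have hcont : Continuous fun x : ℝ × ℝ => -((x.1 : ℂ) * U.helm k x.2 x.1 * wave k θ x.2 x.1) := by
    have h0 := (differentiable_polar U.differentiable_V).continuous
    have haa := U.continuous_aa
    have hbb := U.continuous_bb
    unfold helm wave
    fun_prop
  -- The divergence theorem is applied on a rectangle in the `(r, φ)` plane. Its side `r = 0`, which
  -- collapses to the vertex, contributes nothing because of the factor `r` in `arcDensity`.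
  have key := integral2_divergence_prod_of_hasFDerivAt T J (fderiv ℝ T) (fderiv ℝ J) 0 φ₁ ρ φ₂
    dT.continuous.continuousOn dJ.continuous.continuousOn
    (fun x _ => (dT x).hasFDerivAt) (fun x _ => (dJ x).hasFDerivAt) (by
      simp only [hdiv]
      exact hcont.continuousOn.integrableOn_compact (isCompact_uIcc.prod isCompact_uIcc))
  have hz : (∫ r in (0 : ℝ)..ρ, ∫ φ in φ₁..φ₂,
      fderiv ℝ T (r, φ) (1, 0) + fderiv ℝ J (r, φ) (0, 1)) = 0 := by
    have h0 : ∀ r ∈ uIoc 0 ρ, (∫ φ in φ₁..φ₂,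
        fderiv ℝ T (r, φ) (1, 0) + fderiv ℝ J (r, φ) (0, 1)) = 0 := by
      intro r hr
      rw [uIoc_of_le hρ] at hr
      rw [intervalIntegral.integral_congr (g := fun _ => (0 : ℂ)), intervalIntegral.integral_zero]
      intro φ hφ
      have hφγ : |φ| < γ := by
        rw [abs_lt] at h₁ h₂ ⊢
        rcases le_total φ₁ φ₂ with h | h
        · rw [uIcc_of_le h] at hφ; exact ⟨h₁.1.trans_le hφ.1, hφ.2.trans_lt h₂.2⟩
        · rw [uIcc_of_ge h] at hφ; exact ⟨h₂.1.trans_le hφ.1, hφ.2.trans_lt h₁.2⟩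
      simp [hdiv, hU φ r hφγ hr.1]
    rw [intervalIntegral.integral_congr_ae (g := fun _ => (0 : ℂ)) (.of_forall h0),
      intervalIntegral.integral_zero]
  rw [hz] at key
  have hT0 : ∀ φ, T (0, φ) = 0 := fun φ => by simp [T, arcDensity]
  simp only [hT0, intervalIntegral.integral_zero, sub_zero] at key
  change (∫ r in (0 : ℝ)..ρ, J (r, φ₂)) - (∫ r in (0 : ℝ)..ρ, J (r, φ₁)) = -∫ φ in φ₁..φ₂, T (ρ, φ)
  linear_combination -key

/-- For real `θ` the modulus is one. For `k, r > 0` the wave decays along the ray `φ` exactly when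
`sin(Re θ - φ)` and `Im θ` have the same sign, which is the condition on rays used below. -/
theorem norm_wave (k : ℝ) (θ : ℂ) (φ r : ℝ) :
    ‖wave k θ φ r‖ = Real.exp (-(k * r * (Real.sin (θ.re - φ) * Real.sinh θ.im))) := by
  have him : (cos (θ - φ)).im = -(Real.sin (θ.re - φ) * Real.sinh θ.im) := by
    have e : (θ - φ : ℂ) = ((θ.re - φ : ℝ) : ℂ) + (θ.im : ℂ) * I := by
      apply Complex.ext <;> simp
    rw [e, Complex.cos_add_mul_I, ← Complex.ofReal_cos, ← Complex.ofReal_sin, ← Complex.ofReal_sinh,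
      ← Complex.ofReal_cosh]
    simp only [Complex.sub_im, Complex.mul_im, Complex.mul_re, Complex.ofReal_re,
      Complex.ofReal_im, Complex.I_re, Complex.I_im]
    ring
  have hre : (-(I * k * r * cos (θ - φ))).re = k * r * (cos (θ - φ)).im := by
    simp
  rw [wave, Complex.norm_exp, hre, him]
  ring_nf

theorem norm_sin_le (z : ℂ) : ‖sin z‖ ≤ Real.cosh z.im := by
  rw [Complex.sin_eq]
  have : ∀ a b c d : ℝ, ‖((a : ℂ) * b + c * d * I)‖ ^ 2 = (a * b) ^ 2 + (c * d) ^ 2 := by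
    intro a b c d
    rw [← Complex.normSq_eq_norm_sq, Complex.normSq_apply]
    simp
    ring
  refine abs_le_of_sq_le_sq' ?_ (Real.cosh_pos _).le |>.2
  rw [← Complex.ofReal_cosh, ← Complex.ofReal_sinh, ← Complex.ofReal_sin, ← Complex.ofReal_cos,
    this]
  nlinarith [Real.cosh_sq z.im, Real.sin_sq_add_cos_sq z.re, sq_nonneg (Real.cos z.re),
    sq_nonneg (Real.sinh z.im)]

theorem norm_rayDensity_le {B k : ℝ} (hk : 0 < k) (hB : ∀ p, |U.V p| ≤ B)
    (hBa : ∀ p, |U.Va p| ≤ B) (hBb : ∀ p, |U.Vb p| ≤ B) (θ : ℂ) (φ r : ℝ) :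
    ‖U.rayDensity k θ φ r‖ ≤ B * (k * Real.cosh θ.im + 2) *
      Real.exp (-(k * (Real.sin (θ.re - φ) * Real.sinh θ.im)) * r) := by
  have hB0 : 0 ≤ B := (abs_nonneg _).trans (hB 0)
  rw [rayDensity, norm_mul, norm_wave]
  have h1 : ‖U.val φ r‖ ≤ B := by
    rw [val, Complex.norm_real]; exact hB _
  have h2 : ‖U.nrm φ r‖ ≤ 2 * B := by
    rw [nrm, Complex.norm_real, Real.norm_eq_abs]
    refine (abs_add_le _ _).trans ?_
    rw [abs_mul, abs_mul, abs_neg]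
    have := mul_le_mul (Real.abs_sin_le_one φ) (hBa (r * Real.cos φ, r * Real.sin φ))
      (abs_nonneg _) zero_le_one
    have := mul_le_mul (Real.abs_cos_le_one φ) (hBb (r * Real.cos φ, r * Real.sin φ))
      (abs_nonneg _) zero_le_one
    linarith
  have h3 : ‖-(I * k * sin (θ - φ))‖ ≤ k * Real.cosh θ.im := by
    rw [norm_neg, norm_mul, norm_mul, Complex.norm_I, one_mul, Complex.norm_real, Real.norm_eq_abs,
      abs_of_pos hk]
    gcongr
    simpa using norm_sin_le (θ - φ)
  have h4 : ‖U.val φ r * -(I * k * sin (θ - φ)) - U.nrm φ r‖ ≤ B * (k * Real.cosh θ.im + 2) := by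
    refine (norm_sub_le _ _).trans ?_
    rw [norm_mul]
    have := mul_le_mul h1 h3 (norm_nonneg _) hB0
    linarith
  refine (mul_le_mul_of_nonneg_right h4 (Real.exp_nonneg _)).trans (le_of_eq ?_)
  congr 2
  ring

theorem norm_arcDensity_le {k : ℝ} (hk : 0 < k) {r : ℝ} (hr : 0 ≤ r) (x φ : ℝ) :
    ‖U.arcDensity k x φ r‖ ≤ r * (k * |U.V (r * Real.cos φ, r * Real.sin φ)|
      + |U.Va (r * Real.cos φ, r * Real.sin φ)| + |U.Vb (r * Real.cos φ, r * Real.sin φ)|) := by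
  rw [arcDensity, norm_mul, norm_mul, norm_wave, Complex.norm_real, Real.norm_eq_abs,
    abs_of_nonneg hr]
  simp only [Complex.ofReal_im, Real.sinh_zero, mul_zero, neg_zero, Real.exp_zero, mul_one]
  gcongr
  have h1 : ‖U.val φ r * -(I * k * cos (x - φ))‖ ≤ k * |U.V (r * Real.cos φ, r * Real.sin φ)| := by
    rw [norm_mul, val, Complex.norm_real, norm_neg, norm_mul, norm_mul, Complex.norm_I, one_mul,
      Complex.norm_real, Real.norm_eq_abs, Real.norm_eq_abs, abs_of_pos hk, ← Complex.ofReal_sub,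
      ← Complex.ofReal_cos, Complex.norm_real, Real.norm_eq_abs]
    have := mul_le_mul_of_nonneg_left (Real.abs_cos_le_one (x - φ))
      (mul_nonneg hk.le (abs_nonneg (U.V (r * Real.cos φ, r * Real.sin φ))))
    linarith
  have h2 : ‖U.rad φ r‖ ≤ |U.Va (r * Real.cos φ, r * Real.sin φ)|
      + |U.Vb (r * Real.cos φ, r * Real.sin φ)| := by
    rw [rad, Complex.norm_real, Real.norm_eq_abs]
    refine (abs_add_le _ _).trans ?_
    rw [abs_mul, abs_mul]
    have := mul_le_mul_of_nonneg_right (Real.abs_cos_le_one φ)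
      (abs_nonneg (U.Va (r * Real.cos φ, r * Real.sin φ)))
    have := mul_le_mul_of_nonneg_right (Real.abs_sin_le_one φ)
      (abs_nonneg (U.Vb (r * Real.cos φ, r * Real.sin φ)))
    linarith
  exact (norm_sub_le _ _).trans (by linarith)

theorem differentiable_rayIntegral (k ρ φ : ℝ) : Differentiable ℂ (U.rayIntegral k ρ φ) := by
  intro θ₀
  set D : ℂ → ℝ → ℂ := fun θ r => (U.val φ r * -(I * k * cos (θ - φ))) * wave k θ φ r
    + (U.val φ r * -(I * k * sin (θ - φ)) - U.nrm φ r) * (wave k θ φ r * (I * k * r * sin (θ - φ)))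
    with hD
  have cv : Continuous fun r => U.val φ r := by
    have := U.differentiable_V.continuous
    unfold val; fun_prop
  have cn : Continuous fun r => U.nrm φ r := by
    have := U.differentiable_Va.continuous
    have := U.differentiable_Vb.continuous
    unfold nrm; fun_prop
  have hder : ∀ θ r, HasDerivAt (fun θ => U.rayDensity k θ φ r) (D θ r) θ := by
    intro θ r
    have h1 : HasDerivAt (fun θ : ℂ => θ - φ) 1 θ := (hasDerivAt_id θ).sub_const _
    have hs := (((Complex.hasDerivAt_sin (θ - φ)).comp θ h1).const_mul (I * k)).neg
    have hc := (((Complex.hasDerivAt_cos (θ - φ)).comp θ h1).const_mul (I * k * r)).neg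
    have he : HasDerivAt (fun θ => wave k θ φ r) _ θ := (Complex.hasDerivAt_exp _).comp θ hc
    refine (((hs.const_mul (U.val φ r)).sub_const (U.nrm φ r)).mul he).congr_deriv ?_
    simp only [hD, wave, Function.comp, Pi.neg_apply]
    ring
  have hcont : Continuous fun x : ℂ × ℝ => D x.1 x.2 := by
    simp only [hD]
    unfold wave
    fun_prop
  obtain ⟨M, hM⟩ := ((isCompact_closedBall θ₀ 1).prod (isCompact_uIcc (a := (0 : ℝ)) (b := ρ))
    ).exists_bound_of_continuousOn hcont.continuousOn
  have := intervalIntegral.hasDerivAt_integral_of_dominated_loc_of_deriv_le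
    (μ := volume) (a := 0) (b := ρ) (F := fun θ r => U.rayDensity k θ φ r) (F' := D) (x₀ := θ₀)
    (s := Metric.ball θ₀ 1) (bound := fun _ => M) (Metric.ball_mem_nhds _ one_pos)
    (.of_forall fun θ => (U.continuous_rayDensity k θ φ).aestronglyMeasurable)
    ((U.continuous_rayDensity k θ₀ φ).intervalIntegrable _ _)
    (hcont.comp (continuous_const.prodMk continuous_id)).aestronglyMeasurable
    (.of_forall fun r hr θ hθ => hM (θ, r) ⟨Metric.ball_subset_closedBall hθ, uIoc_subset_uIcc hr⟩)
    intervalIntegrable_const (.of_forall fun r _ θ _ => hder θ r)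
  exact this.2.differentiableAt

end PlaneJet

end WaterWaves

end Sector

/-! ### Good radii, decaying rays and bounds for the ray integrals. -/

section SectorRellich

open Complex

namespace WaterWaves

namespace PlaneJet

variable (U : PlaneJet)

/-- A square integrable function has circles of arbitrarily large radius on which it is small. -/
theorem exists_radii {w : ℝ × ℝ → ℝ} (hi : Integrable w)
    (n : ℕ) : ∃ ρ : ℝ, n ≤ ρ ∧ 0 < ρ ∧
      ρ ^ 2 * ∫ φ in (-Real.pi)..Real.pi, w (ρ * Real.cos φ, ρ * Real.sin φ)
        ≤ (1 / ((n : ℝ) + 1)) ^ 2 := by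
  set j : ℝ → ℝ := fun r => ∫ φ in (-Real.pi)..Real.pi, w (r * Real.cos φ, r * Real.sin φ) with hj
  by_contra! hcon
  have hint : IntegrableOn (fun x : ℝ × ℝ => x.1 • w (polarCoord.symm x)) polarCoord.target := by
    have h1 : Integrable w (volume.restrict polarCoord.source) := hi.integrableOn
    rw [← IntegrableOn, ← polarCoord.symm_image_target_eq_source,
      integrableOn_image_iff_integrableOn_abs_det_fderiv_smul volume
        polarCoord.open_target.measurableSet (f' := fderivPolarCoordSymm)
        (fun p _ => (hasFDerivAt_polarCoord_symm p).hasFDerivWithinAt)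
        polarCoord.symm.injOn] at h1
    refine h1.congr_fun (fun x hx => ?_) polarCoord.open_target.measurableSet
    simp only [det_fderivPolarCoordSymm]
    rw [abs_of_pos hx.1]
  have hint2 : IntegrableOn (fun r => r * j r) (Ioi 0) := by
    have h2 : Integrable (fun x : ℝ × ℝ => x.1 • w (polarCoord.symm x))
        ((volume.restrict (Ioi (0 : ℝ))).prod (volume.restrict (Ioo (-Real.pi) Real.pi))) := by
      rw [Measure.prod_restrict]; exact hint
    refine h2.integral_prod_left.congr (.of_forall fun r => ?_)
    simp only [polarCoord_symm_apply, smul_eq_mul, hj]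
    rw [integral_const_mul, intervalIntegral.integral_of_le (by linarith [Real.pi_pos]),
      integral_Ioc_eq_integral_Ioo]
  have hN : (0 : ℝ) < n + 1 := by positivity
  -- If no such radius existed, the integrable function `r * j r` would dominate a multiple of `1 /
  -- r` at infinity.
  refine not_integrableOn_Ioi_inv (a := (n : ℝ) + 1) ?_
  have h3 : IntegrableOn (fun r => ((n : ℝ) + 1) ^ 2 * (r * j r)) (Ioi ((n : ℝ) + 1)) :=
    (hint2.mono_set (Ioi_subset_Ioi hN.le)).const_mul _
  refine Integrable.mono' h3 measurable_inv.aestronglyMeasurable ?_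
  refine (ae_restrict_iff' measurableSet_Ioi).2 (.of_forall fun r hr => ?_)
  have hr0 : 0 < r := hN.trans hr
  have h4 := hcon r (by have := mem_Ioi.1 hr; linarith) hr0
  rw [div_pow, one_pow, div_lt_iff₀ (by positivity)] at h4
  rw [Real.norm_eq_abs, abs_of_pos (inv_pos.2 hr0), inv_eq_one_div, div_le_iff₀ hr0]
  nlinarith [h4]

/-- Along suitable circles, Green's form of the function and any plane wave tends to zero. -/
theorem exists_radii_arcDensity {k γ : ℝ} (hk : 0 < k) (hγ : γ < Real.pi)
    (hV : Integrable fun p => U.V p ^ 2) (hVa : Integrable fun p => U.Va p ^ 2)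
    (hVb : Integrable fun p => U.Vb p ^ 2) :
    ∃ ρ ε : ℕ → ℝ, (∀ n, 0 < ρ n) ∧ Tendsto ρ atTop atTop ∧ Tendsto ε atTop (𝓝 0) ∧
      ∀ n (x φ₁ φ₂ : ℝ), |φ₁| < γ → |φ₂| < γ →
        ‖∫ φ in φ₁..φ₂, U.arcDensity k x φ (ρ n)‖ ≤ ε n := by
  set w : ℝ × ℝ → ℝ := fun p => k ^ 2 * U.V p ^ 2 + (U.Va p ^ 2 + U.Vb p ^ 2) with hw
  have cV := U.differentiable_V.continuous
  have cVa := U.differentiable_Va.continuous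
  have cVb := U.differentiable_Vb.continuous
  have hwc : Continuous w := by fun_prop
  have hw0 : ∀ p, 0 ≤ w p := fun p => by positivity
  choose ρ hρn hρ hρw using fun n => exists_radii ((hV.const_mul _).add (hVa.add hVb)) n
  refine ⟨ρ, fun n => (3 * Real.pi + 1) * (1 / ((n : ℝ) + 1)), hρ,
    tendsto_atTop_mono hρn tendsto_natCast_atTop_atTop, ?_, ?_⟩
  · simpa using tendsto_one_div_add_atTop_nhds_zero_nat.const_mul (3 * Real.pi + 1)
  intro n x φ₁ φ₂ h₁ h₂
  set e : ℝ := 1 / ((n : ℝ) + 1) with he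
  have he0 : 0 < e := by positivity
  set f : ℝ → ℝ := fun φ => (3 * e + ρ n ^ 2 * w (ρ n * Real.cos φ, ρ n * Real.sin φ) / e) / 2
    with hf
  have hf0 : ∀ φ, 0 ≤ f φ := fun φ => by
    have := hw0 (ρ n * Real.cos φ, ρ n * Real.sin φ)
    positivity
  have hfc : Continuous f := by fun_prop
  have hle : ∀ φ, ‖U.arcDensity k x φ (ρ n)‖ ≤ f φ := by
    intro φ
    refine (U.norm_arcDensity_le hk (hρ n).le x φ).trans ?_
    simp only [hf, hw]
    generalize (ρ n * Real.cos φ, ρ n * Real.sin φ) = p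
    -- The inequality of arithmetic and geometric means with weight `e`: a bound `e ^ 2` for the
    -- integral of the squares becomes a bound of order `e` for that of the first powers.
    have key : ∀ a : ℝ, 0 ≤ a → ρ n * a ≤ (e + ρ n ^ 2 * a ^ 2 / e) / 2 := by
      intro a _
      have : 0 ≤ (e - ρ n * a) ^ 2 / e := by positivity
      have h5 : (e - ρ n * a) ^ 2 / e = e + ρ n ^ 2 * a ^ 2 / e - 2 * (ρ n * a) := by
        field_simp; ring
      linarith
    have k1 := key (k * |U.V p|) (by positivity)
    have k2 := key |U.Va p| (by positivity)
    have k3 := key |U.Vb p| (by positivity)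
    rw [mul_pow, sq_abs] at k1
    rw [sq_abs] at k2 k3
    calc _ = ρ n * (k * |U.V p|) + ρ n * |U.Va p| + ρ n * |U.Vb p| := by ring
      _ ≤ _ := add_le_add_three k1 k2 k3
      _ = _ := by ring
  have hsub : uIoc φ₁ φ₂ ⊆ Ioc (-Real.pi) Real.pi := by
    rw [abs_lt] at h₁ h₂
    intro φ hφ
    rcases le_total φ₁ φ₂ with h | h
    · rw [uIoc_of_le h] at hφ; exact ⟨by linarith [hφ.1], by linarith [hφ.2]⟩
    · rw [uIoc_of_ge h] at hφ; exact ⟨by linarith [hφ.1], by linarith [hφ.2]⟩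
  have hpi : -Real.pi ≤ Real.pi := by linarith [Real.pi_pos]
  have hfi : IntegrableOn f (Ioc (-Real.pi) Real.pi) :=
    (intervalIntegrable_iff_integrableOn_Ioc_of_le hpi).1 (hfc.intervalIntegrable _ _)
  calc ‖∫ φ in φ₁..φ₂, U.arcDensity k x φ (ρ n)‖
      ≤ ∫ φ in uIoc φ₁ φ₂, ‖U.arcDensity k x φ (ρ n)‖ :=
        intervalIntegral.norm_integral_le_integral_norm_uIoc
    _ ≤ ∫ φ in uIoc φ₁ φ₂, f φ :=
        integral_mono_of_nonneg (.of_forall fun _ => norm_nonneg _) (hfi.mono_set hsub)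
          (.of_forall hle)
    _ ≤ ∫ φ in Ioc (-Real.pi) Real.pi, f φ :=
        setIntegral_mono_set hfi (.of_forall hf0) hsub.eventuallyLE
    _ = ∫ φ in (-Real.pi)..Real.pi, f φ := (intervalIntegral.integral_of_le hpi).symm
    _ = 3 * Real.pi * e
        + (ρ n ^ 2 * ∫ φ in (-Real.pi)..Real.pi, w (ρ n * Real.cos φ, ρ n * Real.sin φ)) / e / 2 := by
        have c1 : Continuous fun φ => w (ρ n * Real.cos φ, ρ n * Real.sin φ) := by fun_prop
        simp only [hf, add_div, mul_div_assoc]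
        rw [intervalIntegral.integral_add (by simp) (by
          apply Continuous.intervalIntegrable; fun_prop)]
        simp only [intervalIntegral.integral_const_mul, intervalIntegral.integral_div,
          intervalIntegral.integral_const, smul_eq_mul]
        ring
    _ ≤ 3 * Real.pi * e + e ^ 2 / e / 2 := by
        gcongr
        exact hρw n
    _ ≤ (3 * Real.pi + 1) * e := by
        have : e ^ 2 / e / 2 = e / 2 := by field_simp
        rw [this]; linarith

/-- In a sector of vertex angle greater than `π`, every direction has an uniformly positive, and
an uniformly negative, sine of the angle with one of finitely many rays. -/
theorem exists_ray {γ : ℝ} (h1 : Real.pi / 2 < γ) (h2 : γ < Real.pi) :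
    ∃ σ > 0, ∀ x : ℝ, ∃ φ, |φ| < γ ∧ σ ≤ Real.sin (x - φ) := by
  set β := (γ - Real.pi / 2) / 2 with hβ
  have hπ := Real.pi_pos
  have hb0 : 0 < β := by simp only [hβ]; linarith
  have hb1 : β < Real.pi / 2 := by simp only [hβ]; linarith
  have hs : 0 < Real.sin β := Real.sin_pos_of_pos_of_lt_pi hb0 (by linarith)
  have hc : 0 < Real.cos β := Real.cos_pos_of_mem_Ioo ⟨by linarith, hb1⟩
  have hs1 := Real.sin_le_one β
  have hc1 := Real.cos_le_one β
  -- Three rays suffice: `0` and `±(π/2 + β)`. If all three failed, then `|sin x sin β| < σ` and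
  -- `|cos x cos β| < 2σ`; since `sin β` and `cos β` are at least `5σ`, this would give `sin² x +
  -- cos² x < 1/25 + 4/25`.
  refine ⟨Real.sin β * Real.cos β / 5, by positivity, fun x => ?_⟩
  set σ := Real.sin β * Real.cos β / 5 with hσ
  by_contra! hcon
  have ha := hcon 0 (by simpa using (by linarith : 0 < γ))
  have hb := hcon (Real.pi / 2 + β) (by rw [abs_of_pos (by linarith)]; simp only [hβ]; linarith)
  have hc' := hcon (-(Real.pi / 2 + β))
    (by rw [abs_neg, abs_of_pos (by linarith)]; simp only [hβ]; linarith)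
  rw [sub_zero] at ha
  have eb : Real.sin (x - (Real.pi / 2 + β)) = -Real.cos (x - β) := by
    rw [← Real.sin_sub_pi_div_two]; ring_nf
  have ec : Real.sin (x - -(Real.pi / 2 + β)) = Real.cos (x + β) := by
    rw [← Real.sin_add_pi_div_two]; ring_nf
  rw [eb, Real.cos_sub] at hb
  rw [ec, Real.cos_add] at hc'
  have hσ0 : 0 < σ := by positivity
  set s := Real.sin x
  set c := Real.cos x
  have hsc : s ^ 2 + c ^ 2 = 1 := Real.sin_sq_add_cos_sq x
  set S := Real.sin β
  set C := Real.cos β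
  have hσS : 5 * σ ≤ S := by simp only [hσ]; nlinarith
  have hσC : 5 * σ ≤ C := by simp only [hσ]; nlinarith
  have hsl : -σ < s * S := by nlinarith
  have hsu : s * S < σ := by
    rcases le_total s 0 with h | h
    · nlinarith
    · nlinarith
  have hcl : |c * C| < 2 * σ := by rw [abs_lt]; constructor <;> nlinarith
  have hsl' : |s * S| < σ := by rw [abs_lt]; constructor <;> linarith
  have q1 : (s * S) ^ 2 < σ ^ 2 := by
    rw [← sq_abs]; exact pow_lt_pow_left₀ hsl' (abs_nonneg _) two_ne_zero
  have q2 : (c * C) ^ 2 < (2 * σ) ^ 2 := by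
    rw [← sq_abs]; exact pow_lt_pow_left₀ hcl (abs_nonneg _) two_ne_zero
  have q3 : s ^ 2 * (5 * σ) ^ 2 ≤ (s * S) ^ 2 := by
    rw [mul_pow s]
    exact mul_le_mul_of_nonneg_left (pow_le_pow_left₀ (by positivity) hσS 2) (sq_nonneg s)
  have q4 : c ^ 2 * (5 * σ) ^ 2 ≤ (c * C) ^ 2 := by
    rw [mul_pow c]
    exact mul_le_mul_of_nonneg_left (pow_le_pow_left₀ (by positivity) hσC 2) (sq_nonneg c)
  nlinarith

/-- The integral over a whole ray of Green's form of the function and a plane wave. -/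
noncomputable def rayLimit (k φ : ℝ) (θ : ℂ) : ℂ := ∫ r in Ioi (0 : ℝ), U.rayDensity k θ φ r

theorem sinh_mul_pos {x s : ℝ} (h : 0 < s * x) : 0 < s * Real.sinh x := by
  rcases pos_and_pos_or_neg_and_neg_of_mul_pos h with ⟨h1, h2⟩ | ⟨h1, h2⟩
  · exact mul_pos h1 (Real.sinh_pos_iff.2 h2)
  · exact mul_pos_of_neg_of_neg h1 (Real.sinh_neg_iff.2 h2)

section Bounded

variable {U} {B k : ℝ}

theorem integrableOn_rayDensity (hk : 0 < k) (hB : ∀ p, |U.V p| ≤ B)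
    (hBa : ∀ p, |U.Va p| ≤ B) (hBb : ∀ p, |U.Vb p| ≤ B) {φ : ℝ} {θ : ℂ}
    (h : 0 < Real.sin (θ.re - φ) * θ.im) :
    IntegrableOn (fun r => U.rayDensity k θ φ r) (Ioi 0) := by
  have hs := mul_pos hk (sinh_mul_pos h)
  refine Integrable.mono' ((exp_neg_integrableOn_Ioi 0 hs).const_mul
    (B * (k * Real.cosh θ.im + 2))) (U.continuous_rayDensity k θ φ).aestronglyMeasurable
    (.of_forall fun r => U.norm_rayDensity_le hk hB hBa hBb θ φ r)

theorem tendsto_rayIntegral (hk : 0 < k) (hB : ∀ p, |U.V p| ≤ B)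
    (hBa : ∀ p, |U.Va p| ≤ B) (hBb : ∀ p, |U.Vb p| ≤ B) {φ : ℝ} {θ : ℂ}
    (h : 0 < Real.sin (θ.re - φ) * θ.im) {ρ : ℕ → ℝ} (hρ : Tendsto ρ atTop atTop) :
    Tendsto (fun n => U.rayIntegral k (ρ n) φ θ) atTop (𝓝 (U.rayLimit k φ θ)) :=
  intervalIntegral_tendsto_integral_Ioi 0 (integrableOn_rayDensity hk hB hBa hBb h) hρ

/-- The bound does not depend on the length `ρ`. It grows only like `1 / |Im θ|` at the real axis,
as `exists_analytic_glue` requires, and stays bounded as `|Im θ| → ∞` if the sine is bounded away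
from zero, as Liouville's theorem requires. -/
theorem norm_rayIntegral_le (hk : 0 < k) (hB : ∀ p, |U.V p| ≤ B)
    (hBa : ∀ p, |U.Va p| ≤ B) (hBb : ∀ p, |U.Vb p| ≤ B) {φ ρ : ℝ} (hρ : 0 ≤ ρ) {θ : ℂ}
    (h : 0 < Real.sin (θ.re - φ) * θ.im) :
    ‖U.rayIntegral k ρ φ θ‖ ≤
      B * (k * Real.cosh θ.im + 2) / (k * (Real.sin (θ.re - φ) * Real.sinh θ.im)) := by
  have hs := mul_pos hk (sinh_mul_pos h)
  have hB0 : 0 ≤ B := (abs_nonneg _).trans (hB 0)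
  set s := k * (Real.sin (θ.re - φ) * Real.sinh θ.im)
  have hM : 0 ≤ B * (k * Real.cosh θ.im + 2) := by
    have := Real.cosh_pos θ.im
    positivity
  calc ‖U.rayIntegral k ρ φ θ‖ ≤ ∫ r in (0 : ℝ)..ρ, ‖U.rayDensity k θ φ r‖ :=
        intervalIntegral.norm_integral_le_integral_norm hρ
    _ = ∫ r in Ioc 0 ρ, ‖U.rayDensity k θ φ r‖ := intervalIntegral.integral_of_le hρ
    _ ≤ ∫ r in Ioi 0, ‖U.rayDensity k θ φ r‖ :=
        setIntegral_mono_set (integrableOn_rayDensity hk hB hBa hBb h).norm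
          (.of_forall fun _ => norm_nonneg _) Ioc_subset_Ioi_self.eventuallyLE
    _ ≤ ∫ r in Ioi 0, B * (k * Real.cosh θ.im + 2) * Real.exp (-s * r) :=
        integral_mono_of_nonneg (.of_forall fun _ => norm_nonneg _)
          ((exp_neg_integrableOn_Ioi 0 hs).const_mul _)
          (.of_forall fun r => U.norm_rayDensity_le hk hB hBa hBb θ φ r)
    _ = B * (k * Real.cosh θ.im + 2) / s := by
        rw [integral_const_mul, integral_exp_mul_Ioi (neg_neg_of_pos hs)]
        simp
        ring

end Bounded

end PlaneJet

end WaterWaves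

end SectorRellich

/-! ### The Rellich theorem for smooth bounded solutions in a sector. -/

section SectorRellich

open Complex

namespace WaterWaves

/-- The strip of points whose real part is near `c` and whose imaginary part is less than `Y`. -/
def box (c R Y : ℝ) : Set ℂ := Ioo (c - R) (c + R) ×ℂ Ioo (-Y) Y

theorem isOpen_box (c R Y : ℝ) : IsOpen (box c R Y) := isOpen_Ioo.reProdIm isOpen_Ioo

theorem isPreconnected_box (c R Y : ℝ) : IsPreconnected (box c R Y) := by
  have : Convex ℝ (box c R Y) :=
    ((convex_Ioo (c - R) (c + R)).is_linear_preimage Complex.reLm.isLinear).inter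
      ((convex_Ioo (-Y) Y).is_linear_preimage Complex.imLm.isLinear)
  exact this.isPreconnected

theorem mem_box {c R Y : ℝ} {z : ℂ} : z ∈ box c R Y ↔ |z.re - c| < R ∧ |z.im| < Y := by
  rw [box, Complex.mem_reProdIm, abs_lt, abs_lt, mem_Ioo, mem_Ioo]
  constructor <;> rintro ⟨⟨h1, h2⟩, h3⟩ <;> refine ⟨⟨?_, ?_⟩, h3⟩ <;> linarith

/-- The identity theorem, from one half of the box to the whole; the sign of `s` selects the upper
or the lower half. -/
theorem eqOn_box {c R Y s : ℝ} (hR : 0 < R) (hY : 0 < Y) (hs : s ≠ 0) {f g : ℂ → ℂ}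
    (hf : DifferentiableOn ℂ f (box c R Y)) (hg : DifferentiableOn ℂ g (box c R Y))
    (h : ∀ z ∈ box c R Y, 0 < s * z.im → f z = g z) : EqOn f g (box c R Y) := by
  have hz : ((c : ℂ) + (SignType.sign s * (Y / 2) : ℝ) * I) ∈ box c R Y := by
    rw [mem_box]
    refine ⟨by simpa using hR, ?_⟩
    rcases lt_or_gt_of_ne hs with h | h <;> simp [h, abs_of_pos (half_pos hY)]
    all_goals exact hY
  refine (hf.analyticOnNhd (isOpen_box _ _ _)).eqOn_of_preconnected_of_eventuallyEq
    (hg.analyticOnNhd (isOpen_box _ _ _)) (isPreconnected_box _ _ _) hz ?_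
  have hpos : 0 < s * ((c : ℂ) + (SignType.sign s * (Y / 2) : ℝ) * I).im := by
    rcases lt_or_gt_of_ne hs with h | h <;> simp [h] <;> nlinarith
  have h1 : ∀ᶠ z : ℂ in 𝓝 ((c : ℂ) + (SignType.sign s * (Y / 2) : ℝ) * I), 0 < s * z.im :=
    (continuous_const.mul Complex.continuous_im).continuousAt.eventually_const_lt hpos
  filter_upwards [h1, (isOpen_box _ _ _).mem_nhds hz] with z h2 h3 using h z h3 h2

namespace PlaneJet

variable {U : PlaneJet} {B k γ : ℝ}

/-- Near `Re z = c` the wave decays along `φ₁` above the real axis and along `φ₂` below it. On the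
axis the two finite ray integrals differ, by Green's formula, by an arc integral that tends to zero
along the good radii, so `exists_analytic_glue` applies. -/
theorem exists_glue_rayLimit (hk : 0 < k) (hγ : γ < Real.pi) (hB : ∀ p, |U.V p| ≤ B)
    (hBa : ∀ p, |U.Va p| ≤ B) (hBb : ∀ p, |U.Vb p| ≤ B)
    (hV : Integrable fun p => U.V p ^ 2) (hVa : Integrable fun p => U.Va p ^ 2)
    (hVb : Integrable fun p => U.Vb p ^ 2)
    (hU : ∀ φ r, |φ| < γ → 0 < r → U.helm k φ r = 0) {φ₁ φ₂ c : ℝ} (h₁ : |φ₁| < γ) (h₂ : |φ₂| < γ)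
    (hc₁ : 0 < Real.sin (c - φ₁)) (hc₂ : Real.sin (c - φ₂) < 0) :
    ∃ R > 0, ∀ Y > 0, ∃ h : ℂ → ℂ, DifferentiableOn ℂ h (box c R Y) ∧ ∀ z ∈ box c R Y,
      (0 < z.im → h z = U.rayLimit k φ₁ z) ∧ (z.im < 0 → h z = U.rayLimit k φ₂ z) := by
  obtain ⟨ρ, ε, hρ0, hρ, hε, harc⟩ := U.exists_radii_arcDensity hk hγ hV hVa hVb
  -- Half of the smaller modulus, so that both sines stay away from zero on a whole interval around
  -- `c`.
  set σ := min (Real.sin (c - φ₁)) (-Real.sin (c - φ₂)) / 2 with hσ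
  have hσ0 : 0 < σ := by
    have : 0 < min (Real.sin (c - φ₁)) (-Real.sin (c - φ₂)) := lt_min hc₁ (by linarith)
    positivity
  have e1 : ∀ᶠ x in 𝓝 c, σ < Real.sin (x - φ₁) := by
    refine (by fun_prop : Continuous fun x => Real.sin (x - φ₁)).continuousAt.eventually_const_lt ?_
    have := min_le_left (Real.sin (c - φ₁)) (-Real.sin (c - φ₂))
    simp only [hσ] at hσ0 ⊢; linarith
  have e2 : ∀ᶠ x in 𝓝 c, σ < -Real.sin (x - φ₂) := by
    refine (by fun_prop : Continuous fun x => -Real.sin (x - φ₂)).continuousAt.eventually_const_lt ?_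
    have := min_le_right (Real.sin (c - φ₁)) (-Real.sin (c - φ₂))
    simp only [hσ] at hσ0 ⊢; linarith
  obtain ⟨R', hR', hsin⟩ := Metric.eventually_nhds_iff.1 (e1.and e2)
  have hsin' : ∀ x ∈ Icc (c - R' / 2) (c + R' / 2), σ < Real.sin (x - φ₁) ∧
      σ < -Real.sin (x - φ₂) := by
    intro x hx
    refine hsin ?_
    rw [Real.dist_eq, abs_lt]
    exact ⟨by linarith [hx.1], by linarith [hx.2]⟩
  refine ⟨R' / 2, by positivity, fun Y hY => ?_⟩
  have hB0 : 0 ≤ B := (abs_nonneg _).trans (hB 0)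
  have hcosh : ∀ y : ℝ, |y| ≤ Y → Real.cosh y ≤ Real.cosh Y := by
    intro y hy
    rw [Real.cosh_le_cosh, abs_of_pos hY]; exact hy
  have hbd : ∀ (n : ℕ) (φ : ℝ) (z : ℂ), 0 < Real.sin (z.re - φ) * z.im →
      σ < |Real.sin (z.re - φ)| → |z.im| ≤ Y →
      ‖U.rayIntegral k (ρ n) φ z‖ * |z.im| ≤ B * (k * Real.cosh Y + 2) / (k * σ) := by
    intro n φ z hz h3 h4
    have h5 := norm_rayIntegral_le hk hB hBa hBb (hρ0 n).le hz
    have hs := sinh_mul_pos hz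
    have hy0 : z.im ≠ 0 := by rintro h; rw [h] at hz; simp at hz
    have h6 : σ * |z.im| ≤ Real.sin (z.re - φ) * Real.sinh z.im := by
      rw [← abs_of_pos hs, abs_mul]
      refine mul_le_mul h3.le ?_ (abs_nonneg _) (abs_nonneg _)
      rw [Real.abs_sinh]
      exact Real.self_le_sinh_iff.2 (abs_nonneg _)
    have hcp := Real.cosh_pos z.im
    rw [le_div_iff₀ (by positivity)] at h5
    rw [le_div_iff₀ (by positivity)]
    calc ‖U.rayIntegral k (ρ n) φ z‖ * |z.im| * (k * σ)
        = ‖U.rayIntegral k (ρ n) φ z‖ * (k * (σ * |z.im|)) := by ring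
      _ ≤ ‖U.rayIntegral k (ρ n) φ z‖ * (k * (Real.sin (z.re - φ) * Real.sinh z.im)) := by gcongr
      _ ≤ B * (k * Real.cosh z.im + 2) := h5
      _ ≤ B * (k * Real.cosh Y + 2) := by gcongr; exact hcosh _ h4
  obtain ⟨h, hd, hh⟩ := exists_analytic_glue (a := c - R' / 2) (b := c + R' / 2) (Y := Y)
    (C := B * (k * Real.cosh Y + 2) / (k * σ)) (by linarith) hY
    (f := fun n => U.rayIntegral k (ρ n) φ₁) (g := fun n => U.rayIntegral k (ρ n) φ₂)
    (F := U.rayLimit k φ₁) (G := U.rayLimit k φ₂) (ε := ε)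
    (fun n => U.differentiable_rayIntegral k _ _) (fun n => U.differentiable_rayIntegral k _ _)
    (fun n z hz h0 h1 => by
      have h3 := (hsin' _ hz).1
      have := hbd n φ₁ z (mul_pos (hσ0.trans h3) h0) (h3.trans_le (le_abs_self _))
        (by rwa [abs_of_pos h0])
      rwa [abs_of_pos h0] at this)
    (fun n z hz h0 h1 => by
      have h3 := (hsin' _ hz).2
      have := hbd n φ₂ z (mul_pos_of_neg_of_neg (by linarith) h0)
        (h3.trans_le (neg_le_abs _)) (by rw [abs_of_neg h0]; linarith)
      rwa [abs_of_neg h0] at this)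
    hε
    (fun n x _ => by
      rw [rayIntegral_sub_rayIntegral U (hρ0 n).le h₁ h₂ hU, norm_neg]
      exact harc n x φ₁ φ₂ h₁ h₂)
    (fun z hz h0 h1 => tendsto_rayIntegral hk hB hBa hBb
      (mul_pos (hσ0.trans (hsin' _ hz).1) h0) hρ)
    (fun z hz h0 h1 => tendsto_rayIntegral hk hB hBa hBb
      (mul_pos_of_neg_of_neg (by linarith [(hsin' _ hz).2]) h0) hρ)
  exact ⟨h, hd, hh⟩

/-- Both limits continue analytically across the real axis to the limit along one ray `ψ` that
decays on the other side. They therefore agree by the identity theorem. Such a `ψ` exists because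
the vertex angle exceeds `π`. -/
theorem rayLimit_eq_rayLimit (hk : 0 < k) (hγ : γ < Real.pi) (hγ' : Real.pi / 2 < γ)
    (hB : ∀ p, |U.V p| ≤ B)
    (hBa : ∀ p, |U.Va p| ≤ B) (hBb : ∀ p, |U.Vb p| ≤ B)
    (hV : Integrable fun p => U.V p ^ 2) (hVa : Integrable fun p => U.Va p ^ 2)
    (hVb : Integrable fun p => U.Vb p ^ 2)
    (hU : ∀ φ r, |φ| < γ → 0 < r → U.helm k φ r = 0) {φ φ' : ℝ} (h : |φ| < γ) (h' : |φ'| < γ)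
    {z : ℂ} (hz : 0 < Real.sin (z.re - φ) * z.im) (hz' : 0 < Real.sin (z.re - φ') * z.im) :
    U.rayLimit k φ z = U.rayLimit k φ' z := by
  obtain ⟨σ, hσ, hray⟩ := exists_ray hγ' hγ
  set Y := |z.im| + 1 with hY
  have hY0 : 0 < Y := by positivity
  have hyY : |z.im| < Y := by simp [hY]
  rcases pos_and_pos_or_neg_and_neg_of_mul_pos hz with ⟨h1, h2⟩ | ⟨h1, h2⟩
  · have h3 : 0 < Real.sin (z.re - φ') := (pos_iff_pos_of_mul_pos hz').2 h2
    -- Adding `π` to the direction changes the sign of the sine, so the same statement supplies rays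
    -- with negative sine.
    obtain ⟨ψ, hψ, hψs⟩ := hray (z.re + Real.pi)
    have hψn : Real.sin (z.re - ψ) < 0 := by
      rw [show z.re + Real.pi - ψ = z.re - ψ + Real.pi by ring, Real.sin_add_pi] at hψs
      linarith
    obtain ⟨R, hR, g⟩ := exists_glue_rayLimit hk hγ hB hBa hBb hV hVa hVb hU h hψ h1 hψn
    obtain ⟨R', hR', g'⟩ := exists_glue_rayLimit hk hγ hB hBa hBb hV hVa hVb hU h' hψ h3 hψn
    obtain ⟨f, hf, hfe⟩ := g Y hY0
    obtain ⟨f', hf', hfe'⟩ := g' Y hY0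
    have sub1 : box z.re (min R R') Y ⊆ box z.re R Y := fun w hw => by
      rw [mem_box] at hw ⊢; exact ⟨hw.1.trans_le (min_le_left _ _), hw.2⟩
    have sub2 : box z.re (min R R') Y ⊆ box z.re R' Y := fun w hw => by
      rw [mem_box] at hw ⊢; exact ⟨hw.1.trans_le (min_le_right _ _), hw.2⟩
    have hzb : z ∈ box z.re (min R R') Y := by
      rw [mem_box]; exact ⟨by simp [hR, hR'], hyY⟩
    have := eqOn_box (s := -1) (lt_min hR hR') hY0 (by norm_num) (hf.mono sub1) (hf'.mono sub2)
      (fun w hw hw0 => by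
        have hw1 : w.im < 0 := by linarith
        rw [(hfe w (sub1 hw)).2 hw1, (hfe' w (sub2 hw)).2 hw1]) hzb
    rwa [(hfe z (sub1 hzb)).1 h2, (hfe' z (sub2 hzb)).1 h2] at this
  · have h3 : Real.sin (z.re - φ') < 0 := (neg_iff_neg_of_mul_pos hz').2 h2
    obtain ⟨ψ, hψ, hψs⟩ := hray z.re
    have hψn : 0 < Real.sin (z.re - ψ) := hσ.trans_le hψs
    obtain ⟨R, hR, g⟩ := exists_glue_rayLimit hk hγ hB hBa hBb hV hVa hVb hU hψ h hψn h1
    obtain ⟨R', hR', g'⟩ := exists_glue_rayLimit hk hγ hB hBa hBb hV hVa hVb hU hψ h' hψn h3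
    obtain ⟨f, hf, hfe⟩ := g Y hY0
    obtain ⟨f', hf', hfe'⟩ := g' Y hY0
    have sub1 : box z.re (min R R') Y ⊆ box z.re R Y := fun w hw => by
      rw [mem_box] at hw ⊢; exact ⟨hw.1.trans_le (min_le_left _ _), hw.2⟩
    have sub2 : box z.re (min R R') Y ⊆ box z.re R' Y := fun w hw => by
      rw [mem_box] at hw ⊢; exact ⟨hw.1.trans_le (min_le_right _ _), hw.2⟩
    have hzb : z ∈ box z.re (min R R') Y := by
      rw [mem_box]; exact ⟨by simp [hR, hR'], hyY⟩
    have := eqOn_box (s := 1) (lt_min hR hR') hY0 (by norm_num) (hf.mono sub1) (hf'.mono sub2)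
      (fun w hw hw0 => by
        have hw1 : 0 < w.im := by linarith
        rw [(hfe w (sub1 hw)).1 hw1, (hfe' w (sub2 hw)).1 hw1]) hzb
    rwa [(hfe z (sub1 hzb)).2 h2, (hfe' z (sub2 hzb)).2 h2] at this

theorem rayLimit_periodic (φ : ℝ) (z : ℂ) :
    U.rayLimit k φ (z + 2 * Real.pi) = U.rayLimit k φ z := by
  have e : ∀ r, U.rayDensity k (z + 2 * Real.pi) φ r = U.rayDensity k z φ r := by
    intro r
    rw [rayDensity, rayDensity, wave, wave, show z + 2 * (Real.pi : ℂ) - φ = z - φ + 2 * Real.pi by ring,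
      Complex.sin_add_two_pi, Complex.cos_add_two_pi]
  simp only [rayLimit, e]

/-- The limits agree whenever they are defined, so they form one function off the real axis, and the
gluing extends it to an entire function. It is `2π`-periodic because the wave is, and bounded for
`|Im z| ≥ 1` by the uniform estimate of the ray integrals. By periodicity, a compact rectangle
accounts for the rest, and Liouville's theorem applies. -/
theorem exists_rayLimit_eq_const (hk : 0 < k) (hγ : γ < Real.pi) (hγ' : Real.pi / 2 < γ)
    (hB : ∀ p, |U.V p| ≤ B)
    (hBa : ∀ p, |U.Va p| ≤ B) (hBb : ∀ p, |U.Vb p| ≤ B)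
    (hV : Integrable fun p => U.V p ^ 2) (hVa : Integrable fun p => U.Va p ^ 2)
    (hVb : Integrable fun p => U.Vb p ^ 2)
    (hU : ∀ φ r, |φ| < γ → 0 < r → U.helm k φ r = 0) :
    ∃ K : ℂ, ∀ (φ : ℝ) (z : ℂ), |φ| < γ → 0 < Real.sin (z.re - φ) * z.im →
      U.rayLimit k φ z = K := by
  obtain ⟨σ, hσ, hray⟩ := exists_ray hγ' hγ
  have hB0 : 0 ≤ B := (abs_nonneg _).trans (hB 0)
  have hsel : ∀ z : ℂ, ∃ φ, |φ| < γ ∧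
      (z.im ≠ 0 → σ * |z.im| ≤ Real.sin (z.re - φ) * z.im) := by
    intro z
    rcases lt_or_ge z.im 0 with h | h
    · obtain ⟨ψ, hψ, hψs⟩ := hray (z.re + Real.pi)
      rw [show z.re + Real.pi - ψ = z.re - ψ + Real.pi by ring, Real.sin_add_pi] at hψs
      exact ⟨ψ, hψ, fun _ => by rw [abs_of_neg h]; nlinarith⟩
    · obtain ⟨ψ, hψ, hψs⟩ := hray z.re
      exact ⟨ψ, hψ, fun _ => by rw [abs_of_nonneg h]; nlinarith⟩
  choose sel hsel1 hsel2 using hsel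
  have hsel3 : ∀ z : ℂ, z.im ≠ 0 → 0 < Real.sin (z.re - sel z) * z.im := fun z hz =>
    (mul_pos hσ (abs_pos.2 hz)).trans_le (hsel2 z hz)
  set G₀ : ℂ → ℂ := fun z => U.rayLimit k (sel z) z with hG₀
  have hG₀eq : ∀ (φ : ℝ) (z : ℂ), |φ| < γ → 0 < Real.sin (z.re - φ) * z.im →
      U.rayLimit k φ z = G₀ z := by
    intro φ z hφ hz
    have hz0 : z.im ≠ 0 := by rintro h; rw [h] at hz; simp at hz
    exact rayLimit_eq_rayLimit hk hγ hγ' hB hBa hBb hV hVa hVb hU hφ (hsel1 z) hz (hsel3 z hz0)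
  set A : Set ℂ := {z | z.im ≠ 0} with hA
  -- Extension by limits from the complement of the real axis needs no choice among the local
  -- continuations.
  set G : ℂ → ℂ := extendFrom A G₀ with hG
  have hAd : ∀ z : ℂ, z ∈ closure A := by
    intro z
    rw [Metric.mem_closure_iff]
    intro ε hε
    by_cases hz : z.im = 0
    · refine ⟨z + (ε / 2 : ℝ) * I, ?_, ?_⟩
      · simp [hA, hz, hε.ne']
      · rw [dist_eq_norm]
        simp [abs_of_pos hε]
        linarith
    · exact ⟨z, hz, by simpa using hε⟩
  have hloc : ∀ c Y : ℝ, 0 < Y → ∃ R > 0, DifferentiableOn ℂ G (box c R Y) ∧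
      ∀ z ∈ box c R Y, z.im ≠ 0 → G z = G₀ z := by
    intro c Y hY
    obtain ⟨φ₁, hφ₁, hs₁⟩ := hray c
    obtain ⟨φ₂, hφ₂, hs₂⟩ := hray (c + Real.pi)
    rw [show c + Real.pi - φ₂ = c - φ₂ + Real.pi by ring, Real.sin_add_pi] at hs₂
    have c1 : ∀ᶠ x in 𝓝 c, 0 < Real.sin (x - φ₁) :=
      (by fun_prop : Continuous fun x => Real.sin (x - φ₁)).continuousAt.eventually_const_lt
        (by linarith)
    have c2 : ∀ᶠ x in 𝓝 c, Real.sin (x - φ₂) < 0 :=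
      (by fun_prop : Continuous fun x => Real.sin (x - φ₂)).continuousAt.eventually_lt_const
        (by linarith)
    obtain ⟨R', hR', hsin⟩ := Metric.eventually_nhds_iff.1 (c1.and c2)
    obtain ⟨R, hR, g⟩ := exists_glue_rayLimit hk hγ hB hBa hBb hV hVa hVb hU hφ₁ hφ₂
      (hσ.trans_le hs₁) (by linarith)
    obtain ⟨f, hf, hfe⟩ := g Y hY
    have sub : box c (min R R') Y ⊆ box c R Y := fun w hw => by
      rw [mem_box] at hw ⊢; exact ⟨hw.1.trans_le (min_le_left _ _), hw.2⟩
    have hfG : ∀ z ∈ box c (min R R') Y, z.im ≠ 0 → f z = G₀ z := by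
      intro z hz hz0
      have hzc : dist z.re c < R' := by
        rw [Real.dist_eq]; exact (mem_box.1 hz).1.trans_le (min_le_right _ _)
      obtain ⟨q1, q2⟩ := hsin hzc
      rcases lt_or_gt_of_ne hz0 with h | h
      · rw [(hfe z (sub hz)).2 h]
        exact hG₀eq _ _ hφ₂ (mul_pos_of_neg_of_neg q2 h)
      · rw [(hfe z (sub hz)).1 h]
        exact hG₀eq _ _ hφ₁ (mul_pos q1 h)
    have hGf : ∀ z ∈ box c (min R R') Y, G z = f z := by
      intro z hz
      refine extendFrom_eq (hAd z) ?_
      have h1 : Tendsto f (𝓝[A] z) (𝓝 (f z)) :=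
        ((hf.mono sub).differentiableAt ((isOpen_box _ _ _).mem_nhds hz)).continuousAt.tendsto.mono_left
          nhdsWithin_le_nhds
      refine h1.congr' ?_
      filter_upwards [self_mem_nhdsWithin,
        mem_nhdsWithin_of_mem_nhds ((isOpen_box _ _ _).mem_nhds hz)] with w hw1 hw2
      exact hfG w hw2 hw1
    refine ⟨min R R', lt_min hR hR', (hf.mono sub).congr hGf, fun z hz hz0 => ?_⟩
    rw [hGf z hz, hfG z hz hz0]
  have hGG : ∀ z : ℂ, z.im ≠ 0 → G z = G₀ z := by
    intro z hz
    obtain ⟨R, hR, -, h⟩ := hloc z.re (|z.im| + 1) (by positivity)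
    exact h z (mem_box.2 ⟨by simpa using hR, by simp⟩) hz
  have hGd : Differentiable ℂ G := by
    intro z
    obtain ⟨R, hR, h, -⟩ := hloc z.re (|z.im| + 1) (by positivity)
    exact h.differentiableAt ((isOpen_box _ _ _).mem_nhds (mem_box.2 ⟨by simpa using hR, by simp⟩))
  have hper : Function.Periodic G (2 * Real.pi) := by
    have : (fun z => G (z + 2 * Real.pi)) = G := by
      refine Continuous.ext_on (s := A) (fun z => hAd z) (hGd.continuous.comp (by fun_prop))
        hGd.continuous fun z hz => ?_
      have hz : z.im ≠ 0 := hz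
      have hz' : (z + 2 * Real.pi).im ≠ 0 := by simpa using hz
      have hre : Real.sin ((z + 2 * Real.pi).re - sel z) = Real.sin (z.re - sel z) := by
        rw [← Real.sin_add_two_pi (z.re - sel z)]
        congr 1
        simp
        ring
      have him : (z + 2 * Real.pi).im = z.im := by simp
      rw [hGG _ hz', hGG _ hz, ← hG₀eq (sel z) _ (hsel1 z) (by rw [hre, him]; exact hsel3 z hz),
        rayLimit_periodic]
    exact fun z => congrFun this z
  have hlarge : ∀ z : ℂ, 1 ≤ |z.im| → ‖G z‖ ≤ 2 * B * (k + 2) / (k * σ) := by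
    intro z hz
    have hz0 : z.im ≠ 0 := by intro h; rw [h] at hz; norm_num at hz
    have hs := hsel3 z hz0
    have hlim := tendsto_rayIntegral (U := U) hk hB hBa hBb hs tendsto_natCast_atTop_atTop
    rw [hGG z hz0]
    refine le_of_tendsto hlim.norm (.of_forall fun n => ?_)
    refine (norm_rayIntegral_le hk hB hBa hBb n.cast_nonneg hs).trans ?_
    have hss := sinh_mul_pos hs
    have h6 : σ * Real.sinh |z.im| ≤ Real.sin (z.re - sel z) * Real.sinh z.im := by
      rw [← abs_of_pos hss, abs_mul, Real.abs_sinh]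
      refine mul_le_mul_of_nonneg_right ?_ (Real.sinh_nonneg_iff.2 (abs_nonneg _))
      have := hsel2 z hz0
      rw [← abs_of_pos hs, abs_mul] at this
      exact le_of_mul_le_mul_right this (abs_pos.2 hz0)
    have h7 : Real.cosh z.im ≤ 2 * Real.sinh |z.im| := by
      rw [← Real.cosh_abs, Real.cosh_eq, Real.sinh_eq]
      have e1 : 2 ≤ Real.exp |z.im| := by
        have := Real.add_one_le_exp |z.im|; linarith
      have e2 : Real.exp (-|z.im|) ≤ 1 / 2 := by
        rw [Real.exp_neg, inv_eq_one_div]; gcongr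
      linarith
    have h8 : 1 ≤ Real.cosh z.im := Real.one_le_cosh _
    have h9 : 0 < Real.sinh |z.im| := by linarith
    rw [div_le_div_iff₀ (by positivity) (by positivity)]
    calc B * (k * Real.cosh z.im + 2) * (k * σ)
        ≤ B * (k * (2 * Real.sinh |z.im|) + 2 * (2 * Real.sinh |z.im|)) * (k * σ) := by
          gcongr; linarith
      _ = 2 * B * (k + 2) * (k * (σ * Real.sinh |z.im|)) := by ring
      _ ≤ 2 * B * (k + 2) * (k * (Real.sin (z.re - sel z) * Real.sinh z.im)) := by gcongr
  obtain ⟨M, hM⟩ := ((isCompact_Icc (a := (0 : ℝ)) (b := 2 * Real.pi)).reProdIm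
    (isCompact_Icc (a := (-1 : ℝ)) (b := 1))).exists_bound_of_continuousOn hGd.continuous.continuousOn
  have hbdd : Bornology.IsBounded (range G) := by
    rw [isBounded_iff_forall_norm_le]
    refine ⟨max M (2 * B * (k + 2) / (k * σ)), ?_⟩
    rintro _ ⟨z, rfl⟩
    rcases le_total 1 |z.im| with h | h
    · exact (hlarge z h).trans (le_max_right _ _)
    · refine le_trans ?_ (le_max_left _ _)
      obtain ⟨n, hn⟩ : ∃ n : ℤ, z.re - n * (2 * Real.pi) ∈ Ico 0 (2 * Real.pi) := by
        obtain ⟨n, hn, -⟩ := existsUnique_sub_zsmul_mem_Ico (a := 2 * Real.pi) (by positivity) z.re 0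
        exact ⟨n, by simpa using hn⟩
      have := hper.sub_int_mul_eq n (x := z)
      rw [← this]
      refine hM _ ?_
      rw [Complex.mem_reProdIm]
      refine ⟨?_, ?_⟩
      · simpa using Ico_subset_Icc_self hn
      · simpa using abs_le.1 h
  refine ⟨G 0, fun φ z hφ hz => ?_⟩
  have hz0 : z.im ≠ 0 := by rintro h; rw [h] at hz; simp at hz
  rw [hG₀eq φ z hφ hz, ← hGG z hz0]
  exact hGd.apply_eq_apply_of_bounded hbdd z 0

/-- A bounded square integrable solution of the Helmholtz equation in a sector of vertex angle
greater than `π` vanishes in the sector. -/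
theorem eq_zero_of_helmholtz_sector (hk : 0 < k) (hγ : γ < Real.pi) (hγ' : Real.pi / 2 < γ)
    (hB : ∀ p, |U.V p| ≤ B)
    (hBa : ∀ p, |U.Va p| ≤ B) (hBb : ∀ p, |U.Vb p| ≤ B)
    (hV : Integrable fun p => U.V p ^ 2) (hVa : Integrable fun p => U.Va p ^ 2)
    (hVb : Integrable fun p => U.Vb p ^ 2)
    (hU : ∀ φ r, |φ| < γ → 0 < r → U.helm k φ r = 0) {φ r : ℝ} (hφ : |φ| < γ) (hr : 0 < r) :
    U.V (r * Real.cos φ, r * Real.sin φ) = 0 := by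
  obtain ⟨K, hK⟩ := exists_rayLimit_eq_const hk hγ hγ' hB hBa hBb hV hVa hVb hU
  have hkC : (k : ℂ) ≠ 0 := by exact_mod_cast hk.ne'
  have cv : Continuous fun r => U.val φ r := by
    have := U.differentiable_V.continuous
    unfold val; fun_prop
  -- the Laplace transform along the ray vanishes
  have hlap : ∀ ξ : ℝ, ∫ r in Ioi (0 : ℝ), U.val φ r * exp (-((1 + 2 * Real.pi * ξ * I) * r)) = 0 := by
    intro ξ
    -- This makes `i k cos τ = 1 + 2πiξ`, so the wave along the ray becomes the Laplace kernel on
    -- the line of real part one. The imaginary part of `cos τ` then gives `sin(Re τ) sinh(Im τ) = 1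
    -- / k > 0`, hence convergence for `τ + φ` and `-τ + φ` alike.
    obtain ⟨τ, hτ⟩ := Complex.cos_surjective ((2 * Real.pi * ξ - I) / k)
    have him : Real.sin τ.re * Real.sinh τ.im = 1 / k := by
      have h1 : (cos τ).im = -(1 / k) := by
        rw [hτ, Complex.div_ofReal_im]; simp [neg_div]
      have h2 : (cos τ).im = -(Real.sin τ.re * Real.sinh τ.im) := by
        rw [Complex.cos_eq, ← Complex.ofReal_cos, ← Complex.ofReal_sin, ← Complex.ofReal_sinh,
          ← Complex.ofReal_cosh]
        simp only [Complex.sub_im, Complex.mul_im, Complex.mul_re, Complex.ofReal_re,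
          Complex.ofReal_im, Complex.I_re, Complex.I_im]
        ring
      linarith
    have hpos : 0 < Real.sin τ.re * τ.im := by
      have h1 : 0 < Real.sin τ.re * Real.sinh τ.im := by rw [him]; positivity
      rcases pos_and_pos_or_neg_and_neg_of_mul_pos h1 with ⟨h2, h3⟩ | ⟨h2, h3⟩
      · exact mul_pos h2 (Real.sinh_pos_iff.1 h3)
      · exact mul_pos_of_neg_of_neg h2 (Real.sinh_neg_iff.1 h3)
    have hsin : sin τ ≠ 0 := by
      intro h
      have h1 := Complex.sin_sq_add_cos_sq τ
      rw [h, hτ] at h1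
      have h2 : (2 * Real.pi * ξ - I) ^ 2 = (k : ℂ) ^ 2 := by
        field_simp at h1
        linear_combination h1
      have h3 := congrArg Complex.re h2
      have h4 := congrArg Complex.im h2
      simp [sq] at h3 h4
      rw [h4] at h3
      simp at h3
      nlinarith
    have hz1 : 0 < Real.sin ((τ + φ).re - φ) * (τ + φ).im := by simpa using hpos
    have hz2 : 0 < Real.sin ((-τ + φ).re - φ) * (-τ + φ).im := by simpa using hpos
    have e1 := hK φ (τ + φ) hφ hz1
    have e2 := hK φ (-τ + φ) hφ hz2
    have i1 := integrableOn_rayDensity hk hB hBa hBb hz1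
    have i2 := integrableOn_rayDensity hk hB hBa hBb hz2
    have e3 : ∫ r in Ioi (0 : ℝ), (U.rayDensity k (τ + φ) φ r - U.rayDensity k (-τ + φ) φ r) = 0 := by
      rw [integral_sub i1 i2]
      exact sub_eq_zero.2 (e1.trans e2.symm)
    -- The cosine is even and the sine odd: the two waves coincide on the ray, the normal
    -- derivatives cancel, and a nonzero multiple of the value remains.
    have e4 : ∀ r : ℝ, U.rayDensity k (τ + φ) φ r - U.rayDensity k (-τ + φ) φ r
        = (-(2 * I * k * sin τ)) * (U.val φ r * exp (-((1 + 2 * Real.pi * ξ * I) * r))) := by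
      intro r
      have e5 : -(I * k * r * cos τ) = -((1 + 2 * Real.pi * ξ * I) * r) := by
        rw [hτ]
        field_simp
        linear_combination (r : ℂ) * Complex.I_sq
      simp only [rayDensity, wave, add_sub_cancel_right, Complex.sin_neg, Complex.cos_neg, e5]
      ring
    simp only [e4] at e3
    rw [integral_const_mul] at e3
    refine (mul_eq_zero.1 e3).resolve_left ?_
    simp [hkC, hsin]
  -- The factor `exp (-r)` makes the function integrable; its Fourier transform is the Laplace
  -- transform just shown to vanish, and inversion holds at the points of continuity `r > 0`.
  set h : ℝ → ℂ := (Ioi (0 : ℝ)).indicator fun r => U.val φ r * exp (-r) with hh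
  have hint : Integrable h := by
    rw [hh, integrable_indicator_iff measurableSet_Ioi]
    refine Integrable.mono' ((exp_neg_integrableOn_Ioi 0 one_pos).const_mul B)
      (cv.mul (by fun_prop)).aestronglyMeasurable (.of_forall fun r => ?_)
    rw [norm_mul, val, Complex.norm_real, Complex.norm_exp]
    have : (-(r : ℂ)).re = -1 * r := by simp
    rw [this]
    gcongr
    exact hB _
  have hF : FourierTransform.fourier h = fun _ : ℝ => (0 : ℂ) := by
    ext ξ
    rw [Real.fourier_real_eq_integral_exp_smul]
    rw [← hlap ξ, ← integral_indicator measurableSet_Ioi]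
    congr 1
    ext x
    by_cases hx : x ∈ Ioi (0 : ℝ)
    · simp only [hh, indicator_of_mem hx, smul_eq_mul]
      rw [mul_left_comm, ← Complex.exp_add]
      congr 2
      push_cast
      ring
    · simp [hh, indicator_of_notMem hx]
  have hc : ContinuousAt h r := by
    refine ((cv.mul (by fun_prop : Continuous fun r : ℝ => exp (-(r : ℂ)))).continuousAt).congr ?_
    filter_upwards [Ioi_mem_nhds hr] with x hx
    simp [hh, indicator_of_mem (show x ∈ Ioi (0 : ℝ) from hx)]
  have hinv := hint.fourierInv_fourier_eq (by
    rw [hF]; exact integrable_zero _ _ _) hc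
  have h0 : h r = 0 := by
    rw [← hinv]
    rw [hF, Real.fourierInv_eq]
    simp
  rw [hh, indicator_of_mem (show r ∈ Ioi (0 : ℝ) from hr)] at h0
  have := (mul_eq_zero.1 h0).resolve_right (Complex.exp_ne_zero _)
  simpa [val] using this

end PlaneJet

end WaterWaves

end SectorRellich

/-! ### Mollification of square integrable functions. -/

section Mollification

namespace WaterWaves

/-- The Cauchy–Schwarz inequality with a weight. -/
theorem sq_integral_mul_le {Ω : Type*} [MeasurableSpace Ω] {μ : Measure Ω} {w f : Ω → ℝ}
    (hw : ∀ x, 0 ≤ w x) (h1 : Integrable w μ) (h2 : Integrable (fun x => w x * f x) μ)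
    (h3 : Integrable (fun x => w x * f x ^ 2) μ) :
    (∫ x, w x * f x ∂μ) ^ 2 ≤ (∫ x, w x ∂μ) * ∫ x, w x * f x ^ 2 ∂μ := by
  have key : ∀ t : ℝ, 0 ≤ (∫ x, w x ∂μ) * (t * t) + (-2 * ∫ x, w x * f x ∂μ) * t
      + ∫ x, w x * f x ^ 2 ∂μ := by
    intro t
    have h : 0 ≤ ∫ x, w x * (f x - t) ^ 2 ∂μ :=
      integral_nonneg fun x => mul_nonneg (hw x) (sq_nonneg _)
    have e : ∀ x, w x * (f x - t) ^ 2 = (t * t) * w x + (-2 * t) * (w x * f x) + w x * f x ^ 2 :=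
      fun x => by ring
    simp only [e] at h
    have hi : Integrable (fun x => t * t * w x + -2 * t * (w x * f x)) μ :=
      (h1.const_mul _).add (h2.const_mul _)
    rw [integral_add hi h3,
      integral_add (h1.const_mul _) (h2.const_mul _), integral_const_mul, integral_const_mul] at h
    linarith
  have := discrim_le_zero key
  rw [discrim] at this
  nlinarith

theorem sq_integral_mul_le' {Ω : Type*} [MeasurableSpace Ω] {μ : Measure Ω} {f g : Ω → ℝ}
    (hf : MemLp f 2 μ) (hg : MemLp g 2 μ) :
    (∫ x, f x * g x ∂μ) ^ 2 ≤ (∫ x, f x ^ 2 ∂μ) * ∫ x, g x ^ 2 ∂μ := by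
  have hff := hf.integrable_sq
  have hgg := hg.integrable_sq
  have hfg : Integrable (fun x => f x * g x) μ := hf.integrable_mul hg
  have key : ∀ t : ℝ, 0 ≤ (∫ x, f x ^ 2 ∂μ) * (t * t) + (-2 * ∫ x, f x * g x ∂μ) * t
      + ∫ x, g x ^ 2 ∂μ := by
    intro t
    have h : 0 ≤ ∫ x, (g x - t * f x) ^ 2 ∂μ := integral_nonneg fun x => sq_nonneg _
    have e : ∀ x, (g x - t * f x) ^ 2 = (t * t) * f x ^ 2 + (-2 * t) * (f x * g x) + g x ^ 2 :=
      fun x => by ring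
    simp only [e] at h
    have hi : Integrable (fun x => t * t * f x ^ 2 + -2 * t * (f x * g x)) μ :=
      (hff.const_mul _).add (hfg.const_mul _)
    rw [integral_add hi hgg,
      integral_add (hff.const_mul _) (hfg.const_mul _), integral_const_mul,
      integral_const_mul] at h
    linarith
  have := discrim_le_zero key
  rw [discrim] at this
  nlinarith

variable {X : Type*} [NormedAddCommGroup X] [NormedSpace ℝ X] [FiniteDimensional ℝ X]
  [MeasurableSpace X] [BorelSpace X] {μ : Measure X} [μ.IsAddHaarMeasure]

/-- The convolution of `f` with the kernel `K`. -/
noncomputable def mollify (μ : Measure X) (K f : X → ℝ) (q : X) : ℝ := ∫ x, f x * K (q - x) ∂μ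

theorem mollify_eq_convolution (K f : X → ℝ) :
    mollify μ K f = convolution f K (ContinuousLinearMap.mul ℝ ℝ) μ := rfl

theorem mollify_eq_integral_sub (K f : X → ℝ) (q : X) :
    mollify μ K f q = ∫ z, K z * f (q - z) ∂μ := by
  rw [mollify, ← integral_sub_left_eq_self _ μ q]
  simp [mul_comm]

theorem contDiff_mollify {K f : X → ℝ} (hK : ContDiff ℝ ∞ K) (hKc : HasCompactSupport K)
    (hf : LocallyIntegrable f μ) : ContDiff ℝ ∞ (mollify μ K f) :=
  hKc.contDiff_convolution_right (ContinuousLinearMap.mul ℝ ℝ) hf (n := ⊤) hK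

theorem fderiv_mollify {K f : X → ℝ} (hK : ContDiff ℝ ∞ K) (hKc : HasCompactSupport K)
    (hf : LocallyIntegrable f μ) (q v : X) :
    fderiv ℝ (mollify μ K f) q v = mollify μ (fun z => fderiv ℝ K z v) f q := by
  have h := hKc.hasFDerivAt_convolution_right (ContinuousLinearMap.mul ℝ ℝ) hf
    (hK.of_le (by simp)) q
  rw [mollify_eq_convolution, h.fderiv]
  rw [convolution_precompR_apply _ hf (hKc.fderiv ℝ) (hK.continuous_fderiv (by simp))]
  rfl

theorem hasCompactSupport_fderiv_apply {K : X → ℝ} (hKc : HasCompactSupport K) (v : X) :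
    HasCompactSupport fun z => fderiv ℝ K z v := hKc.fderiv_apply ℝ v

theorem contDiff_fderiv_apply {K : X → ℝ} (hK : ContDiff ℝ ∞ K) (v : X) :
    ContDiff ℝ ∞ fun z => fderiv ℝ K z v :=
  (hK.fderiv_right (m := ∞) (by simp)).clm_apply contDiff_const

theorem memLp_of_hasCompactSupport {K : X → ℝ} (hK : Continuous K) (hKc : HasCompactSupport K) :
    MemLp K 2 μ := hK.memLp_of_hasCompactSupport hKc

theorem memLp_comp_sub {K : X → ℝ} (hK : MemLp K 2 μ) (q : X) :
    MemLp (fun x => K (q - x)) 2 μ :=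
  hK.comp_measurePreserving (Measure.measurePreserving_sub_left μ q)

theorem exists_bound_mollify {K f : X → ℝ} (hK : Continuous K) (hKc : HasCompactSupport K)
    (hf : MemLp f 2 μ) : ∃ B, ∀ q, |mollify μ K f q| ≤ B := by
  have hKL := memLp_of_hasCompactSupport (μ := μ) hK hKc
  refine ⟨((∫ x, f x ^ 2 ∂μ) * ∫ x, K x ^ 2 ∂μ) + 1, fun q => ?_⟩
  have h1 := sq_integral_mul_le' hf (memLp_comp_sub hKL q)
  rw [integral_sub_left_eq_self (fun x => K x ^ 2) μ q] at h1
  rw [mollify]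
  set a := ∫ x, f x * K (q - x) ∂μ
  rw [← sq_abs] at h1
  nlinarith [abs_nonneg a, sq_nonneg (|a| - 1)]

theorem sq_mollify_le {K f : X → ℝ} (hK : Continuous K) (hKc : HasCompactSupport K)
    (hf : MemLp f 2 μ) (q : X) :
    mollify μ K f q ^ 2 ≤ (∫ x, |K x| ∂μ) * ∫ x, f x ^ 2 * |K (q - x)| ∂μ := by
  have hKL := memLp_of_hasCompactSupport (μ := μ) hK hKc
  have hKi : Integrable (fun x => |K (q - x)|) μ :=
    ((hK.integrable_of_hasCompactSupport hKc).comp_sub_left q).abs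
  have hm : Integrable (fun x => |K (q - x)| * |f x|) μ :=
    (memLp_comp_sub hKL q).abs.integrable_mul hf.abs
  obtain ⟨C, hC⟩ := hKc.exists_bound_of_continuous hK
  have hm2 : Integrable (fun x => |K (q - x)| * |f x| ^ 2) μ := by
    have : Integrable (fun x => |f x| ^ 2) μ := by simpa using hf.integrable_sq
    refine this.bdd_mul (c := C) hKi.aestronglyMeasurable (.of_forall fun x => ?_)
    simpa using hC (q - x)
  have h1 := sq_integral_mul_le (fun x => abs_nonneg (K (q - x))) hKi hm hm2
  have e1 : ∫ x, |K (q - x)| ∂μ = ∫ x, |K x| ∂μ :=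
    integral_sub_left_eq_self (fun x => |K x|) μ q
  rw [e1] at h1
  have h2 : |mollify μ K f q| ≤ ∫ x, |K (q - x)| * |f x| ∂μ := by
    rw [mollify]
    refine (abs_integral_le_integral_abs).trans (le_of_eq ?_)
    congr 1; ext x; rw [abs_mul, mul_comm]
  calc mollify μ K f q ^ 2 = |mollify μ K f q| ^ 2 := (sq_abs _).symm
    _ ≤ (∫ x, |K (q - x)| * |f x| ∂μ) ^ 2 := pow_le_pow_left₀ (abs_nonneg _) h2 2
    _ ≤ _ := h1
    _ = _ := by congr 2; ext x; rw [sq_abs, mul_comm]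

theorem memLp_mollify {K f : X → ℝ} (hK : ContDiff ℝ ∞ K) (hKc : HasCompactSupport K)
    (hf : MemLp f 2 μ) : MemLp (mollify μ K f) 2 μ := by
  have hcont := (contDiff_mollify hK hKc (hf.locallyIntegrable (by norm_num))).continuous
  rw [memLp_two_iff_integrable_sq hcont.aestronglyMeasurable]
  have h1 : Integrable (convolution (fun x => f x ^ 2) (fun x => |K x|)
      (ContinuousLinearMap.mul ℝ ℝ) μ) μ :=
    hf.integrable_sq.integrable_convolution (ContinuousLinearMap.mul ℝ ℝ)
      (hK.continuous.integrable_of_hasCompactSupport hKc).abs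
  refine (h1.const_mul (∫ x, |K x| ∂μ)).mono' (hcont.pow 2).aestronglyMeasurable
    (.of_forall fun q => ?_)
  rw [Real.norm_of_nonneg (sq_nonneg _)]
  exact sq_mollify_le hK.continuous hKc hf q

/-- Translations are continuous in the mean of order two. -/
theorem tendsto_integral_sq_translate {f : X → ℝ} (hf : MemLp f 2 μ) :
    Tendsto (fun z => ∫ q, (f (q - z) - f q) ^ 2 ∂μ) (𝓝 0) (𝓝 0) := by
  set F : Lp ℝ 2 μ := hf.toLp f
  let g : C(X, C(X, X)) := ContinuousMap.curry ⟨fun p : X × X => p.2 - p.1, by fun_prop⟩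
  have hmp : ∀ z, MeasurePreserving (g z) μ μ := fun z => measurePreserving_sub_right μ z
  have hc : Continuous fun z => Lp.compMeasurePreserving (g z) (hmp z) F :=
    continuous_const.compMeasurePreservingLp g.continuous hmp (by simp)
  have h0 : Lp.compMeasurePreserving (g 0) (hmp 0) F = F := by
    apply Lp.ext
    filter_upwards [Lp.coeFn_compMeasurePreserving F (hmp 0)] with q hq
    rw [hq]
    simp [g]
  have ht : Tendsto (fun z => ‖Lp.compMeasurePreserving (g z) (hmp z) F - F‖ ^ 2) (𝓝 0) (𝓝 0) := by
    have h1 := ((hc.sub continuous_const).norm.pow 2).tendsto (0 : X) (f := fun z =>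
      ‖Lp.compMeasurePreserving (g z) (hmp z) F - F‖ ^ 2)
    simpa [h0] using h1
  refine ht.congr fun z => ?_
  rw [← real_inner_self_eq_norm_sq, L2.inner_def]
  refine integral_congr_ae ?_
  have hF := hf.coeFn_toLp
  filter_upwards [Lp.coeFn_sub (Lp.compMeasurePreserving (g z) (hmp z) F) F,
    Lp.coeFn_compMeasurePreserving F (hmp z), hF,
    (hmp z).quasiMeasurePreserving.ae_eq_comp hF] with q h1 h2 h3 h4
  rw [h1, Pi.sub_apply, h2, h3, h4]
  simp [g, sq]

/-- Mollifications converge in the mean of order two. -/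
theorem tendsto_integral_sq_mollify_sub {f : X → ℝ} (hf : MemLp f 2 μ) {K : ℕ → X → ℝ} {r : ℕ → ℝ}
    (hK : ∀ n, ContDiff ℝ ∞ (K n)) (hKc : ∀ n, HasCompactSupport (K n)) (h0 : ∀ n z, 0 ≤ K n z)
    (h1 : ∀ n, ∫ z, K n z ∂μ = 1) (hr : Tendsto r atTop (𝓝 0))
    (hsupp : ∀ n z, r n < ‖z‖ → K n z = 0) :
    Tendsto (fun n => ∫ q, (mollify μ (K n) f q - f q) ^ 2 ∂μ) atTop (𝓝 0) := by
  rw [Metric.tendsto_atTop]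
  intro ε hε
  obtain ⟨δ, hδ, hδε⟩ := Metric.tendsto_nhds_nhds.1 (tendsto_integral_sq_translate hf) (ε / 2)
    (by positivity)
  obtain ⟨N, hN⟩ := Metric.tendsto_atTop.1 hr δ hδ
  refine ⟨N, fun n hn => ?_⟩
  have hrn : r n < δ := by
    have := hN n hn
    rw [Real.dist_eq, sub_zero] at this
    exact (le_abs_self _).trans_lt this
  have hmeas : AEStronglyMeasurable (fun p : X × X => f (p.1 - p.2)) (μ.prod μ) :=
    hf.1.comp_quasiMeasurePreserving (quasiMeasurePreserving_sub_of_right_invariant μ μ)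
  have hKi : Integrable (K n) μ := (hK n).continuous.integrable_of_hasCompactSupport (hKc n)
  have hshift : ∀ q, MemLp (fun z => f (q - z) - f q) 2 (μ.restrict (tsupport (K n))) := by
    intro q
    have := (hKc n).isCompact.measure_lt_top (μ := μ)
    have : IsFiniteMeasure (μ.restrict (tsupport (K n))) := ⟨by simpa using this⟩
    exact ((hf.comp_measurePreserving (Measure.measurePreserving_sub_left μ q)).restrict _).sub
      (memLp_const _)
  -- Jensen's inequality for the probability density `K n`. After Tonelli's theorem the inner
  -- integral is the mean-square effect of a translation by `z`, small on the support of the kernel.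
  -- The kernels need not be centred at the origin, which is used later for shifted ones.
  have hle : ∀ q, ENNReal.ofReal ((mollify μ (K n) f q - f q) ^ 2)
      ≤ ∫⁻ z, ENNReal.ofReal (K n z * (f (q - z) - f q) ^ 2) ∂μ := by
    intro q
    obtain ⟨C, hC⟩ := (hKc n).exists_bound_of_continuous (hK n).continuous
    have i1 : Integrable (fun z => K n z * f (q - z)) μ :=
      (memLp_of_hasCompactSupport (hK n).continuous (hKc n)).integrable_mul
        (memLp_comp_sub hf q)
    have i2 : Integrable (fun z => K n z * (f (q - z) - f q)) μ := by
      simp only [mul_sub]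
      exact i1.sub (hKi.mul_const _)
    have i3 : Integrable (fun z => K n z * (f (q - z) - f q) ^ 2) μ := by
      rw [← integrableOn_iff_integrable_of_support_subset (s := tsupport (K n))]
      · refine (hshift q).integrable_sq.bdd_mul (c := C)
          (hK n).continuous.aestronglyMeasurable (.of_forall hC)
      · intro z hz
        refine subset_tsupport _ ?_
        intro h
        simp [h] at hz
    rw [← ofReal_integral_eq_lintegral_ofReal i3
      (.of_forall fun z => mul_nonneg (h0 n z) (sq_nonneg _))]
    refine ENNReal.ofReal_le_ofReal ?_
    have h2 := sq_integral_mul_le (h0 n) hKi i2 i3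
    rw [h1 n, one_mul] at h2
    refine le_trans (le_of_eq ?_) h2
    congr 1
    simp only [mul_sub]
    rw [integral_sub i1 (hKi.mul_const _), integral_mul_const, h1 n, one_mul,
      mollify_eq_integral_sub]
  have hbound : ∫⁻ q, ENNReal.ofReal ((mollify μ (K n) f q - f q) ^ 2) ∂μ
      ≤ ENNReal.ofReal (ε / 2) := by
    calc _ ≤ ∫⁻ q, ∫⁻ z, ENNReal.ofReal (K n z * (f (q - z) - f q) ^ 2) ∂μ ∂μ :=
          lintegral_mono hle
      _ = ∫⁻ z, ∫⁻ q, ENNReal.ofReal (K n z * (f (q - z) - f q) ^ 2) ∂μ ∂μ := by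
          refine lintegral_lintegral_swap ?_
          have hK2 : AEMeasurable (fun p : X × X => K n p.2) (μ.prod μ) :=
            ((hK n).continuous.comp continuous_snd).measurable.aemeasurable
          have hf2 : AEMeasurable (fun p : X × X => f p.1) (μ.prod μ) :=
            hf.1.comp_fst.aemeasurable
          exact (hK2.mul ((hmeas.aemeasurable.sub hf2).pow_const 2)).ennreal_ofReal
      _ ≤ ∫⁻ z, ENNReal.ofReal (K n z) * ENNReal.ofReal (ε / 2) ∂μ := by
          refine lintegral_mono fun z => ?_
          simp only [ENNReal.ofReal_mul (h0 n z)]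
          rw [lintegral_const_mul' _ _ ENNReal.ofReal_ne_top]
          by_cases hz : r n < ‖z‖
          · simp [hsupp n z hz]
          · gcongr
            have hi : Integrable (fun q => (f (q - z) - f q) ^ 2) μ :=
              ((hf.comp_measurePreserving (measurePreserving_sub_right μ z)).sub hf).integrable_sq
            rw [← ofReal_integral_eq_lintegral_ofReal hi (.of_forall fun q => sq_nonneg _)]
            refine ENNReal.ofReal_le_ofReal ?_
            have := hδε (x := z) (by simpa using (not_lt.1 hz).trans_lt hrn)
            rw [Real.dist_eq, sub_zero] at this
            exact ((le_abs_self _).trans_lt this).le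
      _ = ENNReal.ofReal (ε / 2) := by
          rw [lintegral_mul_const' _ _ ENNReal.ofReal_ne_top,
            ← ofReal_integral_eq_lintegral_ofReal hKi (.of_forall (h0 n)), h1 n]
          simp
  have hml : MemLp (fun q => mollify μ (K n) f q - f q) 2 μ :=
    (memLp_mollify (hK n) (hKc n) hf).sub hf
  rw [← ofReal_integral_eq_lintegral_ofReal hml.integrable_sq (.of_forall fun q => sq_nonneg _)]
    at hbound
  have h3 := (ENNReal.ofReal_le_ofReal_iff (by positivity)).1 hbound
  rw [Real.dist_eq, sub_zero, abs_of_nonneg (integral_nonneg fun q => sq_nonneg _)]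
  have h4 : ∫ q, (mollify μ (K n) f q - f q) ^ 2 ∂μ ≤ ε / 2 := h3
  linarith

end WaterWaves

end Mollification

/-! ### From smooth solutions to weak solutions in the sector. -/

section SectorUniqueness

namespace WaterWaves

theorem isOpen_sector (α : ℝ) : IsOpen (sector α) :=
  isOpen_lt (by fun_prop) (by fun_prop)

/-- Angles are measured from the positive `x₂` axis, so that the sector becomes `|φ| < π/2 + α`,
symmetric about zero. For `|φ| ≤ π` the right-hand side is the positivity of `cos(|φ| - α)`. -/
theorem mem_sector_iff_cos {α : ℝ} (hα : α ∈ Ioo 0 (Real.pi / 2)) {φ r : ℝ} (hr : 0 < r) :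
    (r * Real.sin φ, r * Real.cos φ) ∈ sector α ↔
      0 < Real.cos φ * Real.cos α + |Real.sin φ| * Real.sin α := by
  have hc : 0 < Real.cos α := Real.cos_pos_of_mem_Ioo ⟨by linarith [hα.1, Real.pi_pos], hα.2⟩
  have e : r * Real.cos φ + |r * Real.sin φ| * Real.tan α
      = (Real.cos φ * Real.cos α + |Real.sin φ| * Real.sin α) * (r / Real.cos α) := by
    rw [abs_mul, abs_of_pos hr, Real.tan_eq_sin_div_cos]
    field_simp
  have h : (r * Real.sin φ, r * Real.cos φ) ∈ sector α ↔
      0 < r * Real.cos φ + |r * Real.sin φ| * Real.tan α := by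
    simp only [sector, mem_ofPred_eq]
    constructor <;> intro h <;> linarith
  rw [h, e]
  exact mul_pos_iff_of_pos_right (by positivity)

theorem cos_abs_sub (φ α : ℝ) : Real.cos (|φ| - α)
    = Real.cos φ * Real.cos α + Real.sin |φ| * Real.sin α := by
  rw [Real.cos_sub, Real.cos_abs]

theorem abs_sin_of_abs_le_pi {φ : ℝ} (h : |φ| ≤ Real.pi) : Real.sin |φ| = |Real.sin φ| := by
  rw [Real.abs_sin_eq_sin_abs_of_abs_le_pi h]

theorem mem_sector_of_abs_lt {α : ℝ} (hα : α ∈ Ioo 0 (Real.pi / 2)) {φ r : ℝ} (hr : 0 < r)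
    (hφ : |φ| < Real.pi / 2 + α) : (r * Real.sin φ, r * Real.cos φ) ∈ sector α := by
  rw [mem_sector_iff_cos hα hr, ← abs_sin_of_abs_le_pi (by linarith [hα.2]), ← cos_abs_sub]
  exact Real.cos_pos_of_mem_Ioo ⟨by linarith [hα.2, abs_nonneg φ], by linarith⟩

theorem exists_polar_of_mem_sector {α : ℝ} (hα : α ∈ Ioo 0 (Real.pi / 2)) {x : ℝ × ℝ}
    (hx : x ∈ sector α) : ∃ φ r : ℝ, 0 < r ∧ |φ| < Real.pi / 2 + α ∧
      x = (r * Real.sin φ, r * Real.cos φ) := by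
  have h0 : (⟨x.2, x.1⟩ : ℂ) ≠ 0 := by
    intro h
    have h1 : x.2 = 0 := congrArg Complex.re h
    have h2 : x.1 = 0 := congrArg Complex.im h
    simp [sector, h1, h2] at hx
  set z : ℂ := ⟨x.2, x.1⟩
  have hr : 0 < ‖z‖ := norm_pos_iff.2 h0
  have hxz : x = (‖z‖ * Real.sin z.arg, ‖z‖ * Real.cos z.arg) := by
    rw [Complex.norm_mul_sin_arg, Complex.norm_mul_cos_arg]
  refine ⟨z.arg, ‖z‖, hr, ?_, hxz⟩
  by_contra! hge
  have hle := Complex.abs_arg_le_pi z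
  rw [hxz, mem_sector_iff_cos hα hr, ← abs_sin_of_abs_le_pi hle, ← cos_abs_sub] at hx
  have := Real.cos_nonpos_of_pi_div_two_le_of_le (x := |z.arg| - α) (by linarith)
    (by linarith [hα.1, hα.2])
  linarith

/-- Balls here are squares: inside one, the abscissa changes the threshold by at most `ε tan α` and
the ordinate drops by at most `ε`. A mollification of radius `ε`, shifted up by this amount,
therefore uses only test functions supported in the sector and solves the equation in all of it. -/
theorem closedBall_subset_sector {α : ℝ} (hα : α ∈ Ioo 0 (Real.pi / 2)) {x : ℝ × ℝ}
    (hx : x ∈ sector α) {ε : ℝ} :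
    Metric.closedBall (x.1, x.2 + ε * (1 + Real.tan α)) ε ⊆ sector α := by
  intro y hy
  have ht : 0 < Real.tan α := Real.tan_pos_of_pos_of_lt_pi_div_two hα.1 hα.2
  rw [Metric.mem_closedBall, Prod.dist_eq, max_le_iff, Real.dist_eq, Real.dist_eq] at hy
  have h1 := abs_le.1 hy.2
  have h2 : |x.1| ≤ |y.1| + ε := by
    have := abs_sub_abs_le_abs_sub x.1 y.1
    rw [abs_sub_comm] at this
    linarith [hy.1]
  simp only [sector, mem_ofPred_eq] at hx ⊢
  nlinarith [h1.1]

theorem hasFDerivAt_comp_swap {v : ℝ × ℝ → ℝ} (hv : Differentiable ℝ v) (s : ℝ) (p : ℝ × ℝ) :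
    HasFDerivAt (fun p : ℝ × ℝ => v (p.2, p.1 + s))
      (fderiv ℝ v (p.2, p.1 + s) (0, 1) • ContinuousLinearMap.fst ℝ ℝ ℝ
        + fderiv ℝ v (p.2, p.1 + s) (1, 0) • ContinuousLinearMap.snd ℝ ℝ ℝ) p := by
  have h1 : HasFDerivAt (fun p : ℝ × ℝ => (p.2, p.1 + s))
      ((ContinuousLinearMap.snd ℝ ℝ ℝ).prod (ContinuousLinearMap.fst ℝ ℝ ℝ)) p :=
    hasFDerivAt_snd.prodMk (hasFDerivAt_fst.add_const s)
  refine ((hv (p.2, p.1 + s)).hasFDerivAt.comp p h1).congr_fderiv ?_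
  ext <;> simp

/-- The jet of a smooth function with the axes interchanged and shifted. -/
noncomputable def PlaneJet.ofSmooth (v : ℝ × ℝ → ℝ) (hv : ContDiff ℝ ∞ v) (s : ℝ) : PlaneJet where
  V p := v (p.2, p.1 + s)
  Va p := fderiv ℝ v (p.2, p.1 + s) (0, 1)
  Vb p := fderiv ℝ v (p.2, p.1 + s) (1, 0)
  Vaa p := fderiv ℝ (fun q => fderiv ℝ v q (0, 1)) (p.2, p.1 + s) (0, 1)
  Vab p := fderiv ℝ (fun q => fderiv ℝ v q (0, 1)) (p.2, p.1 + s) (1, 0)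
  Vba p := fderiv ℝ (fun q => fderiv ℝ v q (1, 0)) (p.2, p.1 + s) (0, 1)
  Vbb p := fderiv ℝ (fun q => fderiv ℝ v q (1, 0)) (p.2, p.1 + s) (1, 0)
  hasFDerivAt p := hasFDerivAt_comp_swap (hv.differentiable (by simp)) s p
  hasFDerivAt_a p := hasFDerivAt_comp_swap
    ((contDiff_fderiv_apply hv (0, 1)).differentiable (by simp)) s p
  hasFDerivAt_b p := hasFDerivAt_comp_swap
    ((contDiff_fderiv_apply hv (1, 0)).differentiable (by simp)) s p
  continuous_aa := (contDiff_fderiv_apply (contDiff_fderiv_apply hv (0, 1)) (0, 1)).continuous.comp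
    (by fun_prop)
  continuous_bb := (contDiff_fderiv_apply (contDiff_fderiv_apply hv (1, 0)) (1, 0)).continuous.comp
    (by fun_prop)

theorem integrable_sq_comp_swap {w : ℝ × ℝ → ℝ} (hw : MemLp w 2 volume) (s : ℝ) :
    Integrable fun p : ℝ × ℝ => w (p.2, p.1 + s) ^ 2 := by
  have h1 : MeasurePreserving (Prod.swap : ℝ × ℝ → ℝ × ℝ) volume volume :=
    Measure.measurePreserving_swap
  have h2 : MeasurePreserving (fun q : ℝ × ℝ => q + (0, s)) volume volume :=
    measurePreserving_add_right volume _
  have := (hw.comp_measurePreserving (h2.comp h1)).integrable_sq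
  refine this.congr (.of_forall fun p => ?_)
  simp only [Function.comp_apply, Prod.swap, Prod.mk_add_mk, add_zero]

theorem fderiv_comp_sub_apply {E : Type*} [NormedAddCommGroup E] [NormedSpace ℝ E] {K : E → ℝ}
    (hK : Differentiable ℝ K) (q e x : E) :
    fderiv ℝ (fun x => K (q - x)) x e = - fderiv ℝ K (q - x) e := by
  have h := (hK (q - x)).hasFDerivAt.comp x ((hasFDerivAt_id x).const_sub q)
  change HasFDerivAt (fun x => K (q - x)) _ x at h
  rw [h.fderiv]
  simp

/-- The two-dimensional Rellich theorem in a sector of vertex angle greater than `π`: square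
integrable weak solutions of the Helmholtz equation vanish. -/
theorem ae_eq_zero_of_weak_helmholtz {α : ℝ} (hα : α ∈ Ioo 0 (Real.pi / 2)) {k : ℝ} (hk : 0 < k)
    {f : ℝ × ℝ → ℝ} (hf : MemLp f 2 volume)
    (hw : ∀ η : ℝ × ℝ → ℝ, ContDiff ℝ ∞ η → HasCompactSupport η → tsupport η ⊆ sector α →
      ∫ x, f x * (fderiv ℝ (fun q => fderiv ℝ η q (1, 0)) x (1, 0)
        + fderiv ℝ (fun q => fderiv ℝ η q (0, 1)) x (0, 1) + k ^ 2 * η x) = 0) :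
    ∀ᵐ x, x ∈ sector α → f x = 0 := by
  have hloc : LocallyIntegrable f volume := hf.locallyIntegrable (by norm_num)
  let b : ℕ → ContDiffBump (0 : ℝ × ℝ) := fun n =>
    ⟨1 / (2 * ((n : ℝ) + 1)), 1 / ((n : ℝ) + 1), by positivity, by
      rw [div_lt_div_iff₀ (by positivity) (by positivity)]; linarith [n.cast_nonneg (α := ℝ)]⟩
  -- The mollified and shifted function is a classical bounded square integrable solution in the
  -- whole sector, with bounded square integrable derivatives, so the smooth Rellich theorem applies
  -- to it.
  have hvanish : ∀ n, ∀ x ∈ sector α,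
      mollify volume ((b n).normed volume) f (x.1, x.2 + (b n).rOut * (1 + Real.tan α)) = 0 := by
    intro n x hx
    set K := (b n).normed (volume : Measure (ℝ × ℝ))
    set s := (b n).rOut * (1 + Real.tan α)
    have hK : ContDiff ℝ ∞ K := (b n).contDiff_normed
    have hKc : HasCompactSupport K := (b n).hasCompactSupport_normed
    have hv : ContDiff ℝ ∞ (mollify volume K f) := contDiff_mollify hK hKc hloc
    have hd : ∀ e, (fun q => fderiv ℝ (mollify volume K f) q e)
        = mollify volume (fun z => fderiv ℝ K z e) f := fun e => by
      ext q; exact fderiv_mollify hK hKc hloc q e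
    have hdd : ∀ e q, fderiv ℝ (fun q => fderiv ℝ (mollify volume K f) q e) q e
        = mollify volume (fun z => fderiv ℝ (fun z => fderiv ℝ K z e) z e) f q := by
      intro e q
      rw [hd e]
      exact fderiv_mollify (contDiff_fderiv_apply hK e) (hasCompactSupport_fderiv_apply hKc e)
        hloc q e
    have hint : ∀ (L : ℝ × ℝ → ℝ) (q : ℝ × ℝ), ContDiff ℝ ∞ L → HasCompactSupport L →
        Integrable (fun x => f x * L (q - x)) := fun L q h1 h2 =>
      hf.integrable_mul (memLp_comp_sub (memLp_of_hasCompactSupport h1.continuous h2) q)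
    have hhelm : ∀ y ∈ sector α,
        fderiv ℝ (fun q => fderiv ℝ (mollify volume K f) q (0, 1)) (y.1, y.2 + s) (0, 1)
        + fderiv ℝ (fun q => fderiv ℝ (mollify volume K f) q (1, 0)) (y.1, y.2 + s) (1, 0)
        + k ^ 2 * mollify volume K f (y.1, y.2 + s) = 0 := by
      intro y hy
      set q : ℝ × ℝ := (y.1, y.2 + s)
      have hsub : tsupport (fun x => K (q - x)) ⊆ Metric.closedBall q (b n).rOut := by
        refine closure_minimal (fun x hx => ?_) Metric.isClosed_closedBall
        have : q - x ∈ Function.support K := hx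
        rw [(b n).support_normed_eq, mem_ball_zero_iff] at this
        rw [mem_closedBall_iff_norm', ]
        exact this.le
      have hηc : HasCompactSupport fun x => K (q - x) :=
        (isCompact_closedBall q _).of_isClosed_subset isClosed_closure hsub
      have h1 := hw (fun x => K (q - x)) (hK.comp (contDiff_const.sub contDiff_id)) hηc
        (hsub.trans (closedBall_subset_sector hα hy))
      have e1 : ∀ e x, fderiv ℝ (fun z => fderiv ℝ (fun x => K (q - x)) z e) x e
          = fderiv ℝ (fun z => fderiv ℝ K z e) (q - x) e := by
        intro e x
        have : (fun z => fderiv ℝ (fun x => K (q - x)) z e) = fun z => - fderiv ℝ K (q - z) e := by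
          ext z; exact fderiv_comp_sub_apply (hK.differentiable (by simp)) q e z
        rw [this, fderiv_fun_neg, neg_apply,
          
            fderiv_comp_sub_apply ((contDiff_fderiv_apply hK e).differentiable (by simp)),
            neg_neg]
      simp only [e1, mul_add, mul_left_comm _ (k ^ 2)] at h1
      have hi : ∀ e, Integrable fun x => f x * fderiv ℝ (fun z => fderiv ℝ K z e) (q - x) e :=
        fun e => hint _ q (contDiff_fderiv_apply (contDiff_fderiv_apply hK e) e)
          (hasCompactSupport_fderiv_apply (hasCompactSupport_fderiv_apply hKc e) e)
      have hi2 : Integrable (fun x => f x * fderiv ℝ (fun z => fderiv ℝ K z (1, 0)) (q - x) (1, 0)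
          + f x * fderiv ℝ (fun z => fderiv ℝ K z (0, 1)) (q - x) (0, 1)) := (hi _).add (hi _)
      rw [integral_add hi2 ((hint K q hK hKc).const_mul _), integral_add (hi _) (hi _),
        integral_const_mul] at h1
      rw [hdd, hdd]
      simp only [mollify]
      linarith
    let U : PlaneJet := PlaneJet.ofSmooth (mollify volume K f) hv s
    obtain ⟨B0, hB0⟩ := exists_bound_mollify hK.continuous hKc hf
    have hKe := fun e => contDiff_fderiv_apply hK e
    have hKec := fun e => hasCompactSupport_fderiv_apply hKc e
    obtain ⟨B1, hB1⟩ := exists_bound_mollify (hKe (0, 1)).continuous (hKec _) hf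
    obtain ⟨B2, hB2⟩ := exists_bound_mollify (hKe (1, 0)).continuous (hKec _) hf
    have hde : ∀ e q, fderiv ℝ (mollify volume K f) q e
        = mollify volume (fun z => fderiv ℝ K z e) f q := fun e q => fderiv_mollify hK hKc hloc q e
    obtain ⟨φ, r, hr, hφ, hxe⟩ := exists_polar_of_mem_sector hα hx
    have hconc := PlaneJet.eq_zero_of_helmholtz_sector (U := U) (B := max B0 (max B1 B2)) (k := k)
      (γ := Real.pi / 2 + α) hk (by linarith [hα.2]) (by linarith [hα.1])
      (fun p => (hB0 _).trans (le_max_left _ _))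
      (fun p => by
        change |fderiv ℝ (mollify volume K f) (p.2, p.1 + s) (0, 1)| ≤ _
        rw [hde]
        exact (hB1 _).trans ((le_max_left _ _).trans (le_max_right _ _)))
      (fun p => by
        change |fderiv ℝ (mollify volume K f) (p.2, p.1 + s) (1, 0)| ≤ _
        rw [hde]
        exact (hB2 _).trans ((le_max_right _ _).trans (le_max_right _ _)))
      (integrable_sq_comp_swap (memLp_mollify hK hKc hf) s)
      (by
        have := integrable_sq_comp_swap (memLp_mollify (hKe (0, 1)) (hKec _) hf) s
        refine this.congr (.of_forall fun p => ?_)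
        simp only [← hde]
        rfl)
      (by
        have := integrable_sq_comp_swap (memLp_mollify (hKe (1, 0)) (hKec _) hf) s
        refine this.congr (.of_forall fun p => ?_)
        simp only [← hde]
        rfl)
      (fun φ r hφ hr => hhelm _ (mem_sector_of_abs_lt hα hr hφ)) hφ hr
    rw [hxe]
    exact hconc
  have hrOut : Tendsto (fun n => (b n).rOut) atTop (𝓝 0) :=
    tendsto_one_div_add_atTop_nhds_zero_nat
  filter_upwards [ContDiffBump.ae_convolution_tendsto_right_of_locallyIntegrable (φ := b) (K := 2)
    hrOut (.of_forall fun n => le_of_eq (by simp only [b]; field_simp)) hloc] with x hx hxF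
  have hx' : Tendsto (fun n => mollify volume ((b n).normed volume) f x) atTop (𝓝 (f x)) := by
    refine hx.congr fun n => ?_
    rw [mollify_eq_integral_sub]
    rfl
  refine tendsto_nhds_unique hx' (tendsto_const_nhds.congr' ?_)
  -- The shift is undone by starting from a lower point, which for large `n` still lies in the open
  -- sector; hence the mollifications vanish at `x` itself.
  have hlim : Tendsto (fun n => (x.1, x.2 - (b n).rOut * (1 + Real.tan α))) atTop (𝓝 x) := by
    have : Tendsto (fun n => (x.1, x.2 - (b n).rOut * (1 + Real.tan α))) atTop
        (𝓝 (x.1, x.2 - 0 * (1 + Real.tan α))) :=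
      tendsto_const_nhds.prodMk_nhds (tendsto_const_nhds.sub (hrOut.mul_const _))
    simpa using this
  filter_upwards [hlim.eventually ((isOpen_sector α).mem_nhds hxF)] with n hn
  have := hvanish n (x.1, x.2 - (b n).rOut * (1 + Real.tan α)) hn
  simpa using this.symm

end WaterWaves

end SectorUniqueness

/-! ### Weak derivatives and boundary values on an interval. -/

section Interval

namespace WaterWaves

theorem exists_Icc_of_isCompact_subset_Ioo {K : Set ℝ} {a b : ℝ} (hK : IsCompact K)
    (hne : K.Nonempty) (hKs : K ⊆ Ioo a b) : ∃ c d, a < c ∧ d < b ∧ c ≤ d ∧ K ⊆ Icc c d := by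
  have h1 := hK.sInf_mem hne
  have h2 := hK.sSup_mem hne
  exact ⟨sInf K, sSup K, (hKs h1).1, (hKs h2).2, csInf_le hK.bddBelow h2,
    fun x hx => ⟨csInf_le hK.bddBelow hx, le_csSup hK.bddAbove hx⟩⟩

/-- A smooth function with compact support in an interval and vanishing integral is the derivative
of a function of the same kind. -/
theorem exists_primitive_of_integral_eq_zero {a b : ℝ} {η : ℝ → ℝ} (hη : ContDiff ℝ ∞ η)
    (hc : HasCompactSupport η) (hs : tsupport η ⊆ Ioo a b) (h0 : ∫ y in a..b, η y = 0) :
    ∃ θ : ℝ → ℝ, ContDiff ℝ ∞ θ ∧ HasCompactSupport θ ∧ tsupport θ ⊆ Ioo a b ∧ deriv θ = η := by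
  rcases (tsupport η).eq_empty_or_nonempty with hne | hne
  · have : η = 0 := by
      rwa [tsupport, closure_empty_iff, Function.support_eq_empty_iff] at hne
    exact ⟨0, contDiff_const, HasCompactSupport.zero, by simp, by rw [this]; ext; simp⟩
  obtain ⟨c, d, hac, hdb, hcd, hsub⟩ := exists_Icc_of_isCompact_subset_Ioo hc.isCompact hne hs
  have hz : ∀ y, y ∉ Icc c d → η y = 0 := fun y hy =>
    image_eq_zero_of_notMem_tsupport fun h => hy (hsub h)
  have hint : ∀ x y, IntervalIntegrable η volume x y := fun x y =>
    hη.continuous.intervalIntegrable x y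
  have hder : ∀ y, HasDerivAt (fun y => ∫ z in a..y, η z) (η y) y := fun y =>
    intervalIntegral.integral_hasDerivAt_right (hint a y)
      (hη.continuous.stronglyMeasurableAtFilter _ _) hη.continuous.continuousAt
  have hd : deriv (fun y => ∫ z in a..y, η z) = η := funext fun y => (hder y).deriv
  have hsupp : tsupport (fun y => ∫ z in a..y, η z) ⊆ Icc c d := by
    refine closure_minimal (fun y hy => ?_) isClosed_Icc
    by_contra hn
    refine hy ?_
    rcases lt_or_ge y c with h | h
    · refine (intervalIntegral.integral_congr (g := fun _ => 0) fun z hz' => ?_).trans (by simp)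
      refine hz z fun hzc => ?_
      have := hz'.2
      have h3 : max a y < c := max_lt hac h
      linarith [hzc.1]
    · have hy : d < y := by
        by_contra! h5
        exact hn ⟨h, h5⟩
      change ∫ z in a..y, η z = 0
      rw [← intervalIntegral.integral_add_adjacent_intervals (hint a b) (hint b y), h0, zero_add]
      refine (intervalIntegral.integral_congr (g := fun _ => 0) fun z hz' => ?_).trans (by simp)
      refine hz z fun hzc => ?_
      have := hz'.1
      have h3 : d < min b y := lt_min hdb hy
      linarith [hzc.2]
  refine ⟨fun y => ∫ z in a..y, η z, ?_, isCompact_Icc.of_isClosed_subset isClosed_closure hsupp,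
    hsupp.trans fun y hy => ⟨hac.trans_le hy.1, hy.2.trans_lt hdb⟩, hd⟩
  rw [contDiff_infty_iff_deriv, hd]
  exact ⟨fun y => (hder y).differentiableAt, hη⟩

/-- The lemma of du Bois-Reymond. -/
theorem ae_eq_const_of_integral_mul_deriv {a b : ℝ} (hab : a < b) {u : ℝ → ℝ}
    (hu : IntervalIntegrable u volume a b)
    (h : ∀ θ : ℝ → ℝ, ContDiff ℝ ∞ θ → HasCompactSupport θ → tsupport θ ⊆ Ioo a b →
      ∫ y in a..b, u y * deriv θ y = 0) : ∃ c, ∀ᵐ y, y ∈ Ioo a b → u y = c := by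
  let B : ContDiffBump ((a + b) / 2) := ⟨(b - a) / 8, (b - a) / 4, by linarith, by linarith⟩
  set ρ := B.normed volume
  have hρ : ContDiff ℝ ∞ ρ := B.contDiff_normed
  have hρc : HasCompactSupport ρ := B.hasCompactSupport_normed
  have hρs : tsupport ρ ⊆ Ioo a b := by
    rw [B.tsupport_normed_eq, Real.closedBall_eq_Icc]
    rintro y ⟨h1, h2⟩
    constructor <;> simp only [B] at h1 h2 <;> linarith
  have hfull : ∀ f : ℝ → ℝ, tsupport f ⊆ Ioo a b → ∫ y in a..b, f y = ∫ y, f y := by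
    intro f hf
    rw [intervalIntegral.integral_of_le hab.le]
    exact setIntegral_eq_integral_of_forall_compl_eq_zero fun x hx =>
      image_eq_zero_of_notMem_tsupport fun h => hx (Ioo_subset_Ioc_self (hf h))
  have hρ1 : ∫ y in a..b, ρ y = 1 := by
    rw [hfull ρ hρs]; exact B.integral_normed
  refine ⟨∫ y in a..b, u y * ρ y, ?_⟩
  have hmul : ∀ f : ℝ → ℝ, Continuous f → IntervalIntegrable (fun y => u y * f y) volume a b :=
    fun f hf => hu.mul_continuousOn hf.continuousOn
  have hloc : LocallyIntegrableOn (fun y => u y - ∫ y in a..b, u y * ρ y) (Ioo a b) volume := by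
    refine (IntegrableOn.mono_set (t := Ioc a b) ?_ Ioo_subset_Ioc_self).locallyIntegrableOn
    exact (hu.sub intervalIntegrable_const).1
  have := isOpen_Ioo.ae_eq_zero_of_integral_contDiff_smul_eq_zero hloc ?_
  · filter_upwards [this] with y hy hyI
    linarith [hy hyI]
  intro η hη hc hs
  set m := ∫ y in a..b, η y
  have hηi : IntervalIntegrable η volume a b := hη.continuous.intervalIntegrable _ _
  have hρi : IntervalIntegrable ρ volume a b := hρ.continuous.intervalIntegrable _ _
  have htz : tsupport (fun y => η y - m * ρ y) ⊆ Ioo a b := by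
    refine (closure_mono (t := tsupport η ∪ tsupport ρ) fun y hy => ?_).trans
      ((isClosed_closure.union isClosed_closure).closure_subset.trans (union_subset hs hρs))
    by_contra hn
    rw [mem_union, not_or] at hn
    exact hy (by simp [image_eq_zero_of_notMem_tsupport hn.1, image_eq_zero_of_notMem_tsupport hn.2])
  -- Subtracting `m ρ` makes the integral vanish, so that the test function becomes a derivative.
  obtain ⟨θ, h1, h2, h3, h4⟩ := exists_primitive_of_integral_eq_zero (a := a) (b := b)
    (η := fun y => η y - m * ρ y)
    (hη.sub (contDiff_const.mul hρ)) (hc.sub (hρc.mul_left)) htz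
    (by rw [intervalIntegral.integral_sub hηi (hρi.const_mul _),
      intervalIntegral.integral_const_mul, hρ1]; simp [m])
  have h5 := h θ h1 h2 h3
  rw [h4] at h5
  simp only [mul_sub, mul_left_comm _ m] at h5
  rw [intervalIntegral.integral_sub (hmul η hη.continuous) ((hmul ρ hρ.continuous).const_mul _),
    intervalIntegral.integral_const_mul] at h5
  rw [← hfull _ ((tsupport_smul_subset_left _ _).trans hs)]
  simp only [smul_eq_mul, mul_sub]
  rw [intervalIntegral.integral_sub (by simpa [mul_comm] using hmul η hη.continuous)
    (hηi.mul_const _), intervalIntegral.integral_mul_const]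
  simp only [mul_comm (η _)]
  linarith

theorem integral_deriv_mul_primitive {a b c : ℝ} {G M : ℝ → ℝ}
    (hG : IntervalIntegrable G volume a b) (hM : ContDiff ℝ ∞ M) :
    ∫ y in a..b, (deriv M y * (c + ∫ z in a..y, G z) + M y * G y)
      = M b * (c + ∫ z in a..b, G z) - M a * c := by
  have hMa : AbsolutelyContinuousOnInterval M a b :=
    (hM.contDiffOn.of_le (by simp)).absolutelyContinuousOnInterval
  have hca : AbsolutelyContinuousOnInterval (fun _ : ℝ => c) a b :=
    (contDiff_const (n := 1)).contDiffOn.absolutelyContinuousOnInterval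
  have hP : AbsolutelyContinuousOnInterval (fun y => c + ∫ z in a..y, G z) a b :=
    hca.add (hG.absolutelyContinuousOnInterval_intervalIntegral left_mem_uIcc)
  have := hMa.integral_deriv_mul_eq_sub hP
  simp only [intervalIntegral.integral_same, add_zero] at this
  rw [← this]
  refine intervalIntegral.integral_congr_ae ?_
  filter_upwards [hG.ae_hasDerivAt_integral] with y hy hyI
  rw [((hy (uIoc_subset_uIcc hyI) a left_mem_uIcc).const_add c).deriv]

/-- Integration by parts on `(-1, 0)` for a weakly differentiable function whose value at `0` is
attained in the mean. -/
theorem integral_mul_deriv_of_weak {u G M : ℝ → ℝ} {T : ℝ}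
    (hu : IntervalIntegrable u volume (-1) 0) (hG : IntervalIntegrable G volume (-1) 0)
    (h : ∀ θ : ℝ → ℝ, ContDiff ℝ ∞ θ → HasCompactSupport θ → tsupport θ ⊆ Ioo (-1) 0 →
      ∫ y in (-1)..0, (u y * deriv θ y + G y * θ y) = 0)
    (hT : Tendsto (fun ε : ℝ => ε⁻¹ * ∫ y in (-ε)..0, |u y - T|) (𝓝[>] 0) (𝓝 0))
    (hM : ContDiff ℝ ∞ M) (hM1 : M (-1) = 0) :
    ∫ y in (-1)..0, (M y * G y + deriv M y * u y) = M 0 * T := by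
  set P : ℝ → ℝ := fun y => ∫ z in (-1)..y, G z
  have hPc : ContinuousOn P (Icc (-1) 0) := by
    have := (hG.absolutelyContinuousOnInterval_intervalIntegral (c := -1)
      left_mem_uIcc).continuousOn
    rwa [uIcc_of_le (by norm_num)] at this
  have hPi : IntervalIntegrable P volume (-1) 0 :=
    ContinuousOn.intervalIntegrable (by rwa [uIcc_of_le (by norm_num)])
  -- The primitive `P` of `G` has the same weak derivative as `u`, so `u = c + P` almost everywhere.
  -- The assumption on means identifies `T` with `c + P 0`, because `P` is continuous up to the end
  -- point. At the other end `M (-1) = 0` removes the boundary term, so no value of `u` is needed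
  -- there.
  obtain ⟨c, hc⟩ := ae_eq_const_of_integral_mul_deriv (a := -1) (b := 0) (by norm_num)
    (u := fun y => u y - P y) (hu.sub hPi) (by
      intro θ h1 h2 h3
      have h4 := h θ h1 h2 h3
      have h5 := integral_deriv_mul_primitive (c := 0) hG h1
      have hb : ∀ y, y ∉ Ioo (-1 : ℝ) 0 → θ y = 0 := fun y hy =>
        image_eq_zero_of_notMem_tsupport fun h => hy (h3 h)
      rw [hb 0 (by simp), hb (-1) (by simp), zero_mul, zero_mul, sub_zero] at h5
      have hd : Continuous (deriv θ) := h1.continuous_deriv (by simp)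
      have i1 : IntervalIntegrable (fun y => u y * deriv θ y + G y * θ y) volume (-1) 0 :=
        (hu.mul_continuousOn hd.continuousOn).add (hG.mul_continuousOn h1.continuous.continuousOn)
      have i2 : IntervalIntegrable (fun y => deriv θ y * (0 + P y) + θ y * G y) volume (-1) 0 := by
        simp only [zero_add]
        exact (hPi.continuousOn_mul hd.continuousOn).add
          (hG.continuousOn_mul h1.continuous.continuousOn)
      have h6 := intervalIntegral.integral_sub i1 i2
      rw [h4, h5, sub_zero] at h6
      rw [← h6]
      congr 1
      ext y
      ring)
  have hc' : ∀ᵐ y, y ∈ uIoc (-1 : ℝ) 0 → u y = c + P y := by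
    have h0 : ∀ᵐ y : ℝ, y ≠ 0 := by simp [ae_iff, measure_singleton]
    filter_upwards [hc, h0] with y hy h0 hyI
    rw [uIoc_of_le (by norm_num)] at hyI
    linarith [hy ⟨hyI.1, lt_of_le_of_ne hyI.2 h0⟩]
  have hTP : T = c + P 0 := by
    by_contra hne
    set δ := |T - (c + P 0)|
    have hδ : 0 < δ := abs_pos.2 (sub_ne_zero.2 hne)
    have h1 : ∀ᶠ ε in 𝓝[>] (0 : ℝ), ε⁻¹ * ∫ y in (-ε)..0, |u y - T| < δ / 2 :=
      hT.eventually (gt_mem_nhds (by positivity))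
    obtain ⟨r, hr, hr'⟩ := Metric.continuousOn_iff.1 hPc 0 (by simp) (δ / 2) (by positivity)
    have h2 : ∀ᶠ ε in 𝓝[>] (0 : ℝ), ε < min r 1 :=
      nhdsWithin_le_nhds (gt_mem_nhds (lt_min hr one_pos))
    obtain ⟨ε, ⟨h3, h4⟩, h5⟩ := ((h1.and h2).and self_mem_nhdsWithin).exists
    have hε : (0 : ℝ) < ε := h5
    have hsub : uIcc (-ε) 0 ⊆ uIcc (-1 : ℝ) 0 := by
      rw [uIcc_of_le (by linarith), uIcc_of_le (by norm_num)]
      exact Icc_subset_Icc_left (by linarith [(lt_min_iff.1 h4).2])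
    have hi : IntervalIntegrable (fun y => |u y - T|) volume (-ε) 0 :=
      ((hu.sub intervalIntegrable_const).mono_set hsub).abs
    have h6 : ∫ _ in (-ε)..0, δ / 2 ≤ ∫ y in (-ε)..0, |u y - T| := by
      refine intervalIntegral.integral_mono_ae_restrict (by linarith) intervalIntegrable_const hi ?_
      have h0 : ∀ᵐ y : ℝ, y ≠ -ε := by simp [ae_iff, measure_singleton]
      rw [EventuallyLE, ae_restrict_iff' measurableSet_Icc]
      filter_upwards [hc', h0] with y hy hy0 hyI
      have hyI' : y ∈ Icc (-1 : ℝ) 0 := ⟨by linarith [hyI.1, (lt_min_iff.1 h4).2], hyI.2⟩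
      rw [hy (by rw [uIoc_of_le (by norm_num)]; exact
        ⟨by linarith [lt_of_le_of_ne hyI.1 hy0.symm, (lt_min_iff.1 h4).2], hyI.2⟩)]
      have h7 := hr' y hyI' (by
        rw [Real.dist_eq, sub_zero, abs_of_nonpos hyI.2]
        linarith [hyI.1, (lt_min_iff.1 h4).1])
      rw [Real.dist_eq] at h7
      have h8 : δ ≤ |c + P y - T| + |P y - P 0| := by
        have := abs_sub_abs_le_abs_sub (T - (c + P 0)) (P y - P 0)
        have h9 : |T - (c + P 0) - (P y - P 0)| = |c + P y - T| := by
          rw [← abs_neg]; congr 1; ring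
        linarith
      linarith
    rw [intervalIntegral.integral_const, smul_eq_mul] at h6
    rw [inv_mul_lt_iff₀ hε] at h3
    linarith
  rw [hTP]
  have h5 := integral_deriv_mul_primitive (c := c) hG hM
  rw [hM1, zero_mul, sub_zero] at h5
  rw [← h5]
  refine intervalIntegral.integral_congr_ae ?_
  filter_upwards [hc'] with y hy hyI
  rw [hy hyI]
  ring

end WaterWaves

end Interval

/-! ### Integration by parts in the layer with tests in product form. -/

section LayerCalculus

namespace WaterWaves

theorem isOpen_layer (α : ℝ) : IsOpen (layer α) := (isOpen_sector α).prod isOpen_Ioo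

theorem layer_subset (α : ℝ) (Wc : Set Pt) : layer α ⊆ waterDomain α Wc := subset_union_left

theorem restrict_sector_prod (α : ℝ) (s : Set ℝ) :
    (volume : Measure Pt).restrict (sector α ×ˢ s)
      = (volume.restrict (sector α)).prod (volume.restrict s) :=
  (Measure.prod_restrict _ _).symm

theorem restrict_layer (α : ℝ) : (volume : Measure Pt).restrict (layer α)
    = (volume.restrict (sector α)).prod (volume.restrict (Ioo (-1) 0)) :=
  restrict_sector_prod α _

theorem exists_bound_on_Icc {m : ℝ → ℝ} (hm : Continuous m) :
    ∃ C, ∀ y ∈ Ioo (-1 : ℝ) 0, ‖m y‖ ≤ C := by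
  obtain ⟨C, hC⟩ := isCompact_Icc.exists_bound_of_continuousOn (s := Icc (-1 : ℝ) 0)
    hm.continuousOn
  exact ⟨C, fun y hy => hC y (Ioo_subset_Icc_self hy)⟩

theorem memLp_layer_mul {α : ℝ} {χ : ℝ × ℝ → ℝ} {m : ℝ → ℝ}
    (hχ : MemLp χ 2 (volume.restrict (sector α))) (hm : Continuous m) :
    MemLp (fun p : Pt => χ p.1 * m p.2) 2 (volume.restrict (layer α)) := by
  obtain ⟨C, hC⟩ := exists_bound_on_Icc hm
  have h1 : MemLp (fun p : Pt => χ p.1) 2 (volume.restrict (layer α)) := by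
    rw [restrict_layer]
    exact hχ.comp_fst _
  refine (h1.const_mul C).mono (h1.1.mul (hm.comp continuous_snd).aestronglyMeasurable) ?_
  filter_upwards [ae_restrict_mem (isOpen_layer α).measurableSet] with p hp
  rw [norm_mul, norm_mul, mul_comm]
  gcongr
  exact (hC _ hp.2).trans (le_abs_self _)

theorem integrable_layer_mul {α : ℝ} {f : Pt → ℝ} {χ : ℝ × ℝ → ℝ} {m : ℝ → ℝ}
    (hf : MemLp f 2 (volume.restrict (layer α))) (hχ : MemLp χ 2 (volume.restrict (sector α)))
    (hm : Continuous m) : IntegrableOn (fun p : Pt => f p * (χ p.1 * m p.2)) (layer α) :=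
  hf.integrable_mul (memLp_layer_mul hχ hm)

theorem intervalIntegrable_fiber {α : ℝ} {f : Pt → ℝ} {χ : ℝ × ℝ → ℝ}
    (hf : MemLp f 2 (volume.restrict (layer α))) (hχ : MemLp χ 2 (volume.restrict (sector α))) :
    IntervalIntegrable (fun y => ∫ x in sector α, f (x, y) * χ x) volume (-1) 0 := by
  have h := integrable_layer_mul hf hχ (continuous_const (y := (1 : ℝ)))
  rw [IntegrableOn, restrict_layer] at h
  rw [intervalIntegrable_iff_integrableOn_Ioo_of_le (by norm_num)]
  simpa [IntegrableOn] using h.integral_prod_right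

theorem integral_layer_mul_eq_interval {α : ℝ} {f : Pt → ℝ} {χ : ℝ × ℝ → ℝ} {m : ℝ → ℝ}
    (hf : MemLp f 2 (volume.restrict (layer α))) (hχ : MemLp χ 2 (volume.restrict (sector α)))
    (hm : Continuous m) : ∫ p in layer α, f p * (χ p.1 * m p.2)
      = ∫ y in (-1)..0, (∫ x in sector α, f (x, y) * χ x) * m y := by
  have h := integrable_layer_mul hf hχ hm
  rw [IntegrableOn, restrict_layer] at h
  rw [restrict_layer, integral_prod_symm _ h, intervalIntegral.integral_of_le (by norm_num),
    integral_Ioc_eq_integral_Ioo]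
  simp only [← integral_mul_const, mul_assoc]

theorem integral_layer_mul_eq_sector {α : ℝ} {f : Pt → ℝ} {χ : ℝ × ℝ → ℝ} {m : ℝ → ℝ}
    (hf : MemLp f 2 (volume.restrict (layer α))) (hχ : MemLp χ 2 (volume.restrict (sector α)))
    (hm : Continuous m) : ∫ p in layer α, f p * (χ p.1 * m p.2)
      = ∫ x in sector α, χ x * ∫ y in (-1)..0, m y * f (x, y) := by
  have h := integrable_layer_mul hf hχ hm
  rw [IntegrableOn, restrict_layer] at h
  rw [restrict_layer, integral_prod _ h]
  congr 1
  ext x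
  rw [intervalIntegral.integral_of_le (by norm_num), integral_Ioc_eq_integral_Ioo,
    ← integral_const_mul]
  congr 1
  ext y
  ring

theorem ae_memLp_fiber {α : ℝ} {f : Pt → ℝ} (hf : MemLp f 2 (volume.restrict (layer α))) :
    ∀ᵐ x ∂volume.restrict (sector α),
      MemLp (fun y => f (x, y)) 2 (volume.restrict (Ioo (-1) 0)) := by
  have h1 := hf.integrable_sq
  have h2 := hf.1
  rw [restrict_layer] at h1 h2
  filter_upwards [h1.prod_right_ae, h2.prodMk_left] with x h3 h4
  exact (memLp_two_iff_integrable_sq h4).2 h3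

theorem memLp_restrict_Ioo {m : ℝ → ℝ} (hm : Continuous m) :
    MemLp m 2 (volume.restrict (Ioo (-1) 0)) := by
  obtain ⟨C, hC⟩ := exists_bound_on_Icc hm
  refine MemLp.of_bound hm.aestronglyMeasurable C ?_
  filter_upwards [ae_restrict_mem measurableSet_Ioo] with y hy using hC y hy

theorem ae_sq_integral_fiber_le {α : ℝ} {f : Pt → ℝ} {m : ℝ → ℝ}
    (hf : MemLp f 2 (volume.restrict (layer α))) (hm : Continuous m) :
    ∀ᵐ x ∂volume.restrict (sector α), (∫ y in (-1)..0, m y * f (x, y)) ^ 2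
      ≤ (∫ y in (-1)..0, m y ^ 2) * ∫ y in Ioo (-1) 0, f (x, y) ^ 2 := by
  filter_upwards [ae_memLp_fiber hf] with x hx
  rw [intervalIntegral.integral_of_le (by norm_num), integral_Ioc_eq_integral_Ioo,
    intervalIntegral.integral_of_le (by norm_num), integral_Ioc_eq_integral_Ioo]
  exact sq_integral_mul_le' (memLp_restrict_Ioo hm) hx

theorem memLp_integral_fiber {α : ℝ} {f : Pt → ℝ} {m : ℝ → ℝ}
    (hf : MemLp f 2 (volume.restrict (layer α))) (hm : Continuous m) :
    MemLp (fun x => ∫ y in (-1)..0, m y * f (x, y)) 2 (volume.restrict (sector α)) := by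
  have h1 := hf.integrable_sq
  have h2 := (hm.comp continuous_snd).aestronglyMeasurable.mul hf.1
  rw [restrict_layer] at h1 h2
  have h3 : AEStronglyMeasurable (fun x => ∫ y in (-1)..0, m y * f (x, y))
      (volume.restrict (sector α)) := by
    simp only [intervalIntegral.integral_of_le (show (-1 : ℝ) ≤ 0 by norm_num),
      integral_Ioc_eq_integral_Ioo]
    exact h2.integral_prod_right'
  rw [memLp_two_iff_integrable_sq h3]
  refine (h1.integral_prod_left.const_mul (∫ y in (-1)..0, m y ^ 2)).mono' (h3.pow 2) ?_
  filter_upwards [ae_sq_integral_fiber_le hf hm] with x hx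
  rw [Real.norm_of_nonneg (sq_nonneg _)]
  exact hx

theorem fderiv_mul_fst_snd {χ : ℝ × ℝ → ℝ} {θ : ℝ → ℝ} (hχ : Differentiable ℝ χ)
    (hθ : Differentiable ℝ θ) (p v : Pt) :
    fderiv ℝ (fun p : Pt => χ p.1 * θ p.2) p v
      = fderiv ℝ χ p.1 v.1 * θ p.2 + χ p.1 * (deriv θ p.2 * v.2) := by
  have h1 : HasFDerivAt (fun p : Pt => χ p.1)
      ((fderiv ℝ χ p.1).comp (ContinuousLinearMap.fst ℝ (ℝ × ℝ) ℝ)) p :=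
    (hχ p.1).hasFDerivAt.comp p hasFDerivAt_fst
  have h2 : HasFDerivAt (fun p : Pt => θ p.2)
      ((fderiv ℝ θ p.2).comp (ContinuousLinearMap.snd ℝ (ℝ × ℝ) ℝ)) p :=
    (hθ p.2).hasFDerivAt.comp p hasFDerivAt_snd
  have h4 := (h1.mul h2).fderiv
  change fderiv ℝ (fun p : Pt => χ p.1 * θ p.2) p = _ at h4
  rw [h4]
  have h3 : fderiv ℝ θ p.2 v.2 = deriv θ p.2 * v.2 := by
    have := (fderiv ℝ θ p.2).map_smul v.2 (1 : ℝ)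
    simp only [smul_eq_mul, mul_one] at this
    rw [← fderiv_apply_one_eq_deriv, this, mul_comm]
  simp [h3]
  ring

theorem tsupport_mul_fst_snd_subset {χ : ℝ × ℝ → ℝ} {θ : ℝ → ℝ} :
    tsupport (fun p : Pt => χ p.1 * θ p.2) ⊆ tsupport χ ×ˢ tsupport θ := by
  refine closure_minimal (fun p hp => ?_)
    ((isClosed_tsupport _).prod (isClosed_tsupport _))
  have hp' : χ p.1 * θ p.2 ≠ 0 := hp
  exact ⟨subset_tsupport _ (left_ne_zero_of_mul hp'), subset_tsupport _ (right_ne_zero_of_mul hp')⟩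

theorem memLp_sector_of_hasCompactSupport {α : ℝ} {χ : ℝ × ℝ → ℝ} (hχ : Continuous χ)
    (hχc : HasCompactSupport χ) : MemLp χ 2 (volume.restrict (sector α)) :=
  (memLp_of_hasCompactSupport hχ hχc).restrict _

variable {α : ℝ} {W : Set Pt} {u : Pt → ℝ} {g : Fin 3 → Pt → ℝ}

theorem HasWeakGradient.memLp_layer (hu : HasWeakGradient W u g) (hW : layer α ⊆ W) :
    MemLp u 2 (volume.restrict (layer α)) :=
  hu.memLp.mono_measure (Measure.restrict_mono hW le_rfl)

theorem HasWeakGradient.memLp_grad_layer (hu : HasWeakGradient W u g) (hW : layer α ⊆ W)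
    (i : Fin 3) : MemLp (g i) 2 (volume.restrict (layer α)) :=
  (hu.memLp_grad i).mono_measure (Measure.restrict_mono hW le_rfl)

/-- Tests in product form: with `χ` fixed, Fubini's theorem turns this into a one-dimensional weak
identity for the fibre integrals against `χ`. -/
theorem HasWeakGradient.weak_layer (hu : HasWeakGradient W u g) (hW : layer α ⊆ W)
    (hWo : IsOpen W) {χ : ℝ × ℝ → ℝ} {θ : ℝ → ℝ} (hχ : ContDiff ℝ ∞ χ)
    (hχc : HasCompactSupport χ) (hχs : tsupport χ ⊆ sector α) (hθ : ContDiff ℝ ∞ θ)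
    (hθc : HasCompactSupport θ) (hθs : tsupport θ ⊆ Ioo (-1) 0) (i : Fin 3) :
    (∫ p in layer α, u p * (fderiv ℝ χ p.1 (axis i).1 * θ p.2))
      + (∫ p in layer α, u p * (χ p.1 * (deriv θ p.2 * (axis i).2)))
      + ∫ p in layer α, g i p * (χ p.1 * θ p.2) = 0 := by
  have hd := fderiv_mul_fst_snd (hχ.differentiable (by simp)) (hθ.differentiable (by simp))
  have hsub := (tsupport_mul_fst_snd_subset (χ := χ) (θ := θ))
  have hsubL : tsupport (fun p : Pt => χ p.1 * θ p.2) ⊆ layer α :=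
    hsub.trans (prod_mono hχs hθs)
  have h1 := hu.weak i (fun p => χ p.1 * θ p.2)
    ((hχ.comp contDiff_fst).mul (hθ.comp contDiff_snd))
    ((hχc.isCompact.prod hθc.isCompact).of_isClosed_subset (isClosed_tsupport _) hsub)
    (hsubL.trans hW)
  rw [setIntegral_eq_of_subset_of_forall_sdiff_eq_zero hWo.measurableSet hW,
    setIntegral_eq_of_subset_of_forall_sdiff_eq_zero (s := layer α) hWo.measurableSet hW] at h1
  · simp only [hd] at h1
    have hχ' := memLp_sector_of_hasCompactSupport (α := α) hχ.continuous hχc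
    have i1 := integrable_layer_mul (hu.memLp_layer hW)
      (memLp_sector_of_hasCompactSupport (α := α) (contDiff_fderiv_apply hχ (axis i).1).continuous
        (hasCompactSupport_fderiv_apply hχc _)) hθ.continuous
    have i2 := integrable_layer_mul (hu.memLp_layer hW) hχ' (m := fun y => deriv θ y * (axis i).2)
      ((hθ.continuous_deriv (by simp)).mul continuous_const)
    have h2 := integral_add i1 i2
    simp only [← mul_add] at h2
    rw [← h2, h1]
    simp
  · intro p hp
    rw [image_eq_zero_of_notMem_tsupport (f := fun p : Pt => χ p.1 * θ p.2)
      fun h => hp.2 (hsubL h), mul_zero]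
  · intro p hp
    have : fderiv ℝ (fun p : Pt => χ p.1 * θ p.2) p = 0 :=
      image_eq_zero_of_notMem_tsupport fun h => hp.2 (hsubL (tsupport_fderiv_subset ℝ h))
    rw [this]
    simp

/-- Horizontal integration by parts in the layer. -/
theorem HasWeakGradient.integral_layer_horizontal (hu : HasWeakGradient W u g)
    (hW : layer α ⊆ W) (hWo : IsOpen W) {χ : ℝ × ℝ → ℝ} (hχ : ContDiff ℝ ∞ χ)
    (hχc : HasCompactSupport χ) (hχs : tsupport χ ⊆ sector α) {m : ℝ → ℝ} (hm : Continuous m)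
    {i : Fin 3} (hi : (axis i).2 = 0) :
    (∫ p in layer α, u p * (fderiv ℝ χ p.1 (axis i).1 * m p.2))
      + ∫ p in layer α, g i p * (χ p.1 * m p.2) = 0 := by
  have hχ' := memLp_sector_of_hasCompactSupport (α := α) hχ.continuous hχc
  have hχd := memLp_sector_of_hasCompactSupport (α := α)
    (contDiff_fderiv_apply hχ (axis i).1).continuous (hasCompactSupport_fderiv_apply hχc _)
  have i1 := intervalIntegrable_fiber (hu.memLp_layer hW) hχd
  have i2 := intervalIntegrable_fiber (hu.memLp_grad_layer hW i) hχ'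
  set a := fun y => ∫ x in sector α, u (x, y) * fderiv ℝ χ x (axis i).1
  set b := fun y => ∫ x in sector α, g i (x, y) * χ x
  -- A horizontal derivative does not act on the vertical factor, so the identity holds at almost
  -- every depth, and the vertical factor need no longer vanish at the ends.
  have hz : ∀ᵐ y, y ∈ Ioo (-1 : ℝ) 0 → a y + b y = 0 := by
    refine isOpen_Ioo.ae_eq_zero_of_integral_contDiff_smul_eq_zero ?_ ?_
    · refine IntegrableOn.locallyIntegrableOn ?_
      have := i1.add i2
      rwa [intervalIntegrable_iff_integrableOn_Ioo_of_le (by norm_num)] at this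
    intro θ hθ hθc hθs
    have h := hu.weak_layer hW hWo hχ hχc hχs hθ hθc hθs i
    rw [integral_layer_mul_eq_interval (hu.memLp_layer hW) hχd hθ.continuous,
      integral_layer_mul_eq_interval (hu.memLp_grad_layer hW i) hχ' hθ.continuous] at h
    simp only [hi, mul_zero, integral_zero, add_zero] at h
    rw [← intervalIntegral.integral_add (i1.mul_continuousOn hθ.continuous.continuousOn)
      (i2.mul_continuousOn hθ.continuous.continuousOn), intervalIntegral.integral_of_le
      (by norm_num), setIntegral_eq_integral_of_forall_compl_eq_zero] at h
    · rw [← h]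
      congr 1
      ext y
      simp only [smul_eq_mul, a, b]
      ring
    · intro y hy
      rw [image_eq_zero_of_notMem_tsupport fun h => hy (Ioo_subset_Ioc_self (hθs h))]
      simp
  rw [integral_layer_mul_eq_interval (hu.memLp_layer hW) hχd hm,
    integral_layer_mul_eq_interval (hu.memLp_grad_layer hW i) hχ' hm,
    ← intervalIntegral.integral_add (i1.mul_continuousOn hm.continuousOn)
      (i2.mul_continuousOn hm.continuousOn)]
  have h0 : ∀ᵐ y : ℝ, y ≠ 0 := by simp [ae_iff, measure_singleton]
  rw [intervalIntegral.integral_congr_ae (g := fun _ => 0)]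
  · simp
  filter_upwards [hz, h0] with y hy h0 hyI
  rw [uIoc_of_le (by norm_num)] at hyI
  rw [← add_mul]
  exact mul_eq_zero_of_left (hy ⟨hyI.1, lt_of_le_of_ne hyI.2 h0⟩) _

/-- By the Cauchy–Schwarz inequality on the slab of thickness `ε`: the square of the mean carries
`ε⁻²`, one factor of which is absorbed by the norm of `χ` on the slab, equal to `ε ∫ χ²` when
squared. What remains is the quantity in the definition of the trace. -/
theorem HasTrace.tendsto_integral_abs {t : ℝ × ℝ → ℝ} (ht : HasTrace α u t)
    (hu : MemLp u 2 (volume.restrict (layer α))) {χ : ℝ × ℝ → ℝ}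
    (hχ : MemLp χ 2 (volume.restrict (sector α))) :
    Tendsto (fun ε : ℝ => ε⁻¹ * ∫ y in (-ε)..0,
      |(∫ x in sector α, u (x, y) * χ x) - ∫ x in sector α, t x * χ x|) (𝓝[>] 0) (𝓝 0) := by
  have hC := ht.tendsto.mul_const (∫ x in sector α, χ x ^ 2)
  rw [zero_mul] at hC
  have hsq : Tendsto (fun ε : ℝ => (ε⁻¹ * ∫ y in (-ε)..0,
      |(∫ x in sector α, u (x, y) * χ x) - ∫ x in sector α, t x * χ x|) ^ 2) (𝓝[>] 0) (𝓝 0) := by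
    refine squeeze_zero' (.of_forall fun ε => sq_nonneg _) ?_ hC
    filter_upwards [Ioo_mem_nhdsGT (zero_lt_one' ℝ)] with ε hε
    have hε0 : 0 < ε := hε.1
    have hsub : sector α ×ˢ Ioo (-ε) 0 ⊆ layer α :=
      prod_mono le_rfl (Ioo_subset_Ioo_left (by linarith [hε.2]))
    set ν := (volume : Measure ℝ).restrict (Ioo (-ε) 0)
    set μ := (volume : Measure (ℝ × ℝ)).restrict (sector α)
    have huε : MemLp u 2 (μ.prod ν) := by
      rw [← restrict_sector_prod]; exact hu.mono_measure (Measure.restrict_mono hsub le_rfl)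
    have hdiff : MemLp (fun p : Pt => u p - t p.1) 2 (μ.prod ν) := huε.sub (ht.memLp.comp_fst ν)
    have hχε : MemLp (fun p : Pt => χ p.1) 2 (μ.prod ν) := hχ.comp_fst ν
    have hw : Integrable (fun p : Pt => (u p - t p.1) * χ p.1) (μ.prod ν) :=
      hdiff.integrable_mul hχε
    have huχ : Integrable (fun p : Pt => u p * χ p.1) (μ.prod ν) := huε.integrable_mul hχε
    have htχ : Integrable (fun x => t x * χ x) μ := ht.memLp.integrable_mul hχ
    have h1 : ∫ y in (-ε)..0, |(∫ x in sector α, u (x, y) * χ x) - ∫ x in sector α, t x * χ x|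
        ≤ ∫ p, |u p - t p.1| * |χ p.1| ∂(μ.prod ν) := by
      rw [intervalIntegral.integral_of_le (by linarith), integral_Ioc_eq_integral_Ioo]
      have hw' : Integrable (fun p : Pt => |u p - t p.1| * |χ p.1|) (μ.prod ν) := by
        simpa only [abs_mul] using hw.abs
      rw [integral_prod_symm _ hw']
      refine integral_mono_ae ?_ hw'.integral_prod_right ?_
      · exact (huχ.integral_prod_right.sub (integrable_const _)).abs
      · filter_upwards [huχ.prod_left_ae] with y hy
        change |(∫ x, u (x, y) * χ x ∂μ) - ∫ x, t x * χ x ∂μ| ≤ ∫ x, |u (x, y) - t x| * |χ x| ∂μ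
        rw [← integral_sub hy htχ]
        refine abs_integral_le_integral_abs.trans (le_of_eq ?_)
        congr 1
        ext x
        rw [← abs_mul, sub_mul]
    have h2 := sq_integral_mul_le' (f := fun p : Pt => |u p - t p.1|)
      (g := fun p : Pt => |χ p.1|) hdiff.abs hχε.abs
    simp only [sq_abs] at h2
    have h3 : ∫ p : Pt, χ p.1 ^ 2 ∂(μ.prod ν) = ε * ∫ x in sector α, χ x ^ 2 := by
      have := integral_prod_mul (μ := μ) (ν := ν) (fun x => χ x ^ 2) (fun _ => (1 : ℝ))
      simp only [mul_one] at this
      rw [this]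
      simp [ν, μ, Measure.real, hε0.le, mul_comm]
    rw [h3] at h2
    have h0 : 0 ≤ ∫ y in (-ε)..0,
        |(∫ x in sector α, u (x, y) * χ x) - ∫ x in sector α, t x * χ x| :=
      intervalIntegral.integral_nonneg (by linarith) fun y _ => abs_nonneg _
    have h4 := (pow_le_pow_left₀ h0 h1 2).trans h2
    rw [restrict_sector_prod, mul_pow]
    calc _ ≤ ε⁻¹ ^ 2 * ((∫ p, (u p - t p.1) ^ 2 ∂(μ.prod ν)) * (ε * ∫ x in sector α, χ x ^ 2)) := by
          gcongr
      _ = _ := by field_simp; rfl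
  have := hsq.sqrt
  rw [Real.sqrt_zero] at this
  refine (tendsto_zero_iff_abs_tendsto_zero _).2 (this.congr fun ε => ?_)
  exact Real.sqrt_sq_eq_abs _

theorem axis_two_snd : (axis 2).2 = 1 := rfl
theorem axis_two_fst : (axis 2).1 = 0 := rfl

/-- Green's formula in the vertical direction, tested in the layer. -/
theorem HasWeakGradient.integral_layer_vertical (hu : HasWeakGradient W u g)
    (hW : layer α ⊆ W) (hWo : IsOpen W) {t : ℝ × ℝ → ℝ} (ht : HasTrace α u t)
    {χ : ℝ × ℝ → ℝ} (hχ : ContDiff ℝ ∞ χ) (hχc : HasCompactSupport χ)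
    (hχs : tsupport χ ⊆ sector α) {M : ℝ → ℝ} (hM : ContDiff ℝ ∞ M) (hM1 : M (-1) = 0) :
    (∫ p in layer α, g 2 p * (χ p.1 * M p.2)) + ∫ p in layer α, u p * (χ p.1 * deriv M p.2)
      = M 0 * ∫ x in sector α, t x * χ x := by
  have hχ' := memLp_sector_of_hasCompactSupport (α := α) hχ.continuous hχc
  have hul := hu.memLp_layer hW
  have hgl := hu.memLp_grad_layer hW 2
  have i1 := intervalIntegrable_fiber hul hχ'
  have i2 := intervalIntegrable_fiber hgl hχ'
  have key := integral_mul_deriv_of_weak i1 i2 (M := M)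
    (T := ∫ x in sector α, t x * χ x) (fun θ hθ hθc hθs => by
      have h := hu.weak_layer hW hWo hχ hχc hχs hθ hθc hθs 2
      have hd := hθ.continuous_deriv (by simp)
      simp only [axis_two_fst, axis_two_snd, map_zero, zero_mul, mul_zero, integral_zero, mul_one,
        zero_add] at h
      rwa [integral_layer_mul_eq_interval hul hχ' hd,
        integral_layer_mul_eq_interval hgl hχ' hθ.continuous,
        ← intervalIntegral.integral_add (i1.mul_continuousOn hd.continuousOn)
        (i2.mul_continuousOn hθ.continuous.continuousOn)] at h)
    (ht.tendsto_integral_abs hul hχ') hM hM1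
  have hd := hM.continuous_deriv (by simp)
  rw [← key, integral_layer_mul_eq_interval hul hχ' hd,
    integral_layer_mul_eq_interval hgl hχ' hM.continuous,
    ← intervalIntegral.integral_add (i2.mul_continuousOn hM.continuous.continuousOn)
        (i1.mul_continuousOn hd.continuousOn)]
  congr 1
  ext y
  ring

/-- Green's formula in the vertical direction, on almost every vertical line in the layer. -/
theorem HasWeakGradient.ae_vertical (hu : HasWeakGradient W u g)
    (hW : layer α ⊆ W) (hWo : IsOpen W) {t : ℝ × ℝ → ℝ} (ht : HasTrace α u t)
    {M : ℝ → ℝ} (hM : ContDiff ℝ ∞ M) (hM1 : M (-1) = 0) :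
    ∀ᵐ x ∂volume.restrict (sector α), M 0 * t x
      = (∫ y in (-1)..0, M y * g 2 (x, y)) + ∫ y in (-1)..0, deriv M y * u (x, y) := by
  have hul := hu.memLp_layer hW
  have hgl := hu.memLp_grad_layer hW 2
  have hd := hM.continuous_deriv (by simp)
  have m1 := memLp_integral_fiber hgl hM.continuous
  have m2 := memLp_integral_fiber hul hd
  have m3 := ((m1.add m2).sub (ht.memLp.const_mul (M 0)))
  rw [ae_restrict_iff' (isOpen_sector α).measurableSet]
  have := (isOpen_sector α).ae_eq_zero_of_integral_contDiff_smul_eq_zero (μ := volume)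
    (locallyIntegrableOn_of_locallyIntegrable_restrict (m3.locallyIntegrable (by norm_num))) ?_
  · filter_upwards [this] with x hx hxF
    have := hx hxF
    simp only [Pi.sub_apply, Pi.add_apply] at this
    linarith
  intro χ hχ hχc hχs
  have hχ' := memLp_sector_of_hasCompactSupport (α := α) hχ.continuous hχc
  have h := hu.integral_layer_vertical hW hWo ht hχ hχc hχs hM hM1
  rw [integral_layer_mul_eq_sector hul hχ' hd,
    integral_layer_mul_eq_sector hgl hχ' hM.continuous] at h
  rw [← setIntegral_eq_integral_of_forall_compl_eq_zero (s := sector α) (fun x hx => by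
    rw [image_eq_zero_of_notMem_tsupport fun h => hx (hχs h), zero_smul])]
  have j1 : Integrable (fun x => χ x * ∫ y in (-1)..0, M y * g 2 (x, y))
      (volume.restrict (sector α)) := hχ'.integrable_mul m1
  have j2 : Integrable (fun x => χ x * ∫ y in (-1)..0, deriv M y * u (x, y))
      (volume.restrict (sector α)) := hχ'.integrable_mul m2
  have j3 : Integrable (fun x => M 0 * (t x * χ x)) (volume.restrict (sector α)) :=
    (ht.memLp.integrable_mul hχ').const_mul (M 0)
  have j12 : Integrable (fun x => (χ x * ∫ y in (-1)..0, M y * g 2 (x, y))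
      + χ x * ∫ y in (-1)..0, deriv M y * u (x, y)) (volume.restrict (sector α)) := j1.add j2
  have e := integral_sub j12 j3
  rw [integral_add j1 j2, integral_const_mul] at e
  rw [h, sub_self] at e
  refine Eq.trans ?_ e
  congr 1
  ext x
  simp only [Pi.sub_apply, Pi.add_apply, smul_eq_mul]
  ring

end WaterWaves

end LayerCalculus

/-! ### Test functions extended from the layer by zero, and their traces. -/

section LayerTest

namespace WaterWaves

/-- By `hs` the support of `w` does not meet the boundary of `Ω`, so the extension of `w` by zero
from `Ω` remains differentiable and the boundary need not be regular. -/
theorem setIntegral_fderiv_eq_zero {X : Type*} [NormedAddCommGroup X] [NormedSpace ℝ X]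
    [FiniteDimensional ℝ X] [MeasurableSpace X] [BorelSpace X] {μ : Measure X}
    [μ.IsAddHaarMeasure] {Ω : Set X} (hΩ : IsOpen Ω) {w : X → ℝ} (hw : ContDiff ℝ ∞ w)
    (hc : HasCompactSupport w) (hs : tsupport w ∩ closure Ω ⊆ Ω) (v : X) :
    ∫ x in Ω, fderiv ℝ w x v ∂μ = 0 := by
  have hd : ∀ x, HasFDerivAt (Ω.indicator w) (Ω.indicator (fderiv ℝ w) x) x := by
    intro x
    by_cases hx : x ∈ Ω
    · rw [indicator_of_mem hx]
      refine (hw.differentiable (by simp) x).hasFDerivAt.congr_of_eventuallyEq ?_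
      filter_upwards [hΩ.mem_nhds hx] with y hy using indicator_of_mem hy _
    · rw [indicator_of_notMem hx]
      refine (hasFDerivAt_const (0 : ℝ) x).congr_of_eventuallyEq ?_
      by_cases hxt : x ∈ tsupport w
      · have hxc : x ∈ (closure Ω)ᶜ := fun h => hx (hs ⟨hxt, h⟩)
        filter_upwards [isClosed_closure.isOpen_compl.mem_nhds hxc] with y hy
        exact indicator_of_notMem (fun h => hy (subset_closure h)) _
      · filter_upwards [(isClosed_tsupport w).isOpen_compl.mem_nhds hxt] with y hy
        rw [indicator_apply_eq_zero]
        exact fun _ => image_eq_zero_of_notMem_tsupport hy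
  have e : ∀ x, fderiv ℝ (Ω.indicator w) x v = Ω.indicator (fun x => fderiv ℝ w x v) x := by
    intro x
    rw [(hd x).fderiv]
    by_cases hx : x ∈ Ω <;> simp [hx]
  have i1 : Integrable (Ω.indicator w) μ :=
    (hw.continuous.integrable_of_hasCompactSupport hc).indicator hΩ.measurableSet
  have i2 : Integrable (Ω.indicator fun x => fderiv ℝ w x v) μ :=
    ((contDiff_fderiv_apply hw v).continuous.integrable_of_hasCompactSupport
      (hasCompactSupport_fderiv_apply hc v)).indicator hΩ.measurableSet
  have := integral_mul_fderiv_eq_neg_fderiv_mul_of_integrable (μ := μ) (v := v)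
    (f := fun _ => (1 : ℝ)) (g := Ω.indicator w) (by simp) (by simpa [e] using i2) (by simpa using i1)
    (fun x _ => differentiableAt_const _) (fun x _ => (hd x).differentiableAt)
  simp only [e, one_mul, fderiv_fun_const, Pi.zero_apply, zero_apply, zero_mul, integral_zero,
    neg_zero] at this
  rwa [integral_indicator hΩ.measurableSet] at this

instance isAddHaarMeasure_volume_pt : (volume : Measure Pt).IsAddHaarMeasure :=
  inferInstanceAs ((volume : Measure (ℝ × ℝ)).prod (volume : Measure ℝ)).IsAddHaarMeasure

variable {α : ℝ} {Wc : Set Pt}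

/-- This is where the geometry of the cliff enters. A point of the closed layer has height at least
`-1`, so over the sector it cannot belong to `Wc`: the water touches the layer there only in the
layer itself, and the bottom is rigid. Hence extension by zero creates no jump inside `W`. -/
theorem IsCliffRegion.mem_layer_of_mem_closure (hWc : IsCliffRegion α Wc) {p : Pt}
    (hp : p ∈ waterDomain α Wc) (hpc : p ∈ closure (layer α)) (hpF : p.1 ∈ sector α) :
    p ∈ layer α := by
  rcases hp with h | h
  · exact h
  · have h2 : p ∈ {p : Pt | -1 ≤ p.2} :=
      closure_minimal (fun q (hq : q ∈ layer α) => hq.2.1.le)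
        (isClosed_le continuous_const continuous_snd) hpc
    exact absurd hpF (hWc.confined p h h2)

theorem memLp_indicator_layer {f : Pt → ℝ} (hf : MemLp f 2 (volume.restrict (layer α)))
    (W : Set Pt) : MemLp ((layer α).indicator f) 2 (volume.restrict W) :=
  ((memLp_indicator_iff_restrict (isOpen_layer α).measurableSet).2 hf).restrict W

theorem setIntegral_indicator_mul {W : Set Pt} (hW : layer α ⊆ W) (f h : Pt → ℝ) :
    ∫ p in W, (layer α).indicator f p * h p = ∫ p in layer α, f p * h p := by
  have : ∀ p, (layer α).indicator f p * h p = (layer α).indicator (fun p => f p * h p) p := by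
    intro p
    by_cases hp : p ∈ layer α <;> simp [hp]
  simp only [this]
  rw [setIntegral_indicator (isOpen_layer α).measurableSet, inter_eq_self_of_subset_right hW]

/-- Products of a function of the horizontal variables, compactly supported in the sector, and of a
function of the vertical variable, extended from the layer by zero, belong to `H¹`. -/
theorem IsCliffRegion.hasWeakGradient_indicator (hWc : IsCliffRegion α Wc) {χ : ℝ × ℝ → ℝ}
    (hχ : ContDiff ℝ ∞ χ) (hχc : HasCompactSupport χ) (hχs : tsupport χ ⊆ sector α) {m : ℝ → ℝ}
    (hm : ContDiff ℝ ∞ m) :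
    HasWeakGradient (waterDomain α Wc) ((layer α).indicator fun p => χ p.1 * m p.2)
      (fun i => (layer α).indicator fun p =>
        fderiv ℝ χ p.1 (axis i).1 * m p.2 + χ p.1 * (deriv m p.2 * (axis i).2)) where
  memLp := memLp_indicator_layer (memLp_layer_mul
    (memLp_sector_of_hasCompactSupport hχ.continuous hχc) hm.continuous) _
  memLp_grad i := memLp_indicator_layer ((memLp_layer_mul (memLp_sector_of_hasCompactSupport
      (contDiff_fderiv_apply hχ (axis i).1).continuous (hasCompactSupport_fderiv_apply hχc _))
    hm.continuous).add (memLp_layer_mul (memLp_sector_of_hasCompactSupport hχ.continuous hχc)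
      (m := fun y => deriv m y * (axis i).2)
      ((hm.continuous_deriv (by simp)).mul continuous_const))) _
  weak i η hη hηc hηs := by
    have hW := layer_subset α Wc
    rw [setIntegral_indicator_mul hW, setIntegral_indicator_mul hW]
    set f : Pt → ℝ := fun p => χ p.1 * m p.2
    have hf : ContDiff ℝ ∞ f := (hχ.comp contDiff_fst).mul (hm.comp contDiff_snd)
    have hfs : ∀ p ∈ tsupport f, p.1 ∈ sector α := fun p hp =>
      hχs (tsupport_mul_fst_snd_subset hp).1
    have h1 := setIntegral_fderiv_eq_zero (μ := volume) (isOpen_layer α) (hf.mul hη) hηc.mul_left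
      (fun p hp => hWc.mem_layer_of_mem_closure (hηs (tsupport_mul_subset_right hp.1)) hp.2
        (hfs p (tsupport_mul_subset_left hp.1))) (axis i)
    have e : ∀ p, fderiv ℝ (f * η) p (axis i) = f p * fderiv ℝ η p (axis i)
        + (fderiv ℝ χ p.1 (axis i).1 * m p.2 + χ p.1 * (deriv m p.2 * (axis i).2)) * η p := by
      intro p
      rw [fderiv_mul (hf.differentiable (by simp) p) (hη.differentiable (by simp) p),
        ← fderiv_mul_fst_snd (hχ.differentiable (by simp)) (hm.differentiable (by simp))]
      simp [f, mul_comm]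
    change ∫ p in layer α, fderiv ℝ (f * η) p (axis i) = 0 at h1
    simp only [e] at h1
    rw [integral_add] at h1
    · linarith
    · refine (Continuous.integrable_of_hasCompactSupport ?_ ?_).integrableOn
      · exact hf.continuous.mul (contDiff_fderiv_apply hη _).continuous
      · exact (hasCompactSupport_fderiv_apply hηc _).mul_left
    · refine (Continuous.integrable_of_hasCompactSupport ?_ hηc.mul_left).integrableOn
      have h1 := (contDiff_fderiv_apply hχ (axis i).1).continuous
      have h2 := hm.continuous_deriv (by simp)
      have h3 := hχ.continuous
      have h4 := hm.continuous
      have h5 := hη.continuous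
      fun_prop

/-- A vertical Lipschitz bound with square integrable constant `κ` makes the mean-square defect at
most `ε² ∫ κ²`. -/
theorem hasTrace_of_abs_sub_le {u : Pt → ℝ} {t κ : ℝ × ℝ → ℝ}
    (ht : MemLp t 2 (volume.restrict (sector α))) (hκ : MemLp κ 2 (volume.restrict (sector α)))
    (h : ∀ p ∈ layer α, |u p - t p.1| ≤ κ p.1 * |p.2|) : HasTrace α u t where
  memLp := ht
  tendsto := by
    have hlim : Tendsto (fun ε : ℝ => (∫ x in sector α, κ x ^ 2) * ε ^ 2) (𝓝[>] 0) (𝓝 0) := by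
      have : Continuous fun ε : ℝ => (∫ x in sector α, κ x ^ 2) * ε ^ 2 := by fun_prop
      exact tendsto_nhdsWithin_of_tendsto_nhds (by simpa using this.tendsto 0)
    refine squeeze_zero' ?_ ?_ hlim
    · filter_upwards [self_mem_nhdsWithin] with ε hε
      exact mul_nonneg (inv_nonneg.2 (le_of_lt hε)) (integral_nonneg fun p => sq_nonneg _)
    filter_upwards [Ioo_mem_nhdsGT (zero_lt_one' ℝ)] with ε hε
    have hε0 : 0 < ε := hε.1
    have h1 : ∫ p in sector α ×ˢ Ioo (-ε) 0, (u p - t p.1) ^ 2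
        ≤ ∫ p : Pt in sector α ×ˢ Ioo (-ε) 0, κ p.1 ^ 2 * ε ^ 2 := by
      refine integral_mono_of_nonneg (.of_forall fun p => sq_nonneg _) ?_ ?_
      · rw [restrict_sector_prod]
        exact (hκ.comp_fst _).integrable_sq.mul_const _
      · filter_upwards [ae_restrict_mem ((isOpen_sector α).prod isOpen_Ioo).measurableSet] with p hp
        have hp1 : -ε < p.2 := hp.2.1
        have hp2 : p.2 < 0 := hp.2.2
        have h2 := h p ⟨hp.1, by linarith [hε.2], hp2⟩
        rw [← sq_abs]
        refine (pow_le_pow_left₀ (abs_nonneg _) h2 2).trans ?_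
        rw [mul_pow]
        refine mul_le_mul_of_nonneg_left (pow_le_pow_left₀ (abs_nonneg _) ?_ 2) (sq_nonneg _)
        rw [abs_of_neg hp2]
        linarith
    have h3 : ∫ p : Pt in sector α ×ˢ Ioo (-ε) 0, κ p.1 ^ 2 * ε ^ 2
        = ε * ((∫ x in sector α, κ x ^ 2) * ε ^ 2) := by
      rw [integral_mul_const, restrict_sector_prod]
      have := integral_prod_mul (μ := (volume : Measure (ℝ × ℝ)).restrict (sector α))
        (ν := (volume : Measure ℝ).restrict (Ioo (-ε) 0)) (fun x => κ x ^ 2) (fun _ => (1 : ℝ))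
      simp only [mul_one] at this
      rw [this]
      simp [Measure.real, hε0.le]
      ring
    rw [h3] at h1
    calc _ ≤ ε⁻¹ * (ε * ((∫ x in sector α, κ x ^ 2) * ε ^ 2)) := by gcongr
      _ = _ := by field_simp

theorem hasTrace_indicator {χ : ℝ × ℝ → ℝ} (hχ : Continuous χ) (hχc : HasCompactSupport χ)
    {m : ℝ → ℝ} (hm : ContDiff ℝ ∞ m) :
    HasTrace α ((layer α).indicator fun p => χ p.1 * m p.2) (fun x => χ x * m 0) := by
  obtain ⟨C, hC⟩ := isCompact_Icc.exists_bound_of_continuousOn (s := Icc (-1 : ℝ) 0)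
    (hm.continuous_deriv (by simp)).continuousOn
  have hL := memLp_sector_of_hasCompactSupport (α := α) hχ hχc
  refine hasTrace_of_abs_sub_le (hL.mul_const _) (κ := fun x => |χ x| * C) (hL.abs.mul_const C)
    fun p hp => ?_
  rw [indicator_of_mem hp, ← mul_sub, abs_mul, mul_assoc]
  refine mul_le_mul_of_nonneg_left ?_ (abs_nonneg _)
  have := (convex_Icc (-1 : ℝ) 0).norm_image_sub_le_of_norm_deriv_le
    (fun z _ => hm.differentiable (by simp) z) hC (right_mem_Icc.2 (by norm_num))
    (Ioo_subset_Icc_self hp.2)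
  simpa using this

end WaterWaves

end LayerTest

/-! ### Functions with vanishing weak gradient. -/

section LocalConstancy

namespace WaterWaves

variable {W : Set Pt} {u : Pt → ℝ} {g : Fin 3 → Pt → ℝ}

theorem memLp_indicator {f : Pt → ℝ} (hW : IsOpen W) (hf : MemLp f 2 (volume.restrict W)) :
    MemLp (W.indicator f) 2 volume :=
  (memLp_indicator_iff_restrict hW.measurableSet).2 hf

theorem integral_indicator_mul (hW : IsOpen W) (f h : Pt → ℝ) :
    ∫ p, W.indicator f p * h p = ∫ p in W, f p * h p := by
  rw [← integral_indicator hW.measurableSet]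
  congr 1
  ext p
  by_cases hp : p ∈ W <;> simp [hp]

/-- Mollification commutes with the weak gradient as long as only values in the domain are used. -/
theorem HasWeakGradient.fderiv_mollify_indicator (hu : HasWeakGradient W u g) (hW : IsOpen W)
    {K : Pt → ℝ} (hK : ContDiff ℝ ∞ K) (hKc : HasCompactSupport K) {q : Pt}
    (hq : ∀ z ∈ tsupport K, q - z ∈ W) (i : Fin 3) :
    fderiv ℝ (mollify volume K (W.indicator u)) q (axis i)
      = mollify volume K (W.indicator (g i)) q := by
  rw [fderiv_mollify hK hKc ((memLp_indicator hW hu.memLp).locallyIntegrable (by norm_num))]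
  simp only [mollify]
  rw [integral_indicator_mul hW u (fun x => fderiv ℝ K (q - x) (axis i)),
    integral_indicator_mul hW (g i) (fun x => K (q - x))]
  have hc : HasCompactSupport fun x => K (q - x) :=
    hKc.comp_homeomorph (Homeomorph.subLeft q)
  have hs : tsupport (fun x => K (q - x)) ⊆ W := by
    intro x hx
    have h1 := tsupport_comp_subset_preimage K (f := fun x => q - x) (by fun_prop) hx
    have := hq _ h1
    simpa using this
  have h := hu.weak i (fun x => K (q - x)) (hK.comp (contDiff_const.sub contDiff_id)) hc hs
  simp only [fderiv_comp_sub_apply (hK.differentiable (by simp)), mul_neg, integral_neg] at h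
  linarith

theorem ext_axis {L : Pt →L[ℝ] ℝ} (h : ∀ i, L (axis i) = 0) : L = 0 := by
  have h0 := h 0
  have h1 := h 1
  have h2 := h 2
  simp only [axis] at h0 h1 h2
  ext <;> simpa

/-- A normalized bump function supported in the closed ball of radius `1 / (n + 1)`. -/
noncomputable def shrinkingBump (n : ℕ) : ContDiffBump (0 : Pt) :=
  ⟨1 / (2 * ((n : ℝ) + 1)), 1 / ((n : ℝ) + 1), by positivity, by
    rw [div_lt_div_iff₀ (by positivity) (by positivity)]; linarith [n.cast_nonneg (α := ℝ)]⟩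

theorem tendsto_shrinkingBump_rOut : Tendsto (fun n => (shrinkingBump n).rOut) atTop (𝓝 0) :=
  tendsto_one_div_add_atTop_nhds_zero_nat

theorem ae_tendsto_mollify_shrinkingBump {f : Pt → ℝ} (hf : LocallyIntegrable f volume) :
    ∀ᵐ x, Tendsto (fun n => mollify volume ((shrinkingBump n).normed volume) f x) atTop
      (𝓝 (f x)) := by
  filter_upwards [ContDiffBump.ae_convolution_tendsto_right_of_locallyIntegrable
    (φ := shrinkingBump) (K := 2) tendsto_shrinkingBump_rOut
    (.of_forall fun n => le_of_eq (by simp only [shrinkingBump]; field_simp)) hf] with x hx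
  refine hx.congr fun n => ?_
  rw [mollify_eq_integral_sub]
  rfl

/-- Mollifications of radius less than `r / 2` have zero gradient on the half ball, hence are
constant there, and they converge to `u` almost everywhere. -/
theorem HasWeakGradient.exists_ae_eq_const_nhds (hu : HasWeakGradient W u g) (hW : IsOpen W)
    (hg : ∀ i, g i =ᵐ[volume.restrict W] 0) {p : Pt} (hp : p ∈ W) :
    ∃ c, ∃ V, IsOpen V ∧ p ∈ V ∧ V ⊆ W ∧ ∀ᵐ x, x ∈ V → u x = c := by
  obtain ⟨r, hr, hrW⟩ := Metric.isOpen_iff.1 hW p hp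
  set V := Metric.ball p (r / 2)
  have hVW : V ⊆ W := (Metric.ball_subset_ball (by linarith)).trans hrW
  have hloc : LocallyIntegrable (W.indicator u) volume :=
    (memLp_indicator hW hu.memLp).locallyIntegrable (by norm_num)
  have hg0 : ∀ i, W.indicator (g i) =ᵐ[volume] 0 := by
    intro i
    have := (ae_restrict_iff' hW.measurableSet).1 (hg i)
    filter_upwards [this] with x hx
    by_cases h : x ∈ W
    · rw [indicator_of_mem h, hx h]
    · rw [indicator_of_notMem h, Pi.zero_apply]
  have hconst : ∀ᶠ n in atTop, ∀ x ∈ V, ∀ y ∈ V,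
      mollify volume ((shrinkingBump n).normed volume) (W.indicator u) x
        = mollify volume ((shrinkingBump n).normed volume) (W.indicator u) y := by
    filter_upwards [tendsto_shrinkingBump_rOut.eventually (gt_mem_nhds (half_pos hr))] with n hn
    set K := (shrinkingBump n).normed (volume : Measure Pt)
    have hK : ContDiff ℝ ∞ K := (shrinkingBump n).contDiff_normed
    have hKc : HasCompactSupport K := (shrinkingBump n).hasCompactSupport_normed
    have hd := (contDiff_mollify hK hKc hloc).differentiable (by simp)
    intro x hx y hy
    refine Metric.isOpen_ball.is_const_of_fderiv_eq_zero
      (convex_ball p (r / 2)).isPreconnected hd.differentiableOn (fun q hq => ?_) hx hy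
    refine ext_axis fun i => ?_
    rw [hu.fderiv_mollify_indicator hW hK hKc (fun z hz => hrW ?_) i]
    · rw [mollify]
      refine (integral_congr_ae (g := fun _ => 0) ?_).trans (by simp)
      filter_upwards [hg0 i] with x hx
      rw [hx]
      simp
    · rw [(shrinkingBump n).tsupport_normed_eq, mem_closedBall_zero_iff] at hz
      rw [mem_ball_iff_norm] at hq ⊢
      calc ‖q - z - p‖ = ‖(q - p) - z‖ := by congr 1; abel
        _ ≤ ‖q - p‖ + ‖z‖ := norm_sub_le _ _
        _ < r := by linarith
  have hae := ae_tendsto_mollify_shrinkingBump hloc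
  have hne : ∃ x ∈ V, Tendsto (fun n => mollify volume ((shrinkingBump n).normed volume)
      (W.indicator u) x) atTop (𝓝 (W.indicator u x)) := by
    by_contra! h
    have h0 : volume V = 0 := measure_mono_null (fun x hx => h x hx) hae
    exact (Metric.measure_ball_pos volume p (half_pos hr)).ne' h0
  obtain ⟨x0, hx0, hlim⟩ := hne
  refine ⟨u x0, V, Metric.isOpen_ball, Metric.mem_ball_self (half_pos hr), hVW, ?_⟩
  filter_upwards [hae] with x hx hxV
  have h1 : Tendsto (fun n => mollify volume ((shrinkingBump n).normed volume)
      (W.indicator u) x) atTop (𝓝 (W.indicator u x0)) := by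
    refine hlim.congr' ?_
    filter_upwards [hconst] with n hn using hn x0 hx0 x hxV
  have := tendsto_nhds_unique hx h1
  rwa [indicator_of_mem (hVW hxV), indicator_of_mem (hVW hx0)] at this

/-- A function with vanishing weak gradient in a connected open set is constant. -/
theorem HasWeakGradient.exists_ae_eq_const (hu : HasWeakGradient W u g) (hW : IsOpen W)
    (hWc : IsConnected W) (hg : ∀ i, g i =ᵐ[volume.restrict W] 0) :
    ∃ c, ∀ᵐ x, x ∈ W → u x = c := by
  have hloc := fun p (hp : p ∈ W) => hu.exists_ae_eq_const_nhds hW hg hp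
  obtain ⟨p0, hp0⟩ := hWc.nonempty
  obtain ⟨c0, V0, hV0, hpV0, hVW0, hc0⟩ := hloc p0 hp0
  -- Points with local constant `c0`, and in `S'` those with another one. Both sets are open, and
  -- disjoint because two overlapping open sets meet in positive measure; connectedness leaves only
  -- `S`.
  let S : Set Pt := {p | ∃ V, IsOpen V ∧ p ∈ V ∧ V ⊆ W ∧ ∀ᵐ x, x ∈ V → u x = c0}
  let S' : Set Pt := {p | ∃ c, c ≠ c0 ∧ ∃ V, IsOpen V ∧ p ∈ V ∧ V ⊆ W ∧ ∀ᵐ x, x ∈ V → u x = c}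
  have hS : IsOpen S := isOpen_iff_forall_mem_open.2 fun p ⟨V, h1, h2, h3, h4⟩ =>
    ⟨V, fun q hq => ⟨V, h1, hq, h3, h4⟩, h1, h2⟩
  have hS' : IsOpen S' := isOpen_iff_forall_mem_open.2 fun p ⟨c, hc, V, h1, h2, h3, h4⟩ =>
    ⟨V, fun q hq => ⟨c, hc, V, h1, hq, h3, h4⟩, h1, h2⟩
  have hdisj : Disjoint S S' := by
    rw [Set.disjoint_left]
    rintro p ⟨V, h1, h2, h3, h4⟩ ⟨c, hc, V', h1', h2', h3', h4'⟩
    have hpos : 0 < volume (V ∩ V') := (h1.inter h1').measure_pos volume ⟨p, h2, h2'⟩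
    refine hpos.ne' (measure_mono_null (t := {x | ¬ ((x ∈ V → u x = c0) ∧ (x ∈ V' → u x = c))})
      (fun x hx h => hc ((h.2 hx.2).symm.trans (h.1 hx.1))) (h4.and h4'))
  have hcov : W ⊆ S ∪ S' := by
    intro p hp
    obtain ⟨c, V, h⟩ := hloc p hp
    by_cases hc : c = c0
    · exact Or.inl ⟨V, hc ▸ h⟩
    · exact Or.inr ⟨c, hc, V, h⟩
  have hWS : W ⊆ S := hWc.isPreconnected.subset_left_of_subset_union hS hS' hdisj hcov
    ⟨p0, hp0, V0, hV0, hpV0, hVW0, hc0⟩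
  refine ⟨c0, ?_⟩
  rw [ae_iff]
  refine measure_null_of_locally_null _ fun x hx => ?_
  have hxW : x ∈ W := by
    by_contra h
    exact hx fun h' => absurd h' h
  obtain ⟨V, h1, h2, h3, h4⟩ := hWS hxW
  refine ⟨V ∩ {x | ¬ (x ∈ W → u x = c0)}, ?_, ?_⟩
  · rw [inter_comm]
    exact inter_mem_nhdsWithin _ (h1.mem_nhds h2)
  · rw [ae_iff] at h4
    exact measure_mono_null (t := {a | ¬(a ∈ V → u a = c0)})
      (fun y hy h => hy.2 fun _ => h hy.1) h4

end WaterWaves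

end LocalConstancy

/-! ### The energy argument and the first claim. -/

section NoTrappedModes

namespace WaterWaves

/-- The dispersion relation `ν = k tanh k`, solved by the intermediate value theorem on `[0, ν +
1]`. At the right end `(ν+1) sinh - ν cosh = sinh(ν+1) - ν exp(-(ν+1))`, which is at least `(ν+1) -
ν`. -/
theorem exists_wavenumber {ν : ℝ} (hν : 0 < ν) :
    ∃ k > 0, ν * Real.cosh k = k * Real.sinh k := by
  have hc : ContinuousOn (fun x : ℝ => x * Real.sinh x - ν * Real.cosh x) (Icc 0 (ν + 1)) := by
    have := Real.continuous_sinh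
    have := Real.continuous_cosh
    fun_prop
  have h1 : 0 ≤ (ν + 1) * Real.sinh (ν + 1) - ν * Real.cosh (ν + 1) := by
    have e := Real.cosh_sub_sinh (ν + 1)
    have h2 := Real.self_le_sinh_iff.2 (show (0 : ℝ) ≤ ν + 1 by linarith)
    have h3 := Real.exp_le_one_iff.2 (show -(ν + 1) ≤ 0 by linarith)
    nlinarith
  obtain ⟨k, hk, hk0⟩ := intermediate_value_Icc (show (0 : ℝ) ≤ ν + 1 by linarith) hc
    (show (0 : ℝ) ∈ Icc _ _ from ⟨by simp [hν.le], h1⟩)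
  simp only at hk0
  refine ⟨k, lt_of_le_of_ne hk.1 ?_, by linarith⟩
  rintro rfl
  simp at hk0
  linarith

theorem hasDerivAt_cosh_mul (k y : ℝ) :
    HasDerivAt (fun y => Real.cosh (k * (y + 1))) (k * Real.sinh (k * (y + 1))) y := by
  have := ((hasDerivAt_id y).add_const 1).const_mul k
  simpa [mul_comm] using this.cosh

theorem hasDerivAt_sinh_mul (k y : ℝ) :
    HasDerivAt (fun y => Real.sinh (k * (y + 1))) (k * Real.cosh (k * (y + 1))) y := by
  have := ((hasDerivAt_id y).add_const 1).const_mul k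
  simpa [mul_comm] using this.sinh

theorem contDiff_cosh_mul (k : ℝ) : ContDiff ℝ ∞ fun y => Real.cosh (k * (y + 1)) :=
  Real.contDiff_cosh.comp (contDiff_const.mul (contDiff_id.add contDiff_const))

theorem contDiff_sinh_mul (k : ℝ) : ContDiff ℝ ∞ fun y => Real.sinh (k * (y + 1)) :=
  Real.contDiff_sinh.comp (contDiff_const.mul (contDiff_id.add contDiff_const))

theorem integral_sq_sinh_mul {k : ℝ} (hk : 0 < k) :
    ∫ y in (-1)..0, Real.sinh (k * (y + 1)) ^ 2 = (Real.sinh k * Real.cosh k / k - 1) / 2 := by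
  have hd : ∀ y ∈ uIcc (-1 : ℝ) 0, HasDerivAt
      (fun y => (Real.sinh (k * (y + 1)) * Real.cosh (k * (y + 1)) / k - y) / 2)
      (Real.sinh (k * (y + 1)) ^ 2) y := by
    intro y _
    have h := ((((hasDerivAt_sinh_mul k y).mul (hasDerivAt_cosh_mul k y)).div_const k).sub
      (hasDerivAt_id y)).div_const 2
    refine h.congr_deriv ?_
    have := Real.cosh_sq (k * (y + 1))
    field_simp
    linarith
  rw [intervalIntegral.integral_eq_sub_of_hasDerivAt hd
    (((contDiff_sinh_mul k).continuous.pow 2).intervalIntegrable _ _)]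
  simp
  ring

variable {α ν k : ℝ} {Wc : Set Pt} {φ : Pt → ℝ} {g : Fin 3 → Pt → ℝ} {t : ℝ × ℝ → ℝ}

/-- The test function is `χ(x) m(y)` with `m(y) = cosh(k(y+1))`. Since `m'' = k² m` and `m'(-1) =
0`, a vertical integration by parts with `M = sinh(k(y+1))` turns the vertical term into a multiple
of `∫ χ u` and a surface term, and `k sinh k = ν cosh k` makes the surface terms cancel. -/
theorem integral_layer_weak_helmholtz (hWc : IsCliffRegion α Wc)
    (hk : ν * Real.cosh k = k * Real.sinh k)
    (hφ : HasWeakGradient (waterDomain α Wc) φ g) (ht : HasTrace α φ t)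
    (hsol : ∀ (ψ : Pt → ℝ) (h : Fin 3 → Pt → ℝ) (s : ℝ × ℝ → ℝ),
      HasWeakGradient (waterDomain α Wc) ψ h → HasTrace α ψ s →
      ∫ p in waterDomain α Wc, ∑ i, g i p * h i p = ν * ∫ x in sector α, t x * s x)
    {χ : ℝ × ℝ → ℝ} (hχ : ContDiff ℝ ∞ χ) (hχc : HasCompactSupport χ)
    (hχs : tsupport χ ⊆ sector α) :
    (∫ x in sector α, fderiv ℝ (fun q => fderiv ℝ χ q (1, 0)) x (1, 0)
        * ∫ y in (-1)..0, Real.cosh (k * (y + 1)) * φ (x, y))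
      + (∫ x in sector α, fderiv ℝ (fun q => fderiv ℝ χ q (0, 1)) x (0, 1)
        * ∫ y in (-1)..0, Real.cosh (k * (y + 1)) * φ (x, y))
      + k ^ 2 * ∫ x in sector α, χ x * ∫ y in (-1)..0, Real.cosh (k * (y + 1)) * φ (x, y) = 0 := by
  have hW := layer_subset α Wc
  have hWo := hWc.isOpen
  have hφl := hφ.memLp_layer hW
  have hgl := hφ.memLp_grad_layer hW
  have hc := contDiff_cosh_mul k
  have hs := contDiff_sinh_mul k
  have hdc : deriv (fun y => Real.cosh (k * (y + 1))) = fun y => k * Real.sinh (k * (y + 1)) :=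
    funext fun y => (hasDerivAt_cosh_mul k y).deriv
  have hds : deriv (fun y => Real.sinh (k * (y + 1))) = fun y => k * Real.cosh (k * (y + 1)) :=
    funext fun y => (hasDerivAt_sinh_mul k y).deriv
  have hχe : ∀ e, ContDiff ℝ ∞ fun q => fderiv ℝ χ q e := contDiff_fderiv_apply hχ
  have hχec : ∀ e, HasCompactSupport fun q => fderiv ℝ χ q e := hasCompactSupport_fderiv_apply hχc
  have hχes : ∀ e, tsupport (fun q => fderiv ℝ χ q e) ⊆ sector α := fun e =>
    (tsupport_fderiv_apply_subset ℝ e).trans hχs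
  have L : ∀ {f : ℝ × ℝ → ℝ}, ContDiff ℝ ∞ f → HasCompactSupport f →
      MemLp f 2 (volume.restrict (sector α)) := fun hf hfc =>
    memLp_sector_of_hasCompactSupport hf.continuous hfc
  have h1 := hsol _ _ _ (hWc.hasWeakGradient_indicator hχ hχc hχs hc)
    (hasTrace_indicator hχ.continuous hχc hc)
  have e1 : ∀ p, ∑ i, g i p * (layer α).indicator (fun p => fderiv ℝ χ p.1 (axis i).1
      * Real.cosh (k * (p.2 + 1)) + χ p.1 * (deriv (fun y => Real.cosh (k * (y + 1))) p.2
      * (axis i).2)) p = (layer α).indicator (fun p =>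
        g 0 p * (fderiv ℝ χ p.1 (1, 0) * Real.cosh (k * (p.2 + 1)))
        + g 1 p * (fderiv ℝ χ p.1 (0, 1) * Real.cosh (k * (p.2 + 1)))
        + g 2 p * (χ p.1 * (k * Real.sinh (k * (p.2 + 1))))) p := by
    intro p
    by_cases hp : p ∈ layer α
    · have h0 : fderiv ℝ χ p.1 ((0, 0) : ℝ × ℝ) = 0 := map_zero _
      simp only [hp, indicator_of_mem, Fin.sum_univ_three, axis, hdc, Matrix.cons_val_zero,
        Matrix.cons_val_one, Matrix.cons_val, mul_zero, mul_one, add_zero]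
      erw [h0]
      ring
    · simp [hp]
  simp only [e1] at h1
  rw [setIntegral_indicator (isOpen_layer α).measurableSet, inter_eq_self_of_subset_right hW] at h1
  have i0 := integrable_layer_mul (hgl 0) (L (hχe (1, 0)) (hχec _)) hc.continuous
  have i1 := integrable_layer_mul (hgl 1) (L (hχe (0, 1)) (hχec _)) hc.continuous
  have i2 := integrable_layer_mul (hgl 2) (L hχ hχc) (continuous_const.mul hs.continuous) (m := fun
    y => k * Real.sinh (k * (y + 1)))
  have i01 : Integrable (fun p => g 0 p * (fderiv ℝ χ p.1 (1, 0) * Real.cosh (k * (p.2 + 1)))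
        + g 1 p * (fderiv ℝ χ p.1 (0, 1) * Real.cosh (k * (p.2 + 1))))
        (volume.restrict (layer α)) := i0.add i1
  rw [integral_add i01 i2, integral_add i0 i1] at h1
  have h2 := hφ.integral_layer_vertical hW hWo ht hχ hχc hχs hs (by simp)
  rw [hds] at h2
  have h3 := hφ.integral_layer_horizontal hW hWo (hχe (1, 0)) (hχec _) (hχes _) hc.continuous
    (i := 0) rfl
  have h4 := hφ.integral_layer_horizontal hW hWo (hχe (0, 1)) (hχec _) (hχes _) hc.continuous
    (i := 1) rfl
  rw [← integral_layer_mul_eq_sector hφl (L (contDiff_fderiv_apply (hχe (1, 0)) (1, 0))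
      (hasCompactSupport_fderiv_apply (hχec _) _)) hc.continuous,
    ← integral_layer_mul_eq_sector hφl (L (contDiff_fderiv_apply (hχe (0, 1)) (0, 1))
      (hasCompactSupport_fderiv_apply (hχec _) _)) hc.continuous,
    ← integral_layer_mul_eq_sector hφl (L hχ hχc) hc.continuous]
  have e2 : ∫ x in sector α, t x * (χ x * Real.cosh (k * (0 + 1)))
      = (∫ x in sector α, t x * χ x) * Real.cosh (k * (0 + 1)) := by
    simp only [← mul_assoc, integral_mul_const]
  rw [e2] at h1
  simp only [mul_left_comm _ k, integral_const_mul, zero_add, mul_one] at h1 h2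
  simp only [axis, Matrix.cons_val_zero, Matrix.cons_val_one] at h3 h4
  linear_combination h3 + h4 - h1 + k * h2 - (∫ x in sector α, t x * χ x) * hk

/-- The mode of the solution that propagates at infinity vanishes. -/
theorem ae_integral_cosh_eq_zero (hα : α ∈ Ioo 0 (Real.pi / 2)) (hWc : IsCliffRegion α Wc)
    (hk0 : 0 < k) (hk : ν * Real.cosh k = k * Real.sinh k)
    (hφ : HasWeakGradient (waterDomain α Wc) φ g) (ht : HasTrace α φ t)
    (hsol : ∀ (ψ : Pt → ℝ) (h : Fin 3 → Pt → ℝ) (s : ℝ × ℝ → ℝ),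
      HasWeakGradient (waterDomain α Wc) ψ h → HasTrace α ψ s →
      ∫ p in waterDomain α Wc, ∑ i, g i p * h i p = ν * ∫ x in sector α, t x * s x) :
    ∀ᵐ x ∂volume.restrict (sector α),
      ∫ y in (-1)..0, Real.cosh (k * (y + 1)) * φ (x, y) = 0 := by
  set u := fun x => ∫ y in (-1)..0, Real.cosh (k * (y + 1)) * φ (x, y)
  have hu : MemLp u 2 (volume.restrict (sector α)) :=
    memLp_integral_fiber (hφ.memLp_layer (layer_subset α Wc)) (contDiff_cosh_mul k).continuous
  have hF := (isOpen_sector α).measurableSet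
  have key := ae_eq_zero_of_weak_helmholtz hα hk0 (f := (sector α).indicator u)
    ((memLp_indicator_iff_restrict hF).2 hu) ?_
  · rw [ae_restrict_iff' hF]
    filter_upwards [key] with x hx hxF
    change u x = 0
    rw [← indicator_of_mem hxF u]
    exact hx hxF
  intro χ hχ hχc hχs
  have h := integral_layer_weak_helmholtz hWc hk hφ ht hsol hχ hχc hχs
  have L : ∀ {f : ℝ × ℝ → ℝ}, ContDiff ℝ ∞ f → HasCompactSupport f →
      Integrable (fun x => f x * u x) (volume.restrict (sector α)) := fun hf hfc =>
    (memLp_sector_of_hasCompactSupport hf.continuous hfc).integrable_mul hu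
  have L2 := fun e => L (contDiff_fderiv_apply (contDiff_fderiv_apply hχ e) e)
    (hasCompactSupport_fderiv_apply (hasCompactSupport_fderiv_apply hχc e) e)
  have L3 : Integrable (fun x => fderiv ℝ (fun q => fderiv ℝ χ q (1, 0)) x (1, 0) * u x
      + fderiv ℝ (fun q => fderiv ℝ χ q (0, 1)) x (0, 1) * u x) (volume.restrict (sector α)) :=
    (L2 _).add (L2 _)
  rw [← integral_const_mul, ← integral_add (L2 (1, 0)) (L2 (0, 1)),
    ← integral_add L3 ((L hχ hχc).const_mul _)] at h
  refine Eq.trans ?_ h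
  rw [← integral_indicator hF]
  congr 1
  ext x
  by_cases hx : x ∈ sector α
  · rw [indicator_of_mem hx, indicator_of_mem hx]
    ring
  · simp [indicator_of_notMem hx]

/-- As the cosh mode vanishes, the vertical formula with `M = sinh(k(y+1))` reads `sinh k · t = ∫ M
φ_y`. The Cauchy–Schwarz inequality with `∫ M² ≤ sinh k cosh k / (2k)` and `ν = k tanh k` produces
exactly the factor `1/2`; what matters is that it is less than one. -/
theorem integral_sq_trace_le (hα : α ∈ Ioo 0 (Real.pi / 2)) (hWc : IsCliffRegion α Wc)
    (hk0 : 0 < k) (hk : ν * Real.cosh k = k * Real.sinh k)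
    (hφ : HasWeakGradient (waterDomain α Wc) φ g) (ht : HasTrace α φ t)
    (hsol : ∀ (ψ : Pt → ℝ) (h : Fin 3 → Pt → ℝ) (s : ℝ × ℝ → ℝ),
      HasWeakGradient (waterDomain α Wc) ψ h → HasTrace α ψ s →
      ∫ p in waterDomain α Wc, ∑ i, g i p * h i p = ν * ∫ x in sector α, t x * s x) :
    ν * ∫ x in sector α, t x * t x ≤ 1 / 2 * ∫ p in layer α, g 2 p ^ 2 := by
  have hW := layer_subset α Wc
  have hgl := hφ.memLp_grad_layer hW 2
  have hs := contDiff_sinh_mul k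
  have hds : deriv (fun y => Real.sinh (k * (y + 1))) = fun y => k * Real.cosh (k * (y + 1)) :=
    funext fun y => (hasDerivAt_sinh_mul k y).deriv
  have hi := hgl.integrable_sq
  rw [restrict_layer] at hi
  rw [restrict_layer, integral_prod _ hi, ← integral_const_mul, ← integral_const_mul]
  have hsk : 0 < Real.sinh k := Real.sinh_pos_iff.2 hk0
  have hck : 0 < Real.cosh k := Real.cosh_pos k
  refine integral_mono_ae ((ht.memLp.integrable_mul ht.memLp).const_mul ν)
    (hi.integral_prod_left.const_mul _) ?_
  filter_upwards [ae_integral_cosh_eq_zero hα hWc hk0 hk hφ ht hsol,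
    hφ.ae_vertical hW hWc.isOpen ht hs (by simp), ae_sq_integral_fiber_le hgl hs.continuous]
    with x h1 h2 h3
  simp only [hds, mul_assoc, intervalIntegral.integral_const_mul] at h2
  rw [h1, mul_zero, add_zero, zero_add, mul_one] at h2
  rw [← h2, integral_sq_sinh_mul hk0] at h3
  set I := ∫ y in Ioo (-1) 0, g 2 (x, y) ^ 2
  have hI : 0 ≤ I := integral_nonneg fun y => sq_nonneg _
  have h4 : (Real.sinh k * t x) ^ 2 ≤ (Real.sinh k * Real.cosh k / k) / 2 * I := by
    refine h3.trans (mul_le_mul_of_nonneg_right ?_ hI)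
    linarith
  have h5 : ν = k * Real.sinh k / Real.cosh k := by
    field_simp; linarith
  change ν * (t x * t x) ≤ 1 / 2 * I
  have h6 : ν * (t x * t x) = k / (Real.sinh k * Real.cosh k) * (Real.sinh k * t x) ^ 2 := by
    rw [h5]; field_simp
  rw [h6]
  calc _ ≤ k / (Real.sinh k * Real.cosh k) * ((Real.sinh k * Real.cosh k / k) / 2 * I) := by gcongr
    _ = 1 / 2 * I := by field_simp

theorem IsWeakSolution.ae_eq_zero (hα : α ∈ Ioo 0 (Real.pi / 2)) (hWc : IsCliffRegion α Wc)
    (hν : 0 < ν) (h : IsWeakSolution α Wc ν φ) :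
    φ =ᵐ[volume.restrict (waterDomain α Wc)] 0 := by
  obtain ⟨g, t, hφ, ht, hsol⟩ := h
  obtain ⟨k, hk0, hk⟩ := exists_wavenumber hν
  have hW := layer_subset α Wc
  have hWo := hWc.isOpen
  set W := waterDomain α Wc
  have h1 := integral_sq_trace_le hα hWc hk0 hk hφ ht hsol
  -- With `ψ = φ` the left side is the full energy, so the estimate bounds the energy by half of one
  -- of its parts.
  rw [← hsol φ g t hφ ht] at h1
  have hi : ∀ i, Integrable (fun p => g i p * g i p) (volume.restrict W) := fun i =>
    (hφ.memLp_grad i).integrable_mul (hφ.memLp_grad i)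
  have hsum : ∫ p in W, ∑ i, g i p * g i p = ∑ i, ∫ p in W, g i p * g i p :=
    integral_finsetSum _ fun i _ => hi i
  have hnn : ∀ i, 0 ≤ ∫ p in W, g i p * g i p := fun i =>
    integral_nonneg fun p => mul_self_nonneg _
  have h2 : ∫ p in layer α, g 2 p ^ 2 ≤ ∫ p in W, g 2 p * g 2 p := by
    simp only [sq]
    exact setIntegral_mono_set (hi 2) (.of_forall fun p => mul_self_nonneg _)
      (LE.le.eventuallyLE hW)
  rw [hsum] at h1
  have hzero : ∀ i, ∫ p in W, g i p * g i p = 0 := by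
    rw [Fin.sum_univ_three] at h1
    have n0 := hnn 0
    have n1 := hnn 1
    have n2 := hnn 2
    intro i
    fin_cases i <;> simp only [Fin.zero_eta, Fin.mk_one, Fin.reduceFinMk] <;> linarith
  have hg : ∀ i, g i =ᵐ[volume.restrict W] 0 := by
    intro i
    have := (integral_eq_zero_iff_of_nonneg (fun p => mul_self_nonneg (g i p)) (hi i)).1 (hzero i)
    filter_upwards [this] with p hp
    exact mul_self_eq_zero.1 hp
  obtain ⟨c, hc⟩ := hφ.exists_ae_eq_const hWo hWc.isConnected hg
  -- The cosh mode of a constant is the constant times a positive integral, and the mode vanishes.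
  have hc0 : c = 0 := by
    have hL : ∀ᵐ p ∂(volume : Measure Pt).restrict (layer α), φ p = c := by
      rw [ae_restrict_iff' (isOpen_layer α).measurableSet]
      filter_upwards [hc] with p hp hpL using hp (hW hpL)
    rw [restrict_layer] at hL
    have hne : (volume.restrict (sector α)) ≠ 0 := by
      rw [Ne, Measure.restrict_eq_zero]
      exact ((isOpen_sector α).measure_pos volume ⟨(0, 1), by simp [sector]⟩).ne'
    have : (ae (volume.restrict (sector α))).NeBot := ae_neBot.2 hne
    obtain ⟨x, h3, h4⟩ := ((Measure.ae_ae_of_ae_prod hL).and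
      (ae_integral_cosh_eq_zero hα hWc hk0 hk hφ ht hsol)).exists
    have h5 : ∫ y in (-1)..0, Real.cosh (k * (y + 1)) * φ (x, y)
        = c * ∫ y in (-1)..0, Real.cosh (k * (y + 1)) := by
      rw [← intervalIntegral.integral_const_mul,
        intervalIntegral.integral_of_le (by norm_num), integral_Ioc_eq_integral_Ioo,
        intervalIntegral.integral_of_le (by norm_num), integral_Ioc_eq_integral_Ioo]
      refine integral_congr_ae ?_
      filter_upwards [h3] with y hy
      rw [hy, mul_comm]
    rw [h5] at h4
    refine (mul_eq_zero.1 h4).resolve_right (ne_of_gt ?_)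
    exact intervalIntegral.intervalIntegral_pos_of_pos
      ((contDiff_cosh_mul k).continuous.intervalIntegrable _ _) (fun y => Real.cosh_pos _)
      (by norm_num)
  rw [EventuallyEq, ae_restrict_iff' hWo.measurableSet]
  filter_upwards [hc] with p hp hpW
  rw [hp hpW, hc0, Pi.zero_apply]

end WaterWaves

end NoTrappedModes

/-! ### Functionals on `H¹` and mollification along inward cones. -/

section Pairing

namespace WaterWaves

/-- The bounded linear functional on `H¹(W)` with coefficients `G` and `G₀`. -/
noncomputable def pairing (W : Set Pt) (G : Fin 3 → Pt → ℝ) (G₀ : Pt → ℝ) (u : Pt → ℝ)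
    (g : Fin 3 → Pt → ℝ) : ℝ :=
  (∑ i, ∫ p in W, G i p * g i p) + ∫ p in W, G₀ p * u p

theorem tendsto_integral_mul_of_sq {Ω : Type*} [MeasurableSpace Ω] {μ : Measure Ω} {F f : Ω → ℝ}
    {fn : ℕ → Ω → ℝ} (hF : MemLp F 2 μ) (hf : MemLp f 2 μ) (hfn : ∀ n, MemLp (fn n) 2 μ)
    (h : Tendsto (fun n => ∫ x, (fn n x - f x) ^ 2 ∂μ) atTop (𝓝 0)) :
    Tendsto (fun n => ∫ x, F x * fn n x ∂μ) atTop (𝓝 (∫ x, F x * f x ∂μ)) := by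
  have h1 : Tendsto (fun n => (∫ x, F x ^ 2 ∂μ) * ∫ x, (fn n x - f x) ^ 2 ∂μ) atTop (𝓝 0) := by
    simpa using h.const_mul (∫ x, F x ^ 2 ∂μ)
  have h2 : Tendsto (fun n => (∫ x, F x * (fn n x - f x) ∂μ) ^ 2) atTop (𝓝 0) :=
    squeeze_zero (fun n => sq_nonneg _) (fun n => sq_integral_mul_le' hF ((hfn n).sub hf)) h1
  have h3 : Tendsto (fun n => ∫ x, F x * (fn n x - f x) ∂μ) atTop (𝓝 0) := by
    have := h2.sqrt
    rw [Real.sqrt_zero] at this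
    exact (tendsto_zero_iff_abs_tendsto_zero _).2 (this.congr fun n => Real.sqrt_sq_eq_abs _)
  have h4 := h3.add_const (∫ x, F x * f x ∂μ)
  rw [zero_add] at h4
  refine h4.congr fun n => ?_
  simp only [mul_sub]
  have i1 : Integrable (fun x => F x * fn n x) μ := hF.integrable_mul (hfn n)
  have i2 : Integrable (fun x => F x * f x) μ := hF.integrable_mul hf
  rw [integral_sub i1 i2, sub_add_cancel]

theorem tendsto_pairing {W : Set Pt} {G : Fin 3 → Pt → ℝ} {G₀ u : Pt → ℝ} {g : Fin 3 → Pt → ℝ}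
    {un : ℕ → Pt → ℝ} {gn : ℕ → Fin 3 → Pt → ℝ}
    (h : ∀ i, Tendsto (fun n => ∫ p in W, G i p * gn n i p) atTop (𝓝 (∫ p in W, G i p * g i p)))
    (h0 : Tendsto (fun n => ∫ p in W, G₀ p * un n p) atTop (𝓝 (∫ p in W, G₀ p * u p))) :
    Tendsto (fun n => pairing W G G₀ (un n) (gn n)) atTop (𝓝 (pairing W G G₀ u g)) :=
  (tendsto_finsetSum _ fun i _ => h i).add h0

variable {W : Set Pt} {u : Pt → ℝ} {g : Fin 3 → Pt → ℝ}

theorem memLp_mul_of_bound {μ : Measure Pt} {f χ : Pt → ℝ} (hf : MemLp f 2 μ) (hχ : Continuous χ)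
    (hχc : HasCompactSupport χ) : MemLp (fun p => χ p * f p) 2 μ := by
  obtain ⟨C, hC⟩ := hχc.exists_bound_of_continuous hχ
  refine (hf.const_mul C).mono (hχ.aestronglyMeasurable.mul hf.1) (.of_forall fun p => ?_)
  rw [norm_mul, norm_mul]
  gcongr
  exact (hC p).trans (le_abs_self _)

/-- The product rule for the weak gradient. -/
theorem HasWeakGradient.mul_smooth (hu : HasWeakGradient W u g) {χ : Pt → ℝ}
    (hχ : ContDiff ℝ ∞ χ) (hχc : HasCompactSupport χ) :
    HasWeakGradient W (fun p => χ p * u p)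
      (fun i p => χ p * g i p + fderiv ℝ χ p (axis i) * u p) where
  memLp := memLp_mul_of_bound hu.memLp hχ.continuous hχc
  memLp_grad i := (memLp_mul_of_bound (hu.memLp_grad i) hχ.continuous hχc).add
    (memLp_mul_of_bound hu.memLp (contDiff_fderiv_apply hχ _).continuous
      (hasCompactSupport_fderiv_apply hχc _))
  weak i η hη hηc hηs := by
    have hd := (contDiff_fderiv_apply hχ (axis i))
    have hdη := (contDiff_fderiv_apply hη (axis i))
    have h := hu.weak i (χ * η) (hχ.mul hη) hχc.mul_right ((tsupport_mul_subset_right).trans hηs)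
    have e : ∀ p, fderiv ℝ (χ * η) p (axis i) = χ p * fderiv ℝ η p (axis i)
        + fderiv ℝ χ p (axis i) * η p := by
      intro p
      rw [fderiv_mul (hχ.differentiable (by simp) p) (hη.differentiable (by simp) p)]
      simp [mul_comm]
    have L : ∀ {f k : Pt → ℝ}, MemLp f 2 (volume.restrict W) → Continuous k →
        HasCompactSupport k → Integrable (fun p => f p * k p) (volume.restrict W) :=
      fun hf hk hkc => hf.integrable_mul ((memLp_of_hasCompactSupport hk hkc).restrict _)
    have i1 := L hu.memLp (hχ.continuous.mul hdη.continuous) hχc.mul_right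
    have i2 := L hu.memLp (hd.continuous.mul hη.continuous) hηc.mul_left
    have i3 := L (hu.memLp_grad i) (hχ.continuous.mul hη.continuous) hχc.mul_right
    have h2 := integral_add i1 i2
    have h3 := integral_add i3 i2
    simp only [e, Pi.mul_apply, mul_add] at h
    have e1 : ∫ p in W, χ p * u p * fderiv ℝ η p (axis i)
        = ∫ p in W, u p * (χ p * fderiv ℝ η p (axis i)) := by
      congr 1; ext p; ring
    have e2 : ∫ p in W, (χ p * g i p + fderiv ℝ χ p (axis i) * u p) * η p
        = ∫ p in W, (g i p * (χ p * η p) + u p * (fderiv ℝ χ p (axis i) * η p)) := by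
      congr 1; ext p; ring
    rw [e1, e2]
    simp only [Pi.mul_apply] at h2 h3
    linarith

/-- Near `p`, the points of `W` can be translated into `W` along a cone of directions. -/
def HasInwardCone (W : Set Pt) (p : Pt) : Prop :=
  ∃ r > 0, ∃ d : Pt, ∃ c > 0, ∀ τ > 0, ∀ q ∈ W ∩ Metric.ball p (2 * r), ∀ z : Pt,
    ‖z - τ • d‖ ≤ c * τ → q - z ∈ Metric.ball p (2 * r) → q - z ∈ W

theorem hasInwardCone_of_mem (hW : IsOpen W) {p : Pt} (hp : p ∈ W) : HasInwardCone W p := by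
  obtain ⟨r, hr, h⟩ := Metric.isOpen_iff.1 hW p hp
  refine ⟨r / 2, by positivity, 0, 1, one_pos, fun τ _ q _ z _ hz => h ?_⟩
  rwa [mul_div_cancel₀ r two_ne_zero] at hz

theorem hasInwardCone_of_notMem_closure {p : Pt} (hp : p ∉ closure W) : HasInwardCone W p := by
  obtain ⟨r, hr, h⟩ := Metric.isOpen_iff.1 isClosed_closure.isOpen_compl p hp
  refine ⟨r / 2, by positivity, 0, 1, one_pos, fun τ _ q hq z _ hz => ?_⟩
  have := hq.2
  rw [mul_div_cancel₀ r two_ne_zero] at this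
  exact absurd (subset_closure hq.1) (h this)

theorem IsLipschitzGraphNear.hasInwardCone {p : Pt} (h : IsLipschitzGraphNear W p) :
    HasInwardCone W p := by
  obtain ⟨U, hU, T, K, f, hf, hUW⟩ := h
  obtain ⟨r, hr, hrU⟩ := Metric.mem_nhds_iff.1 hU
  -- With this opening, `T z` differs from `τ • (0, 1)` by a vector `e` with `‖e‖ (1 + K) ≤ τ / 2`:
  -- the descent exceeds what the graph can fall over the horizontal displacement together with the
  -- vertical error.
  set c : ℝ := 1 / (2 * ((‖(T : Pt →L[ℝ] Pt)‖ + 1) * (1 + K)))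
  have hTn := norm_nonneg (T : Pt →L[ℝ] Pt)
  have hc : 0 < c := by positivity
  refine ⟨r / 2, by positivity, T.symm (0, 1), c, hc, fun τ hτ q hq z hz hqz => ?_⟩
  rw [mul_div_cancel₀ r two_ne_zero] at hq hqz
  rw [hUW _ (hrU hqz), map_sub]
  have h1 := (hUW q (hrU hq.2)).1 hq.1
  set e := T z - τ • ((0, 1) : Pt)
  have he : ‖e‖ * (1 + K) < τ := by
    have h2 : ‖e‖ ≤ ‖(T : Pt →L[ℝ] Pt)‖ * ‖z - τ • T.symm (0, 1)‖ := by
      have := (T : Pt →L[ℝ] Pt).le_opNorm (z - τ • T.symm (0, 1))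
      simpa [e, map_sub, map_smul] using this
    have h3 : ‖e‖ ≤ (‖(T : Pt →L[ℝ] Pt)‖ + 1) * (c * τ) :=
      h2.trans (mul_le_mul (by linarith) hz (norm_nonneg _) (by positivity))
    have hK1 : (0 : ℝ) < 1 + K := by positivity
    have hT1 : 0 < ‖(T : Pt →L[ℝ] Pt)‖ + 1 := by positivity
    calc ‖e‖ * (1 + K) ≤ (‖(T : Pt →L[ℝ] Pt)‖ + 1) * (c * τ) * (1 + K) := by gcongr
      _ = τ / 2 := by simp only [c]; field_simp
      _ < τ := by linarith
  have hTz : T z = e + τ • ((0, 1) : Pt) := by simp [e]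
  have e1 : (T q - T z).1 = (T q).1 - e.1 := by rw [hTz]; simp
  have e2 : (T q - T z).2 = (T q).2 - e.2 - τ := by rw [hTz]; simp; ring
  rw [e1, e2]
  have h4 := hf.dist_le_mul ((T q).1 - e.1) (T q).1
  rw [dist_eq_norm, dist_eq_norm, sub_sub_cancel_left, norm_neg, Real.norm_eq_abs] at h4
  have h5 : ‖e.1‖ ≤ ‖e‖ := norm_fst_le e
  have h6 : ‖e.2‖ ≤ ‖e‖ := norm_snd_le e
  rw [Real.norm_eq_abs] at h6
  have h7 : (K : ℝ) * ‖e.1‖ ≤ K * ‖e‖ := by gcongr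
  have h8 := (abs_le.1 h4).1
  have h9 := (abs_le.1 h6).1
  linarith

theorem hasCompactSupport_mollify {K f : Pt → ℝ} (hK : HasCompactSupport K)
    (hf : HasCompactSupport f) : HasCompactSupport (mollify volume K f) := by
  rw [mollify_eq_convolution]
  exact HasCompactSupport.convolution _ hf hK

variable {G : Fin 3 → Pt → ℝ} {G₀ : Pt → ℝ}

/-- A functional vanishing on smooth functions vanishes on functions supported near a point with an
inward cone. -/
theorem exists_ball_pairing_eq_zero (hW : IsOpen W)
    (hG : ∀ i, MemLp (G i) 2 (volume.restrict W)) (hG₀ : MemLp G₀ 2 (volume.restrict W))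
    (hsm : ∀ ψ : Pt → ℝ, ContDiff ℝ ∞ ψ → HasCompactSupport ψ →
      pairing W G G₀ ψ (fun i p => fderiv ℝ ψ p (axis i)) = 0)
    {p : Pt} (hp : HasInwardCone W p) : ∃ r > 0, ∀ χ : Pt → ℝ, ContDiff ℝ ∞ χ →
      HasCompactSupport χ → tsupport χ ⊆ Metric.ball p r → ∀ u g, HasWeakGradient W u g →
      pairing W G G₀ (fun p => χ p * u p)
        (fun i p => χ p * g i p + fderiv ℝ χ p (axis i) * u p) = 0 := by
  obtain ⟨r, hr, d, c, hc, hcone⟩ := hp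
  refine ⟨r, hr, fun χ hχ hχc hχs u g hu => ?_⟩
  have hu' := hu.mul_smooth hχ hχc
  set u' : Pt → ℝ := fun p => χ p * u p
  set g' : Fin 3 → Pt → ℝ := fun i p => χ p * g i p + fderiv ℝ χ p (axis i) * u p
  let τ : ℕ → ℝ := fun n => 1 / ((n : ℝ) + 1)
  have hτ0 : ∀ n, 0 < τ n := fun n => by positivity
  have hτ : Tendsto τ atTop (𝓝 0) := tendsto_one_div_add_atTop_nhds_zero_nat
  -- The kernels are centred at `τ n • d` and supported in the cone, so near `p` the mollification
  -- at a point of `W` uses only values from `W`, even at the boundary, and commutes there with the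
  -- weak gradient.
  let B : (n : ℕ) → ContDiffBump (τ n • d) := fun n =>
    ⟨c * τ n / 2, c * τ n, by have := hτ0 n; positivity, by
      have := mul_pos hc (hτ0 n); linarith⟩
  set K : ℕ → Pt → ℝ := fun n => (B n).normed volume
  have hK : ∀ n, ContDiff ℝ ∞ (K n) := fun n => (B n).contDiff_normed
  have hKc : ∀ n, HasCompactSupport (K n) := fun n => (B n).hasCompactSupport_normed
  have hKt : ∀ n, ∀ z ∈ tsupport (K n), ‖z - τ n • d‖ ≤ c * τ n := by
    intro n z hz
    rw [(B n).tsupport_normed_eq, mem_closedBall_iff_norm] at hz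
    exact hz
  have hKn : ∀ n, ∀ z ∈ tsupport (K n), ‖z‖ ≤ (c + ‖d‖) * τ n := by
    intro n z hz
    have h1 := hKt n z hz
    have h2 : ‖z‖ ≤ ‖z - τ n • d‖ + ‖τ n • d‖ := by
      simpa using norm_add_le (z - τ n • d) (τ n • d)
    rw [norm_smul, Real.norm_of_nonneg (hτ0 n).le] at h2
    linarith
  have hrad : Tendsto (fun n => (c + ‖d‖) * τ n) atTop (𝓝 0) := by
    simpa using hτ.const_mul (c + ‖d‖)
  have hconv : ∀ {f : Pt → ℝ}, MemLp f 2 volume →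
      Tendsto (fun n => ∫ q, (mollify volume (K n) f q - f q) ^ 2) atTop (𝓝 0) := fun hf =>
    tendsto_integral_sq_mollify_sub hf hK hKc (fun n z => (B n).nonneg_normed z)
      (fun n => (B n).integral_normed) hrad fun n z hz => by
        by_contra hne
        exact absurd (hKn n z (subset_tsupport _ hne)) (not_le.2 hz)
  have hW' := hW.measurableSet
  have hconvW : ∀ {F f : Pt → ℝ}, MemLp F 2 (volume.restrict W) → MemLp f 2 (volume.restrict W) →
      Tendsto (fun n => ∫ p in W, F p * mollify volume (K n) (W.indicator f) p) atTop
        (𝓝 (∫ p in W, F p * f p)) := by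
    intro F f hF hf
    have hfi := memLp_indicator hW hf
    refine tendsto_integral_mul_of_sq hF hf (fun n => (memLp_mollify (hK n) (hKc n) hfi).restrict _)
      ?_
    refine squeeze_zero (fun n => integral_nonneg fun p => sq_nonneg _) (fun n => ?_) (hconv hfi)
    have hi : Integrable (fun q => (mollify volume (K n) (W.indicator f) q
        - W.indicator f q) ^ 2) volume :=
      ((memLp_mollify (hK n) (hKc n) hfi).sub hfi).integrable_sq
    calc ∫ p in W, (mollify volume (K n) (W.indicator f) p - f p) ^ 2
        = ∫ p in W, (mollify volume (K n) (W.indicator f) p - W.indicator f p) ^ 2 :=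
          setIntegral_congr_fun hW' fun p hp => by simp only [indicator_of_mem hp]
      _ ≤ _ := setIntegral_le_integral hi (.of_forall fun p => sq_nonneg _)
  have hlim : Tendsto (fun n => pairing W G G₀ (mollify volume (K n) (W.indicator u'))
      (fun i => mollify volume (K n) (W.indicator (g' i)))) atTop (𝓝 (pairing W G G₀ u' g')) :=
    tendsto_pairing (fun i => hconvW (hG i) (hu'.memLp_grad i)) (hconvW hG₀ hu'.memLp)
  refine tendsto_nhds_unique hlim (tendsto_const_nhds.congr' ?_)
  filter_upwards [hrad.eventually (gt_mem_nhds (half_pos hr))] with n hn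
  have hloc : LocallyIntegrable (W.indicator u') volume :=
    (memLp_indicator hW hu'.memLp).locallyIntegrable (by norm_num)
  have huc : HasCompactSupport (W.indicator u') := by
    refine hχc.mono fun q hq => ?_
    have h1 : q ∈ Function.support u' := (support_indicator (s := W) (f := u') ▸ hq).2
    exact left_ne_zero_of_mul (h1 : χ q * u q ≠ 0)
  have h0 := hsm _ (contDiff_mollify (hK n) (hKc n) hloc) (hasCompactSupport_mollify (hKc n) huc)
  rw [← h0, pairing, pairing]
  congr 1
  refine Finset.sum_congr rfl fun i _ => setIntegral_congr_fun hW' fun q hq => ?_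
  congr 1
  -- The translations are shorter than `r / 2`: inside this ball they stay in the ball of the cone
  -- condition, and outside it they do not reach the support of `χ`, so both sides vanish.
  by_cases hqb : q ∈ Metric.ball p (3 / 2 * r)
  · refine hu'.fderiv_mollify_indicator hW (hK n) (hKc n) (fun z hz => ?_) i
    have hzn := hKn n z hz
    rw [mem_ball_iff_norm] at hqb
    refine hcone (τ n) (hτ0 n) q ⟨hq, ?_⟩ z (hKt n z hz) ?_
    · rw [mem_ball_iff_norm]; linarith
    · rw [mem_ball_iff_norm]
      calc ‖q - z - p‖ = ‖(q - p) - z‖ := by congr 1; abel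
        _ ≤ ‖q - p‖ + ‖z‖ := norm_sub_le _ _
        _ < 2 * r := by linarith
  · have hz : ∀ z ∈ tsupport (K n), q - z ∉ tsupport χ := by
      intro z hz hmem
      have h1 := hχs hmem
      have h2 := hKn n z hz
      rw [mem_ball_iff_norm] at h1 hqb
      have h3 : ‖q - p‖ ≤ ‖q - z - p‖ + ‖z‖ := by
        have := norm_add_le (q - z - p) z
        rwa [show q - z - p + z = q - p by abel] at this
      exact hqb (by linarith)
    rw [fderiv_mollify (hK n) (hKc n) hloc, mollify, mollify]
    have e1 : ∀ x, W.indicator u' x * fderiv ℝ (K n) (q - x) (axis i) = 0 := by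
      intro x
      by_cases hx : q - x ∈ tsupport (K n)
      · have := hz _ hx
        rw [sub_sub_cancel] at this
        have h1 : u' x = 0 := by
          simp [u', image_eq_zero_of_notMem_tsupport this]
        rw [indicator_apply_eq_zero.2 fun _ => h1, zero_mul]
      · have : fderiv ℝ (K n) (q - x) = 0 :=
          image_eq_zero_of_notMem_tsupport fun h => hx (tsupport_fderiv_subset ℝ h)
        simp [this]
    have e2 : ∀ x, W.indicator (g' i) x * K n (q - x) = 0 := by
      intro x
      by_cases hx : q - x ∈ tsupport (K n)
      · have := hz _ hx
        rw [sub_sub_cancel] at this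
        have h2 : fderiv ℝ χ x = 0 :=
          image_eq_zero_of_notMem_tsupport fun h => this (tsupport_fderiv_subset ℝ h)
        have h1 : g' i x = 0 := by
          simp [g', image_eq_zero_of_notMem_tsupport this, h2]
        rw [indicator_apply_eq_zero.2 fun _ => h1, zero_mul]
      · rw [image_eq_zero_of_notMem_tsupport hx, mul_zero]
    simp only [e1, e2]

end WaterWaves

end Pairing

/-! ### Partition of unity, exceptional points and infinity. -/

section Density

namespace WaterWaves

variable {W : Set Pt} {u : Pt → ℝ} {g : Fin 3 → Pt → ℝ} {G : Fin 3 → Pt → ℝ} {G₀ : Pt → ℝ}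

theorem pairing_sum {ι : Type*} (s : Finset ι) {un : ι → Pt → ℝ} {gn : ι → Fin 3 → Pt → ℝ}
    (hG : ∀ i, MemLp (G i) 2 (volume.restrict W)) (hG₀ : MemLp G₀ 2 (volume.restrict W))
    (h : ∀ k, HasWeakGradient W (un k) (gn k)) :
    pairing W G G₀ (fun p => ∑ k ∈ s, un k p) (fun i p => ∑ k ∈ s, gn k i p)
      = ∑ k ∈ s, pairing W G G₀ (un k) (gn k) := by
  have h1 : ∀ i, ∫ p in W, G i p * ∑ k ∈ s, gn k i p = ∑ k ∈ s, ∫ p in W, G i p * gn k i p := by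
    intro i
    simp only [Finset.mul_sum]
    exact integral_finsetSum _ fun k _ => (hG i).integrable_mul ((h k).memLp_grad i)
  have h2 : ∫ p in W, G₀ p * ∑ k ∈ s, un k p = ∑ k ∈ s, ∫ p in W, G₀ p * un k p := by
    simp only [Finset.mul_sum]
    exact integral_finsetSum _ fun k _ => hG₀.integrable_mul (h k).memLp
  simp only [pairing, h1, h2]
  rw [Finset.sum_comm, ← Finset.sum_add_distrib]

/-- Compactness of the support of `ξ` and a finite smooth partition of unity reduce the claim to the
local one, the functional being additive. -/
theorem pairing_eq_zero_of_forall_cone (hW : IsOpen W)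
    (hG : ∀ i, MemLp (G i) 2 (volume.restrict W)) (hG₀ : MemLp G₀ 2 (volume.restrict W))
    (hsm : ∀ ψ : Pt → ℝ, ContDiff ℝ ∞ ψ → HasCompactSupport ψ →
      pairing W G G₀ ψ (fun i p => fderiv ℝ ψ p (axis i)) = 0)
    (hu : HasWeakGradient W u g) {ξ : Pt → ℝ} (hξ : ContDiff ℝ ∞ ξ) (hξc : HasCompactSupport ξ)
    (hcone : ∀ p ∈ tsupport ξ, HasInwardCone W p) :
    pairing W G G₀ (fun p => ξ p * u p)
      (fun i p => ξ p * g i p + fderiv ℝ ξ p (axis i) * u p) = 0 := by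
  have hloc := fun p (hp : p ∈ tsupport ξ) =>
    exists_ball_pairing_eq_zero hW hG hG₀ hsm (hcone p hp)
  choose r hr hloc using hloc
  obtain ⟨t, ht⟩ := hξc.isCompact.elim_finite_subcover
    (fun p : tsupport ξ => Metric.ball (p : Pt) (r p p.2)) (fun p => Metric.isOpen_ball)
    (fun p hp => mem_iUnion.2 ⟨⟨p, hp⟩, Metric.mem_ball_self (hr p hp)⟩)
  obtain ⟨f, hf⟩ := SmoothPartitionOfUnity.exists_isSubordinate (modelWithCornersSelf ℝ Pt)
    (isClosed_tsupport ξ) (fun k : t => Metric.ball (k : Pt) (r k k.1.2))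
    (fun k => Metric.isOpen_ball) (fun p hp => by
      obtain ⟨k, hk, hpk⟩ := mem_iUnion₂.1 (ht hp)
      exact mem_iUnion.2 ⟨⟨k, hk⟩, hpk⟩)
  set χ : t → Pt → ℝ := fun k p => f k p * ξ p
  have hfk : ∀ k, ContDiff ℝ ∞ (f k) := fun k => (f k).contMDiff.contDiff
  have hχ : ∀ k, ContDiff ℝ ∞ (χ k) := fun k => (hfk k).mul hξ
  have hχc : ∀ k, HasCompactSupport (χ k) := fun k => hξc.mul_left
  have hsum : ξ = fun p => ∑ k, χ k p := by
    ext p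
    simp only [χ, ← Finset.sum_mul]
    by_cases hp : p ∈ tsupport ξ
    · have := f.sum_eq_one hp
      rw [finsum_eq_sum_of_fintype] at this
      rw [this, one_mul]
    · rw [image_eq_zero_of_notMem_tsupport hp, mul_zero]
  have hd : ∀ p i, fderiv ℝ ξ p (axis i) = ∑ k, fderiv ℝ (χ k) p (axis i) := by
    intro p i
    conv_lhs => rw [hsum]
    rw [fderiv_fun_sum fun k _ => (hχ k).differentiable (by simp) p]
    simp
  have e1 : (fun p => ξ p * u p) = fun p => ∑ k, χ k p * u p := by
    ext p
    rw [← Finset.sum_mul, ← congrFun hsum p]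
  have e2 : (fun i p => ξ p * g i p + fderiv ℝ ξ p (axis i) * u p)
      = fun i p => ∑ k, (χ k p * g i p + fderiv ℝ (χ k) p (axis i) * u p) := by
    ext i p
    have e3 : ∑ k, χ k p * g i p = ξ p * g i p := by
      rw [← Finset.sum_mul, ← congrFun hsum p]
    rw [Finset.sum_add_distrib, e3, ← Finset.sum_mul _ _ (u p), ← hd]
  rw [e1, e2, pairing_sum (un := fun k p => χ k p * u p)
    (gn := fun k i p => χ k p * g i p + fderiv ℝ (χ k) p (axis i) * u p) Finset.univ hG hG₀
    fun k => hu.mul_smooth (hχ k) (hχc k)]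
  exact Finset.sum_eq_zero fun k _ => hloc k k.1.2 (χ k) (hχ k) (hχc k)
    ((tsupport_mul_subset_left).trans (hf k)) u g hu

theorem tendsto_integral_mul_of_bounded {μ : Measure Pt} {H a : Pt → ℝ} {an : ℕ → Pt → ℝ}
    (hH : Integrable H μ) (han : ∀ n, AEStronglyMeasurable (an n) μ) {C : ℝ}
    (hC : ∀ n p, |an n p| ≤ C) (hlim : ∀ᵐ p ∂μ, Tendsto (fun n => an n p) atTop (𝓝 (a p))) :
    Tendsto (fun n => ∫ p, H p * an n p ∂μ) atTop (𝓝 (∫ p, H p * a p ∂μ)) := by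
  refine tendsto_integral_of_dominated_convergence (fun p => |H p| * C)
    (fun n => hH.1.mul (han n)) (hH.abs.mul_const C) (fun n => .of_forall fun p => ?_) ?_
  · rw [norm_mul, Real.norm_eq_abs, Real.norm_eq_abs]
    exact mul_le_mul_of_nonneg_left (hC n p) (abs_nonneg _)
  · filter_upwards [hlim] with p hp using hp.const_mul _

/-- A smooth bump function at the origin. -/
noncomputable def unitBump : ContDiffBump (0 : Pt) := ⟨1, 2, one_pos, one_lt_two⟩

theorem exists_bound_fderiv_unitBump : ∃ C, ∀ i p, |fderiv ℝ unitBump p (axis i)| ≤ C := by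
  have h := fun i => (hasCompactSupport_fderiv_apply unitBump.hasCompactSupport
    (axis i)).exists_bound_of_continuous (contDiff_fderiv_apply unitBump.contDiff (axis i)).continuous
  choose C hC using h
  exact ⟨∑ i, |C i|, fun i p => (hC i p).trans ((le_abs_self _).trans
    (Finset.single_le_sum (f := fun i => |C i|) (fun _ _ => abs_nonneg _) (Finset.mem_univ i)))⟩

theorem fderiv_comp_smul_sub {b : Pt → ℝ} (hb : Differentiable ℝ b) (a : ℝ) (e q v : Pt) :
    fderiv ℝ (fun q => b (a • (q - e))) q v = a * fderiv ℝ b (a • (q - e)) v := by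
  have h := (hb (a • (q - e))).hasFDerivAt.comp q (((hasFDerivAt_id q).sub_const e).const_smul a)
  change HasFDerivAt (fun q => b (a • (q - e))) _ q at h
  rw [h.fderiv]
  simp

theorem contDiff_comp_smul_sub {b : Pt → ℝ} (hb : ContDiff ℝ ∞ b) (a : ℝ) (e : Pt) :
    ContDiff ℝ ∞ fun q => b (a • (q - e)) :=
  hb.comp (by fun_prop)

theorem finrank_pt : Module.finrank ℝ Pt = 3 := by simp [Pt]

theorem abs_unitBump_le (p : Pt) : |unitBump p| ≤ 1 := by
  rw [abs_of_nonneg unitBump.nonneg]; exact unitBump.le_one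

/-- A point has zero capacity: cutting it out does not change the functional on bounded
functions. -/
theorem pairing_eq_zero_of_forall_notMem_tsupport
    (hG : ∀ i, MemLp (G i) 2 (volume.restrict W)) (hG₀ : MemLp G₀ 2 (volume.restrict W))
    (hu : HasWeakGradient W u g) {C : ℝ} (hC : ∀ p, |u p| ≤ C) (e : Pt)
    {ξ : Pt → ℝ} (hξ : ContDiff ℝ ∞ ξ) (hξc : HasCompactSupport ξ)
    (h : ∀ ζ : Pt → ℝ, ContDiff ℝ ∞ ζ → HasCompactSupport ζ → tsupport ζ ⊆ tsupport ξ →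
      e ∉ tsupport ζ → pairing W G G₀ (fun p => ζ p * u p)
        (fun i p => ζ p * g i p + fderiv ℝ ζ p (axis i) * u p) = 0) :
    pairing W G G₀ (fun p => ξ p * u p)
      (fun i p => ξ p * g i p + fderiv ℝ ξ p (axis i) * u p) = 0 := by
  have hbd : Differentiable ℝ unitBump := (unitBump.contDiff (n := 1)).differentiable (by simp)
  -- Bumps equal to one on a ball of radius `1 / (n + 1)` about `e`; the functions `1 - b n` remove
  -- the point and tend to one elsewhere.
  set b : ℕ → Pt → ℝ := fun n q => unitBump (((n : ℝ) + 1) • (q - e))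
  have hb : ∀ n, ContDiff ℝ ∞ (b n) := fun n => contDiff_comp_smul_sub unitBump.contDiff _ e
  have hb1 : ∀ n p, |1 - b n p| ≤ 1 := fun n p => by
    have h1 : 0 ≤ b n p := unitBump.nonneg
    have h2 : b n p ≤ 1 := unitBump.le_one
    rw [abs_of_nonneg (by linarith)]; linarith
  have hblim : ∀ p, p ≠ e → Tendsto (fun n => 1 - b n p) atTop (𝓝 1) := by
    intro p hp
    refine tendsto_const_nhds.congr' ?_
    have hpos : 0 < ‖p - e‖ := norm_pos_iff.2 (sub_ne_zero.2 hp)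
    filter_upwards [(tendsto_natCast_atTop_atTop (R := ℝ)).eventually_ge_atTop (2 / ‖p - e‖)]
      with n hn
    have : b n p = 0 := by
      refine unitBump.zero_of_le_dist ?_
      rw [dist_zero_right, norm_smul, Real.norm_of_nonneg (by positivity)]
      rw [div_le_iff₀ hpos] at hn
      change 2 ≤ _
      nlinarith
    rw [this, sub_zero]
  have hae : ∀ᵐ p ∂(volume : Measure Pt).restrict W, p ≠ e := by
    refine ae_restrict_of_ae ?_
    simp [ae_iff, measure_singleton]
  set ζ : ℕ → Pt → ℝ := fun n p => ξ p * (1 - b n p)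
  have hζ : ∀ n, ContDiff ℝ ∞ (ζ n) := fun n => hξ.mul (contDiff_const.sub (hb n))
  have hζd : ∀ n p i, fderiv ℝ (ζ n) p (axis i) = fderiv ℝ ξ p (axis i) * (1 - b n p)
      - ξ p * (((n : ℝ) + 1) * fderiv ℝ unitBump (((n : ℝ) + 1) • (p - e)) (axis i)) := by
    intro n p i
    have h1 : HasFDerivAt (fun p => 1 - b n p) (-fderiv ℝ (b n) p) p :=
      ((hb n).differentiable (by simp) p).hasFDerivAt.const_sub 1
    have h2 := ((hξ.differentiable (by simp) p).hasFDerivAt.mul h1).fderiv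
    change fderiv ℝ (ζ n) p = _ at h2
    rw [h2, ← fderiv_comp_smul_sub hbd]
    simp only [add_apply, FunLike.coe_smul, Pi.smul_apply, neg_apply, smul_eq_mul, b]
    ring
  have hzero : ∀ n, pairing W G G₀ (fun p => ζ n p * u p)
      (fun i p => ζ n p * g i p + fderiv ℝ (ζ n) p (axis i) * u p) = 0 := by
    intro n
    refine h (ζ n) (hζ n) hξc.mul_right tsupport_mul_subset_left ?_
    rw [notMem_tsupport_iff_eventuallyEq]
    filter_upwards [Metric.ball_mem_nhds e (show (0 : ℝ) < 1 / ((n : ℝ) + 1) by positivity)]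
      with q hq
    have : b n q = 1 := by
      refine unitBump.one_of_mem_closedBall ?_
      rw [mem_closedBall_zero_iff, norm_smul, Real.norm_of_nonneg (by positivity)]
      rw [mem_ball_iff_norm, lt_div_iff₀ (by positivity)] at hq
      change _ ≤ (1 : ℝ)
      rw [mul_comm]
      exact hq.le
    simp [ζ, this]
  have hξu : MemLp (fun p => ξ p * u p) 2 (volume.restrict W) :=
    memLp_mul_of_bound hu.memLp hξ.continuous hξc
  have hmeas : ∀ n, AEStronglyMeasurable (fun p => 1 - b n p) (volume.restrict W) := fun n =>
    (continuous_const.sub (hb n).continuous).aestronglyMeasurable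
  have hcut : ∀ {H : Pt → ℝ}, Integrable H (volume.restrict W) →
      Tendsto (fun n => ∫ p in W, H p * (1 - b n p)) atTop (𝓝 (∫ p in W, H p)) := by
    intro H hH
    have := tendsto_integral_mul_of_bounded (a := fun _ => 1) hH hmeas hb1
      (hae.mono fun p hp => hblim p hp)
    simpa using this
  refine tendsto_nhds_unique (tendsto_pairing (un := fun n p => ζ n p * u p)
    (gn := fun n i p => ζ n p * g i p + fderiv ℝ (ζ n) p (axis i) * u p) (fun i => ?_) ?_)
    (tendsto_const_nhds.congr fun n => (hzero n).symm)
  · have i1 : Integrable (fun p => G i p * (ξ p * g i p + fderiv ℝ ξ p (axis i) * u p))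
        (volume.restrict W) := (hG i).integrable_mul ((hu.mul_smooth hξ hξc).memLp_grad i)
    have m1 : MemLp (fun p => G i p * (ξ p * u p)) 2 (volume.restrict W) := by
      obtain ⟨D, hD⟩ := hξc.exists_bound_of_continuous hξ.continuous
      refine ((hG i).const_mul (D * C)).mono ((hG i).1.mul hξu.1) (.of_forall fun p => ?_)
      rw [norm_mul, norm_mul, norm_mul, mul_comm]
      refine mul_le_mul_of_nonneg_right ?_ (norm_nonneg _)
      exact (mul_le_mul (hD p) (hC p) (abs_nonneg _) ((norm_nonneg _).trans (hD p))).trans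
        (le_abs_self _)
    set β : Pt → ℝ := fun q => fderiv ℝ unitBump q (axis i)
    have hβ : ContDiff ℝ ∞ β := contDiff_fderiv_apply unitBump.contDiff _
    have hβc : HasCompactSupport β :=
      hasCompactSupport_fderiv_apply unitBump.hasCompactSupport _
    have m2 : ∀ n : ℕ, MemLp (fun p => ((n : ℝ) + 1) * β (((n : ℝ) + 1) • (p - e))) 2 volume := by
      intro n
      refine MemLp.const_mul ?_ _
      refine memLp_of_hasCompactSupport (contDiff_comp_smul_sub hβ _ e).continuous ?_
      have hn : ((n : ℝ) + 1) ≠ 0 := by positivity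
      exact hβc.comp_homeomorph ((Homeomorph.subRight e).trans (Homeomorph.smulOfNeZero _ hn))
    -- In dimension three the squared norm of the gradient of the cut-off scales like `(n+1)²
    -- (n+1)⁻³` and tends to zero. The bound on `u` lets this gradient be multiplied by `u`.
    have hsq : Tendsto (fun n : ℕ => ∫ p in W, (((n : ℝ) + 1) * β (((n : ℝ) + 1) • (p - e)) - 0) ^ 2)
        atTop (𝓝 0) := by
      have hl : Tendsto (fun n : ℕ => 1 / ((n : ℝ) + 1) * ∫ p, β p ^ 2) atTop (𝓝 0) := by
        simpa using tendsto_one_div_add_atTop_nhds_zero_nat.mul_const (∫ p, β p ^ 2)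
      refine squeeze_zero (fun n => integral_nonneg fun p => sq_nonneg _) (fun n => ?_) hl
      simp only [sub_zero]
      refine (setIntegral_le_integral (m2 n).integrable_sq
        (.of_forall fun p => sq_nonneg _)).trans (le_of_eq ?_)
      simp only [mul_pow]
      rw [integral_const_mul, integral_sub_right_eq_self (fun p => β (((n : ℝ) + 1) • p) ^ 2) e,
        Measure.integral_comp_smul volume (fun p => β p ^ 2), finrank_pt, smul_eq_mul,
        abs_of_nonneg (by positivity)]
      field_simp
    have h1 := hcut i1
    have h2 := tendsto_integral_mul_of_sq m1 (MemLp.zero' (ε := ℝ)) (fun n => (m2 n).restrict W) hsq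
    simp only [mul_zero, integral_zero] at h2
    have h3 := h1.sub h2
    rw [sub_zero] at h3
    refine h3.congr fun n => ?_
    rw [← integral_sub]
    · congr 1
      ext p
      rw [hζd]
      simp only [ζ, β]
      ring
    · refine i1.mul_bdd (c := 1) (hmeas n) (.of_forall fun p => ?_)
      exact hb1 n p
    · exact m1.integrable_mul ((m2 n).restrict W)
  · have i0 : Integrable (fun p => G₀ p * (ξ p * u p)) (volume.restrict W) :=
      hG₀.integrable_mul hξu
    refine (hcut i0).congr fun n => ?_
    congr 1
    ext p
    simp only [ζ]
    ring

/-- The points are removed one at a time; each cut-off only shrinks the support, so points already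
avoided remain so. -/
theorem pairing_eq_zero_of_finset (hG : ∀ i, MemLp (G i) 2 (volume.restrict W))
    (hG₀ : MemLp G₀ 2 (volume.restrict W)) (hu : HasWeakGradient W u g) {C : ℝ}
    (hC : ∀ p, |u p| ≤ C) (E : Finset Pt) :
    (∀ ξ : Pt → ℝ, ContDiff ℝ ∞ ξ → HasCompactSupport ξ → (∀ e ∈ E, e ∉ tsupport ξ) →
      pairing W G G₀ (fun p => ξ p * u p)
        (fun i p => ξ p * g i p + fderiv ℝ ξ p (axis i) * u p) = 0) →
    ∀ ξ : Pt → ℝ, ContDiff ℝ ∞ ξ → HasCompactSupport ξ →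
      pairing W G G₀ (fun p => ξ p * u p)
        (fun i p => ξ p * g i p + fderiv ℝ ξ p (axis i) * u p) = 0 := by
  classical
  induction E using Finset.induction_on with
  | empty => exact fun h ξ h1 h2 => h ξ h1 h2 (by simp)
  | insert e E _ ih =>
    refine fun h => ih fun ξ h1 h2 h3 => ?_
    refine pairing_eq_zero_of_forall_notMem_tsupport hG hG₀ hu hC e h1 h2 fun ζ h4 h5 h6 h7 => ?_
    refine h ζ h4 h5 fun e' he' => ?_
    rcases Finset.mem_insert.1 he' with rfl | he'
    · exact h7
    · exact fun hmem => h3 e' he' (h6 hmem)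

/-- The cut-offs `unitBump (q / (n + 1))` tend to one, and their gradients are of order `1 / (n +
1)` uniformly, so dominated convergence removes the restriction to bounded supports. -/
theorem pairing_eq_zero_of_forall_cutoff (hG : ∀ i, MemLp (G i) 2 (volume.restrict W))
    (hG₀ : MemLp G₀ 2 (volume.restrict W)) (hu : HasWeakGradient W u g)
    (h : ∀ ξ : Pt → ℝ, ContDiff ℝ ∞ ξ → HasCompactSupport ξ →
      pairing W G G₀ (fun p => ξ p * u p)
        (fun i p => ξ p * g i p + fderiv ℝ ξ p (axis i) * u p) = 0) :
    pairing W G G₀ u g = 0 := by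
  have hbd : Differentiable ℝ unitBump := (unitBump.contDiff (n := 1)).differentiable (by simp)
  set b : ℕ → Pt → ℝ := fun n q => unitBump ((1 / ((n : ℝ) + 1)) • (q - 0))
  have hb : ∀ n, ContDiff ℝ ∞ (b n) := fun n => contDiff_comp_smul_sub unitBump.contDiff _ 0
  have hbc : ∀ n, HasCompactSupport (b n) := fun n => by
    have hn : (1 / ((n : ℝ) + 1)) ≠ 0 := by positivity
    exact unitBump.hasCompactSupport.comp_homeomorph
      ((Homeomorph.subRight (0 : Pt)).trans (Homeomorph.smulOfNeZero _ hn))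
  have hblim : ∀ p, Tendsto (fun n => b n p) atTop (𝓝 1) := by
    intro p
    have h1 : Tendsto (fun n : ℕ => (1 / ((n : ℝ) + 1)) • (p - 0)) atTop (𝓝 ((0 : ℝ) • (p - 0))) :=
      tendsto_one_div_add_atTop_nhds_zero_nat.smul_const _
    rw [zero_smul] at h1
    have h2 := (unitBump.continuous.tendsto 0).comp h1
    rwa [unitBump.one_of_mem_closedBall (Metric.mem_closedBall_self zero_le_one)] at h2
  obtain ⟨C, hC⟩ := exists_bound_fderiv_unitBump
  have hdb : ∀ n i p, fderiv ℝ (b n) p (axis i)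
      = 1 / ((n : ℝ) + 1) * fderiv ℝ unitBump ((1 / ((n : ℝ) + 1)) • (p - 0)) (axis i) :=
    fun n i p => fderiv_comp_smul_sub hbd _ _ _ _
  have hdle : ∀ n i p, |fderiv ℝ (b n) p (axis i)| ≤ 1 / ((n : ℝ) + 1) * C := by
    intro n i p
    rw [hdb, abs_mul, abs_of_nonneg (by positivity)]
    exact mul_le_mul_of_nonneg_left (hC i _) (by positivity)
  have hC0 : 0 ≤ C := (abs_nonneg _).trans (hC 0 0)
  have hdlim : ∀ i p, Tendsto (fun n => fderiv ℝ (b n) p (axis i)) atTop (𝓝 0) := by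
    intro i p
    refine squeeze_zero_norm (fun n => hdle n i p) ?_
    simpa using tendsto_one_div_add_atTop_nhds_zero_nat.mul_const C
  refine tendsto_nhds_unique (tendsto_pairing (un := fun n p => b n p * u p)
    (gn := fun n i p => b n p * g i p + fderiv ℝ (b n) p (axis i) * u p) (fun i => ?_) ?_)
    (tendsto_const_nhds.congr fun n => (h (b n) (hb n) (hbc n)).symm)
  · have i1 : Integrable (fun p => G i p * g i p) (volume.restrict W) :=
      (hG i).integrable_mul (hu.memLp_grad i)
    have i2 : Integrable (fun p => G i p * u p) (volume.restrict W) :=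
      (hG i).integrable_mul hu.memLp
    have h1 := tendsto_integral_mul_of_bounded (a := fun _ => 1) (C := 1) i1
      (fun n => (hb n).continuous.aestronglyMeasurable) (fun n p => abs_unitBump_le _)
      (.of_forall fun p => hblim p)
    have h2 := tendsto_integral_mul_of_bounded (a := fun _ => 0) (C := C) i2
      (fun n => (contDiff_fderiv_apply (hb n) (axis i)).continuous.aestronglyMeasurable)
      (fun n p => (hdle n i p).trans (mul_le_of_le_one_left hC0 (by
        rw [div_le_one (by positivity)]; linarith [n.cast_nonneg (α := ℝ)])))
      (.of_forall fun p => hdlim i p)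
    have h3 := h1.add h2
    simp only [mul_one, mul_zero, integral_zero, add_zero] at h3
    refine h3.congr fun n => ?_
    rw [← integral_add]
    · congr 1; ext p; ring
    · exact i1.mul_bdd (c := 1) (hb n).continuous.aestronglyMeasurable
        (.of_forall fun p => abs_unitBump_le _)
    · exact i2.mul_bdd (c := 1 / ((n : ℝ) + 1) * C)
        (contDiff_fderiv_apply (hb n) (axis i)).continuous.aestronglyMeasurable
        (.of_forall fun p => hdle n i p)
  · have i0 : Integrable (fun p => G₀ p * u p) (volume.restrict W) := hG₀.integrable_mul hu.memLp
    have h1 := tendsto_integral_mul_of_bounded (a := fun _ => 1) (C := 1) i0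
      (fun n => (hb n).continuous.aestronglyMeasurable) (fun n p => abs_unitBump_le _)
      (.of_forall fun p => hblim p)
    simp only [mul_one] at h1
    refine h1.congr fun n => ?_
    congr 1; ext p; ring

end WaterWaves

end Density

/-! ### Reduction to bounded functions, and the second claim. -/

section Truncation

namespace WaterWaves

variable {W : Set Pt} {u : Pt → ℝ} {g : Fin 3 → Pt → ℝ} {G : Fin 3 → Pt → ℝ} {G₀ : Pt → ℝ}

theorem integral_mul_fderiv_eq_neg {f η : Pt → ℝ} (hf : ContDiff ℝ ∞ f) (hη : ContDiff ℝ ∞ η)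
    (hηc : HasCompactSupport η) (v : Pt) :
    ∫ p, f p * fderiv ℝ η p v = - ∫ p, fderiv ℝ f p v * η p := by
  have hdf := (contDiff_fderiv_apply hf v).continuous
  have hdη := (contDiff_fderiv_apply hη v).continuous
  refine integral_mul_fderiv_eq_neg_fderiv_mul_of_integrable ?_ ?_ ?_
    (fun p _ => hf.differentiable (by simp) p) (fun p _ => hη.differentiable (by simp) p)
  · exact (hdf.mul hη.continuous).integrable_of_hasCompactSupport hηc.mul_left
  · exact (hf.continuous.mul hdη).integrable_of_hasCompactSupport
      (hasCompactSupport_fderiv_apply hηc v).mul_left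
  · exact (hf.continuous.mul hη.continuous).integrable_of_hasCompactSupport hηc.mul_left

/-- The chain rule for bounded smooth functions of elements of `H¹`. -/
theorem HasWeakGradient.comp_smooth (hu : HasWeakGradient W u g) (hW : IsOpen W) {T : ℝ → ℝ}
    (hT : ContDiff ℝ ∞ T) {C : ℝ} (hTC : ∀ s, |T s| ≤ C) (hTs : ∀ s, |T s| ≤ |s|)
    (hT1 : ∀ s, |deriv T s| ≤ 1) :
    HasWeakGradient W (fun p => T (u p)) (fun i p => deriv T (u p) * g i p) where
  memLp := hu.memLp.mono (hT.continuous.comp_aestronglyMeasurable hu.memLp.1)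
    (.of_forall fun p => hTs _)
  memLp_grad i := (hu.memLp_grad i).mono
    (((hT.continuous_deriv (by simp)).comp_aestronglyMeasurable hu.memLp.1).mul
      (hu.memLp_grad i).1) (.of_forall fun p => by
        rw [norm_mul]
        exact mul_le_of_le_one_left (norm_nonneg _) (hT1 _))
  weak i η hη hηc hηs := by
    have hdT := hT.continuous_deriv (by simp)
    have hf := memLp_indicator hW hu.memLp
    have hF := memLp_indicator hW (hu.memLp_grad i)
    have hloc : LocallyIntegrable (W.indicator u) volume := hf.locallyIntegrable (by norm_num)
    set K : ℕ → Pt → ℝ := fun n => (shrinkingBump n).normed volume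
    have hK : ∀ n, ContDiff ℝ ∞ (K n) := fun n => (shrinkingBump n).contDiff_normed
    have hKc : ∀ n, HasCompactSupport (K n) := fun n => (shrinkingBump n).hasCompactSupport_normed
    have hKz : ∀ n, ∀ z ∈ tsupport (K n), ‖z‖ ≤ (shrinkingBump n).rOut := fun n z hz => by
      rwa [(shrinkingBump n).tsupport_normed_eq, mem_closedBall_zero_iff] at hz
    set v : ℕ → Pt → ℝ := fun n => mollify volume (K n) (W.indicator u)
    have hv : ∀ n, ContDiff ℝ ∞ (v n) := fun n => contDiff_mollify (hK n) (hKc n) hloc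
    have hvlim : ∀ᵐ p, Tendsto (fun n => v n p) atTop (𝓝 (W.indicator u p)) :=
      ae_tendsto_mollify_shrinkingBump hloc
    have hη2 : MemLp η 2 volume := memLp_of_hasCompactSupport hη.continuous hηc
    have hdη : Integrable (fun p => fderiv ℝ η p (axis i)) volume :=
      (contDiff_fderiv_apply hη _).continuous.integrable_of_hasCompactSupport
        (hasCompactSupport_fderiv_apply hηc _)
    have l1 : Tendsto (fun n => ∫ p, fderiv ℝ η p (axis i) * T (v n p)) atTop
        (𝓝 (∫ p, fderiv ℝ η p (axis i) * T (W.indicator u p))) :=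
      tendsto_integral_mul_of_bounded hdη
        (fun n => (hT.continuous.comp (hv n).continuous).aestronglyMeasurable)
        (fun n p => hTC _) (hvlim.mono fun p hp => (hT.continuous.tendsto _).comp hp)
    have hFη : Integrable (fun p => W.indicator (g i) p * η p) volume := hF.integrable_mul hη2
    have l2 : Tendsto (fun n => ∫ p, W.indicator (g i) p * η p * deriv T (v n p)) atTop
        (𝓝 (∫ p, W.indicator (g i) p * η p * deriv T (W.indicator u p))) :=
      tendsto_integral_mul_of_bounded hFη
        (fun n => (hdT.comp (hv n).continuous).aestronglyMeasurable)
        (fun n p => hT1 _) (hvlim.mono fun p hp => (hdT.tendsto _).comp hp)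
    have hA : ∀ n, MemLp (fun p => deriv T (v n p) * η p) 2 volume := fun n =>
      memLp_of_hasCompactSupport ((hdT.comp (hv n).continuous).mul hη.continuous) hηc.mul_left
    have hD : ∀ n, MemLp (fun p => mollify volume (K n) (W.indicator (g i)) p
        - W.indicator (g i) p) 2 volume := fun n => (memLp_mollify (hK n) (hKc n) hF).sub hF
    have l3 : Tendsto (fun n => ∫ p, deriv T (v n p) * η p
        * (mollify volume (K n) (W.indicator (g i)) p - W.indicator (g i) p)) atTop (𝓝 0) := by
      have hsq := tendsto_integral_sq_mollify_sub hF hK hKc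
        (fun n z => (shrinkingBump n).nonneg_normed z) (fun n => (shrinkingBump n).integral_normed)
        tendsto_shrinkingBump_rOut fun n z hz => by
          by_contra hne
          exact absurd (hKz n z (subset_tsupport _ hne)) (not_le.2 hz)
      have h1 := (hsq.const_mul (∫ p, η p ^ 2)).sqrt
      rw [mul_zero, Real.sqrt_zero] at h1
      refine squeeze_zero_norm (fun n => ?_) h1
      refine Real.abs_le_sqrt ((sq_integral_mul_le' (hA n) (hD n)).trans ?_)
      refine mul_le_mul_of_nonneg_right ?_ (integral_nonneg fun p => sq_nonneg _)
      refine integral_mono (hA n).integrable_sq hη2.integrable_sq fun p => ?_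
      simp only [mul_pow]
      exact mul_le_of_le_one_left (sq_nonneg _) ((sq_le_one_iff_abs_le_one _).2 (hT1 _))
    -- Kernels of radius less than `δ` see only points of `W` from the support of `η`, so the
    -- classical chain rule for the mollifications involves mollified weak derivatives.
    obtain ⟨δ, hδ, hδW⟩ := hηc.isCompact.exists_cthickening_subset_open hW hηs
    have hev : ∀ᶠ n in atTop, ∫ p, fderiv ℝ η p (axis i) * T (v n p)
        = - ((∫ p, W.indicator (g i) p * η p * deriv T (v n p))
          + ∫ p, deriv T (v n p) * η p
            * (mollify volume (K n) (W.indicator (g i)) p - W.indicator (g i) p)) := by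
      filter_upwards [tendsto_shrinkingBump_rOut.eventually (gt_mem_nhds hδ)] with n hn
      have h1 := integral_mul_fderiv_eq_neg (hT.comp (hv n)) hη hηc (axis i)
      have e1 : ∀ p, fderiv ℝ (T ∘ v n) p (axis i) * η p
          = W.indicator (g i) p * η p * deriv T (v n p) + deriv T (v n p) * η p
            * (mollify volume (K n) (W.indicator (g i)) p - W.indicator (g i) p) := by
        intro p
        by_cases hp : p ∈ tsupport η
        · have h2 := ((hT.differentiable (by simp) (v n p)).hasDerivAt.comp_hasFDerivAt p
            ((hv n).differentiable (by simp) p).hasFDerivAt).fderiv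
          rw [h2]
          have h3 := hu.fderiv_mollify_indicator hW (hK n) (hKc n) (q := p) (fun z hz => hδW ?_) i
          · change fderiv ℝ (v n) p (axis i) = _ at h3
            simp only [FunLike.coe_smul, Pi.smul_apply, smul_eq_mul, h3]
            ring
          · refine Metric.mem_cthickening_of_dist_le _ p _ _ hp ?_
            rw [dist_eq_norm, sub_sub_cancel_left, norm_neg]
            exact (hKz n z hz).trans hn.le
        · simp [image_eq_zero_of_notMem_tsupport hp]
      simp only [e1] at h1
      rw [integral_add] at h1
      · rw [← h1]
        congr 1
        ext p
        rw [mul_comm, Function.comp_apply]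
      · exact hFη.mul_bdd (c := 1) (hdT.comp (hv n).continuous).aestronglyMeasurable
          (.of_forall fun p => hT1 _)
      · exact (hA n).integrable_mul (hD n)
    have l4 := (l2.add l3).neg
    rw [add_zero] at l4
    have key := tendsto_nhds_unique l1 (l4.congr' (hev.mono fun n hn => hn.symm))
    have hz : ∀ p, p ∉ W → η p = 0 := fun p hp =>
      image_eq_zero_of_notMem_tsupport fun h => hp (hηs h)
    have hz' : ∀ p, p ∉ W → fderiv ℝ η p (axis i) = 0 := fun p hp => by
      rw [image_eq_zero_of_notMem_tsupport fun h => hp (hηs (tsupport_fderiv_subset ℝ h)),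
        zero_apply]
    rw [setIntegral_eq_integral_of_forall_compl_eq_zero (fun p hp => by rw [hz' p hp, mul_zero]),
      setIntegral_eq_integral_of_forall_compl_eq_zero (fun p hp => by rw [hz p hp, mul_zero])]
    convert key using 2
    · ext p
      by_cases hp : p ∈ W
      · rw [indicator_of_mem hp, mul_comm]
      · rw [hz' p hp, mul_zero, zero_mul]
    · congr 1
      ext p
      by_cases hp : p ∈ W
      · rw [indicator_of_mem hp, indicator_of_mem hp]; ring
      · rw [hz p hp]; ring

/-- A smooth substitute for truncation at height `m > 0`: it is bounded by `m` and by `|s|`, its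
slope `cos(s / m)` is at most one in modulus, and as `m → ∞` it tends to the identity and its slope
to one. -/
theorem contDiff_sin_div (m : ℝ) : ContDiff ℝ ∞ fun s => m * Real.sin (s / m) :=
  contDiff_const.mul (Real.contDiff_sin.comp (contDiff_id.div_const m))

theorem deriv_sin_div {m : ℝ} (hm : 0 < m) (s : ℝ) :
    deriv (fun s => m * Real.sin (s / m)) s = Real.cos (s / m) := by
  have h := (((hasDerivAt_id s).div_const m).sin).const_mul m
  have h2 : deriv (fun s => m * Real.sin (s / m)) s = _ := h.deriv
  rw [h2]
  simp
  field_simp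

theorem abs_sin_div_le {m : ℝ} (hm : 0 < m) (s : ℝ) : |m * Real.sin (s / m)| ≤ |s| := by
  have h : |Real.sin (s / m)| ≤ |s / m| := Real.abs_sin_le_abs
  rw [abs_mul, abs_of_pos hm]
  calc m * |Real.sin (s / m)| ≤ m * |s / m| := by gcongr
    _ = |s| := by rw [abs_div, abs_of_pos hm]; field_simp

theorem tendsto_sin_div (s : ℝ) :
    Tendsto (fun n : ℕ => ((n : ℝ) + 1) * Real.sin (s / ((n : ℝ) + 1))) atTop (𝓝 s) := by
  have h1 := Real.hasDerivAt_sin 0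
  have h2 : HasDerivAt (fun x : ℝ => Real.sin (x * s)) s 0 := by
    have := ((hasDerivAt_id (0 : ℝ)).mul_const s).sin
    simpa using this
  have h3 := hasDerivAt_iff_tendsto_slope_zero.1 h2
  have h4 : Tendsto (fun n : ℕ => 1 / ((n : ℝ) + 1)) atTop (𝓝[≠] 0) :=
    tendsto_nhdsWithin_iff.2 ⟨tendsto_one_div_add_atTop_nhds_zero_nat, .of_forall fun n => by
      have : (0 : ℝ) < 1 / ((n : ℝ) + 1) := by positivity
      exact this.ne'⟩
  refine (h3.comp h4).congr fun n => ?_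
  simp only [Function.comp_apply, zero_add, zero_mul, Real.sin_zero, sub_zero, smul_eq_mul, one_div,
    inv_inv]
  rw [inv_mul_eq_div]

theorem tendsto_cos_div (s : ℝ) :
    Tendsto (fun n : ℕ => Real.cos (s / ((n : ℝ) + 1))) atTop (𝓝 1) := by
  have h : Tendsto (fun n : ℕ => s * (1 / ((n : ℝ) + 1))) atTop (𝓝 (s * 0)) :=
    tendsto_one_div_add_atTop_nhds_zero_nat.const_mul s
  rw [mul_zero] at h
  have := (Real.continuous_cos.tendsto 0).comp h
  rw [Real.cos_zero] at this
  refine this.congr fun n => ?_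
  simp [div_eq_mul_inv]

theorem pairing_eq_zero_of_forall_bounded (hW : IsOpen W)
    (hG : ∀ i, MemLp (G i) 2 (volume.restrict W)) (hG₀ : MemLp G₀ 2 (volume.restrict W))
    (hu : HasWeakGradient W u g)
    (h : ∀ (v : Pt → ℝ) (f : Fin 3 → Pt → ℝ) (C : ℝ), HasWeakGradient W v f → (∀ p, |v p| ≤ C) →
      pairing W G G₀ v f = 0) : pairing W G G₀ u g = 0 := by
  have hm : ∀ n : ℕ, (0 : ℝ) < (n : ℝ) + 1 := fun n => by positivity
  have hz : ∀ n : ℕ, pairing W G G₀ (fun p => ((n : ℝ) + 1) * Real.sin (u p / ((n : ℝ) + 1)))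
      (fun i p => Real.cos (u p / ((n : ℝ) + 1)) * g i p) = 0 := by
    intro n
    have hb : ∀ s : ℝ, |((n : ℝ) + 1) * Real.sin (s / ((n : ℝ) + 1))| ≤ (n : ℝ) + 1 := fun s => by
      rw [abs_mul, abs_of_pos (hm n)]
      exact mul_le_of_le_one_right (hm n).le (Real.abs_sin_le_one _)
    have h1 := hu.comp_smooth hW (contDiff_sin_div ((n : ℝ) + 1)) hb (abs_sin_div_le (hm n))
      (fun s => by rw [deriv_sin_div (hm n)]; exact Real.abs_cos_le_one _)
    simp only [deriv_sin_div (hm n)] at h1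
    exact h _ _ _ h1 fun p => hb _
  refine tendsto_nhds_unique (tendsto_pairing
    (un := fun (n : ℕ) p => ((n : ℝ) + 1) * Real.sin (u p / ((n : ℝ) + 1)))
    (gn := fun (n : ℕ) i p => Real.cos (u p / ((n : ℝ) + 1)) * g i p) (fun i => ?_) ?_)
    (tendsto_const_nhds.congr fun n => (hz n).symm)
  · have i1 : Integrable (fun p => G i p * g i p) (volume.restrict W) :=
      (hG i).integrable_mul (hu.memLp_grad i)
    have h1 := tendsto_integral_mul_of_bounded (a := fun _ => 1) (C := 1) i1
      (an := fun n p => Real.cos (u p / ((n : ℝ) + 1)))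
      (fun n => (Real.continuous_cos.comp (continuous_id.div_const _)).comp_aestronglyMeasurable
        hu.memLp.1) (fun n p => Real.abs_cos_le_one _) (.of_forall fun p => tendsto_cos_div _)
    simp only [mul_one] at h1
    refine h1.congr fun n => ?_
    congr 1; ext p; ring
  · have i0 : Integrable (fun p => G₀ p * u p) (volume.restrict W) := hG₀.integrable_mul hu.memLp
    refine tendsto_integral_of_dominated_convergence (fun p => |G₀ p * u p|) (fun n => ?_) i0.abs
      (fun n => .of_forall fun p => ?_) (.of_forall fun p => (tendsto_sin_div _).const_mul _)
    · exact hG₀.1.mul ((contDiff_sin_div _).continuous.comp_aestronglyMeasurable hu.memLp.1)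
    · rw [Real.norm_eq_abs, abs_mul, abs_mul (G₀ p)]
      exact mul_le_mul_of_nonneg_left (abs_sin_div_le (hm n) _) (abs_nonneg _)

/-- In a domain with Lipschitz boundary, up to finitely many points, the restrictions of smooth
functions with compact support are dense in `H¹`. -/
theorem HasLipschitzBoundary.pairing_eq_zero (hLip : HasLipschitzBoundary W) (hW : IsOpen W)
    (hG : ∀ i, MemLp (G i) 2 (volume.restrict W)) (hG₀ : MemLp G₀ 2 (volume.restrict W))
    (hsm : ∀ ψ : Pt → ℝ, ContDiff ℝ ∞ ψ → HasCompactSupport ψ →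
      pairing W G G₀ ψ (fun i p => fderiv ℝ ψ p (axis i)) = 0)
    (hu : HasWeakGradient W u g) : pairing W G G₀ u g = 0 := by
  obtain ⟨E, hE, hLip⟩ := hLip
  have hcone : ∀ p ∉ E, HasInwardCone W p := by
    intro p hp
    by_cases hpW : p ∈ W
    · exact hasInwardCone_of_mem hW hpW
    by_cases hpc : p ∈ closure W
    · exact (hLip p ⟨⟨hpc, by rwa [hW.interior_eq]⟩, hp⟩).hasInwardCone
    · exact hasInwardCone_of_notMem_closure hpc
  -- Truncation comes first, because the removal of the exceptional points needs a bounded function.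
  refine pairing_eq_zero_of_forall_bounded hW hG hG₀ hu fun v f C hv hC =>
    pairing_eq_zero_of_forall_cutoff hG hG₀ hv (pairing_eq_zero_of_finset hG hG₀ hv hC hE.toFinset
      fun ξ hξ hξc hξE => pairing_eq_zero_of_forall_cone hW hG hG₀ hsm hv hξ hξc fun p hp =>
        hcone p fun hpE => hξE p (hE.mem_toFinset.2 hpE) hp)

variable {α ν : ℝ} {Wc : Set Pt} {φ : Pt → ℝ}

/-- The vertical formula with `M(y) = y + 1`, which is one at the surface and zero at the bottom,
replaces the trace by integrals over the layer. The surface term thus becomes a functional with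
square integrable coefficients, with no separate continuity theorem for traces. -/
theorem integral_trace_mul_eq (hWc : IsCliffRegion α Wc) {t s : ℝ × ℝ → ℝ}
    (ht : MemLp t 2 (volume.restrict (sector α))) {ψ : Pt → ℝ} {h : Fin 3 → Pt → ℝ}
    (hψ : HasWeakGradient (waterDomain α Wc) ψ h) (hs : HasTrace α ψ s) :
    ∫ x in sector α, t x * s x
      = (∫ p in layer α, h 2 p * (t p.1 * (p.2 + 1))) + ∫ p in layer α, ψ p * (t p.1 * 1) := by
  have hW := layer_subset α Wc
  have hM : ContDiff ℝ ∞ fun y : ℝ => y + 1 := contDiff_id.add contDiff_const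
  have hd : deriv (fun y : ℝ => y + 1) = fun _ => 1 := by ext y; simp
  have h1 := hψ.ae_vertical hW hWc.isOpen hs hM (by norm_num)
  rw [hd] at h1
  have hl := hψ.memLp_layer hW
  have hgl := hψ.memLp_grad_layer hW 2
  rw [integral_layer_mul_eq_sector hgl ht hM.continuous,
    integral_layer_mul_eq_sector hl ht continuous_const]
  have j1 : Integrable (fun x => t x * ∫ y in (-1)..0, (y + 1) * h 2 (x, y))
    (volume.restrict (sector α)) := ht.integrable_mul (memLp_integral_fiber hgl hM.continuous)
  have j2 : Integrable (fun x => t x * ∫ y in (-1)..0, 1 * ψ (x, y))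
    (volume.restrict (sector α)) := ht.integrable_mul (memLp_integral_fiber hl continuous_const)
  rw [← integral_add j1 j2]
  refine integral_congr_ae ?_
  filter_upwards [h1] with x hx
  rw [← mul_add, ← hx]
  ring

theorem hasWeakGradient_of_contDiff {W : Set Pt} {ψ : Pt → ℝ}
    (hψ : ContDiff ℝ ∞ ψ) (hψc : HasCompactSupport ψ) :
    HasWeakGradient W ψ (fun i p => fderiv ℝ ψ p (axis i)) where
  memLp := (memLp_of_hasCompactSupport hψ.continuous hψc).restrict _
  memLp_grad i := (memLp_of_hasCompactSupport (contDiff_fderiv_apply hψ _).continuous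
    (hasCompactSupport_fderiv_apply hψc _)).restrict _
  weak i η hη hηc hηs := by
    rw [setIntegral_eq_integral_of_forall_compl_eq_zero (fun p hp => by
        rw [image_eq_zero_of_notMem_tsupport fun h => hp (hηs (tsupport_fderiv_subset ℝ h)),
          zero_apply, mul_zero]),
      setIntegral_eq_integral_of_forall_compl_eq_zero (fun p hp => by
        rw [image_eq_zero_of_notMem_tsupport fun h => hp (hηs h), mul_zero])]
    exact integral_mul_fderiv_eq_neg hψ hη hηc _

theorem hasTrace_of_contDiff {ψ : Pt → ℝ} (hψ : ContDiff ℝ ∞ ψ) (hψc : HasCompactSupport ψ) :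
    HasTrace α ψ (fun x => ψ (x, 0)) := by
  obtain ⟨K, hK⟩ := hψ.lipschitzWith_of_hasCompactSupport hψc (by simp)
  obtain ⟨R, hR⟩ := hψc.isCompact.isBounded.subset_closedBall (0 : Pt)
  have hc : IsClosedEmbedding fun x : ℝ × ℝ => ((x, 0) : Pt) := by
    refine IsClosedEmbedding.of_continuous_injective_isClosedMap (by fun_prop)
      (fun x y h => congrArg Prod.fst h) ?_
    intro s hs
    have : (fun x : ℝ × ℝ => ((x, 0) : Pt)) '' s = s ×ˢ {0} := by
      ext p
      simp [Prod.ext_iff, eq_comm]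
    rw [this]
    exact hs.prod isClosed_singleton
  have hm : MemLp (fun x => ψ (x, 0)) 2 (volume.restrict (sector α)) :=
    memLp_sector_of_hasCompactSupport (hψ.continuous.comp hc.continuous)
      (hψc.comp_isClosedEmbedding hc)
  have hκ : MemLp ((Metric.closedBall (0 : ℝ × ℝ) R).indicator fun _ => (K : ℝ)) 2
      (volume.restrict (sector α)) :=
    (memLp_indicator_const 2 Metric.isClosed_closedBall.measurableSet _
      (Or.inr (isCompact_closedBall _ _).measure_lt_top.ne)).restrict _
  refine hasTrace_of_abs_sub_le hm hκ fun p _ => ?_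
  by_cases hp : p.1 ∈ Metric.closedBall (0 : ℝ × ℝ) R
  · rw [indicator_of_mem hp, ← Real.dist_eq]
    refine (hK.dist_le_mul p (p.1, 0)).trans (le_of_eq ?_)
    simp [Prod.dist_eq]
  · have h0 : ∀ y : ℝ, ψ (p.1, y) = 0 := fun y => image_eq_zero_of_notMem_tsupport fun h => hp (by
      have := hR h
      rw [mem_closedBall_zero_iff] at this ⊢
      exact (norm_fst_le ((p.1, y) : Pt)).trans this)
    rw [indicator_of_notMem hp, zero_mul, h0, ← Prod.mk.eta (p := p), h0]
    simp

/-- In domains with Lipschitz boundary, smooth test functions suffice. -/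
theorem IsSmoothlyTestedWeakSolution.isWeakSolution (hWc : IsCliffRegion α Wc)
    (hLip : HasLipschitzBoundary (waterDomain α Wc))
    (h : IsSmoothlyTestedWeakSolution α Wc ν φ) : IsWeakSolution α Wc ν φ := by
  obtain ⟨g, t, hφ, ht, hsol⟩ := h
  refine ⟨g, t, hφ, ht, fun ψ h s hψ hs => ?_⟩
  have hW := layer_subset α Wc
  have hWo := hWc.isOpen
  set W := waterDomain α Wc
  have m2 : MemLp (fun p : Pt => t p.1 * (p.2 + 1)) 2 (volume.restrict (layer α)) :=
    memLp_layer_mul ht.memLp (m := fun y => y + 1) (by fun_prop)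
  have m0 : MemLp (fun p : Pt => t p.1 * 1) 2 (volume.restrict (layer α)) :=
    memLp_layer_mul ht.memLp (m := fun _ => 1) continuous_const
  have n2 := (memLp_indicator_layer m2 W).const_mul ν
  have n0 := (memLp_indicator_layer m0 W).const_mul (-ν)
  -- The coefficients are chosen so that the pairing with `ψ` is the residual `∫ ∇φ·∇ψ - ν ∫ φψ` of
  -- the equation.
  set G : Fin 3 → Pt → ℝ := fun i p => g i p - if i = 2 then
    ν * (layer α).indicator (fun p : Pt => t p.1 * (p.2 + 1)) p else 0
  set G₀ : Pt → ℝ := fun p => -ν * (layer α).indicator (fun p : Pt => t p.1 * 1) p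
  have hG : ∀ i, MemLp (G i) 2 (volume.restrict W) := by
    intro i
    by_cases hi : i = 2
    · simp only [G, hi, if_true]
      exact (hφ.memLp_grad 2).sub n2
    · simp only [G, hi, if_false, sub_zero]
      exact hφ.memLp_grad i
  have hpair : ∀ {ψ : Pt → ℝ} {h : Fin 3 → Pt → ℝ} {s : ℝ × ℝ → ℝ}, HasWeakGradient W ψ h →
      HasTrace α ψ s → pairing W G G₀ ψ h
        = (∫ p in W, ∑ i, g i p * h i p) - ν * ∫ x in sector α, t x * s x := by
    intro ψ h s hψ hs
    rw [integral_trace_mul_eq hWc ht.memLp hψ hs]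
    have hgi : ∀ i, Integrable (fun p => g i p * h i p) (volume.restrict W) := fun i =>
      (hφ.memLp_grad i).integrable_mul (hψ.memLp_grad i)
    rw [integral_finsetSum _ fun i _ => hgi i, pairing, Fin.sum_univ_three, Fin.sum_univ_three]
    have e2 : ∫ p in W, G 2 p * h 2 p = (∫ p in W, g 2 p * h 2 p)
        - ν * ∫ p in layer α, h 2 p * (t p.1 * (p.2 + 1)) := by
      have i2 : Integrable (fun p => ν * (layer α).indicator (fun p : Pt => t p.1 * (p.2 + 1)) p
        * h 2 p) (volume.restrict W) := n2.integrable_mul (hψ.memLp_grad 2)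
      simp only [G, if_true, sub_mul]
      rw [integral_sub (hgi 2) i2]
      simp only [mul_assoc ν]
      rw [integral_const_mul, setIntegral_indicator_mul hW]
      simp only [mul_comm]
    have e0 : ∫ p in W, G₀ p * ψ p = -ν * ∫ p in layer α, ψ p * (t p.1 * 1) := by
      simp only [G₀, mul_assoc]
      rw [integral_const_mul, setIntegral_indicator_mul hW]
      congr 2
      ext p
      ring
    have e00 : ∫ p in W, G 0 p * h 0 p = ∫ p in W, g 0 p * h 0 p := by simp [G]
    have e01 : ∫ p in W, G 1 p * h 1 p = ∫ p in W, g 1 p * h 1 p := by simp [G]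
    rw [e2, e0, e00, e01]
    ring
  have key := hLip.pairing_eq_zero hWo hG n0 (fun η hη hηc => by
    rw [hpair (hasWeakGradient_of_contDiff hη hηc) (hasTrace_of_contDiff hη hηc),
      hsol η hη hηc, sub_self]) hψ
  rw [hpair hψ hs] at key
  linarith

end WaterWaves

end Truncation

theorem theorem1 (α : ℝ) (hα : α ∈ Ioo 0 (Real.pi / 2)) (Wc : Set Pt)
    (hWc : IsCliffRegion α Wc) (ν : ℝ) (hν : 0 < ν) (φ : Pt → ℝ)
    (hφ : MemH1 (waterDomain α Wc) φ) :
    (IsWeakSolution α Wc ν φ → φ =ᵐ[volume.restrict (waterDomain α Wc)] 0) ∧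
    (HasLipschitzBoundary (waterDomain α Wc) → IsSmoothlyTestedWeakSolution α Wc ν φ →
      φ =ᵐ[volume.restrict (waterDomain α Wc)] 0) :=
  ⟨fun h => h.ae_eq_zero hα hWc hν, fun hLip h => (h.isWeakSolution hWc hLip).ae_eq_zero hα hWc hν⟩
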